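/- **Setting.** Let $n\in\mathbb N$, $\langle x\rangle=(1+|x|^2)^{1/2}$, and $\mathscr Ff(\xi)=\int_{\mathbb R^n}f(x)e^{-2\pi i x\cdot\xi}\,dx$, extended to the tempered distributions $\mathscr S'(\mathbb R^n)$. For $\alpha\in[0,1)$ fix a family of smooth functions $(\eta_k^\alpha)_{k\in\mathbb Z^n}$ and constants $0<C_1<C_2$, $C_m$ ($m\in\mathbb N$) such that $|\eta_k^\alpha(\xi)|=1$ if $|\xi-\langle k\rangle^{\frac{\alpha}{1-\alpha}}k|\le C_1\langle k\rangle^{\frac{\alpha}{1-\alpha}}$; $\operatorname{supp}\eta_k^\alpha\subset\{\xi:|\xi-\langle k\rangle^{\frac{\alpha}{1-\alpha}}k|\le C_2\langle k\rangle^{\frac{\alpha}{1-\alpha}}\}$; $\sum_k\eta_k^\alpha\equiv1$; and $|\partial^\gamma\eta_k^\alpha(\xi)|\le C_{|\gamma|}\langle k\rangle^{-\frac{\alpha|\gamma|}{1-\alpha}}$ for all $\xi$ and $\gamma$. For $1\le p,q\le\infty$ and $s\in\mathbb R$ let $M^{p,q}_{s,\alpha}$ be the space of all $f\in\mathscr S'(\mathbb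 R^n)$ with $$\|f\|_{M^{p,q}_{s,\alpha}}=\Big(\sum_{k\in\mathbb Z^n}\langle k\rangle^{\frac{sq}{1-\alpha}}\|\mathscr F^{-1}(\eta_k^\alpha\mathscr Ff)\|_{L^p}^q\Big)^{1/q}<\infty$$ (supremum over $k$ if $q=\infty$). For $\alpha=1$, $M^{p,q}_{s,1}$ is the inhomogeneous Besov space $B^{p,q}_s$, with norm $\big(\sum_{j\ge0}2^{jsq}\|\mathscr F^{-1}(\phi_j\mathscr Ff)\|_{L^p}^q\big)^{1/q}$ (supremum over $j$ if $q=\infty$), where $\phi_0=\varphi$ and $\phi_j(\xi)=\varphi(2^{-j}\xi)-\varphi(2^{1-j}\xi)$ for $j\ge1$, for a fixed smooth $\varphi:\mathbb R^n\to[0,1]$ supported in $\{|\xi|\le3/2\}$ and equal to $1$ on $\{|\xi|\le4/3\}$. A function $h$ belongs to $\mathscr FM^{p,q}_{s,\alpha}$ if it defines a tempered distribution and $\mathscr F^{-1}h\in M^{p,q}_{s,\alpha}$. For a function $m$ and $f,g\in\mathscr S'(\mathbb R^n)$ we write $g=m(D)f=\mathscr F^{-1}(m\,\mathscr Ff)$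 if the product is given locally by convolution, that is, if $$\langle g,\theta\rangle=\int_{\mathbb R^n}\mathscr F^{-1}(\chi m)(y)\,\langle f,\theta(\cdot+y)\rangle\,dy,$$ with absolute convergence, for all $\theta\in\mathscr S(\mathbb R^n)$ such that $\mathscr F^{-1}\theta$ has compact support and all $\chi\in C_c^\infty(\mathbb R^n)$ with $\chi=1$ on $\operatorname{supp}\mathscr F^{-1}\theta$. **Theorem (boundedness for endpoints).** Let $1\le p,q\le\infty$, $s\in\mathbb R$, $\alpha\in[0,1]$, and let $\mu\in C^2(\mathbb R^n)$ be a real-valued function satisfying $$\partial^\gamma\mu\in\mathscr FM^{1,\infty}_{2\alpha-2s,\alpha}\quad\text{for all multi-indices }\gamma\text{ with }|\gamma|=2.$$ Then, for every $\delta\ge\max\{s,0\}$, the operator $$e^{i\mu(D)}:M^{p,q}_{\delta n,\alpha}\to M^{p,q}_{0,\alpha}$$ is well defined and bounded: for every $f\in M^{p,q}_{\delta n,\alpha}$ there is exactly one $e^{i\mu(D)}f\in\mathscr S'(\mathbb R^n)$, and $\|e^{i\mu(D)}f\|_{M^{p,q}_{0,\alpha}}\le C\|f\|_{M^{p,q}_{\delta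 n,\alpha}}$ with a constant $C$ independent of $f$. -/

import Mathlib

open scoped SchwartzMap FourierTransform ENNReal NNReal ContDiff
open MeasureTheory

noncomputable section

/-- Euclidean space `ℝⁿ`. -/
abbrev RSpace (n : ℕ) : Type := EuclideanSpace ℝ (Fin n)

/-- The Japanese bracket `⟨k⟩ = (1 + |k|²)^{1/2}` of a lattice point `k ∈ ℤⁿ`. -/
def latticeBracket {n : ℕ} (k : Fin n → ℤ) : ℝ :=
  Real.sqrt (1 + ∑ i, (k i : ℝ) ^ 2)

/-- The point `⟨k⟩^{α/(1-α)} k` of `ℝⁿ`, around which the `k`-th window is centred. -/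
def alphaCenter {n : ℕ} (α : ℝ) (k : Fin n → ℤ) : RSpace n :=
  latticeBracket k ^ (α / (1 - α)) • WithLp.toLp 2 (fun i => (k i : ℝ))

/-- A smooth partition of unity `(η_k)_{k ∈ ℤⁿ}` subordinate to the `α`-covering, `0 ≤ α < 1`:
`|η_k| = 1` on the ball of radius `C₁⟨k⟩^{α/(1-α)}` about `⟨k⟩^{α/(1-α)}k`, the support lies in
the ball of radius `C₂⟨k⟩^{α/(1-α)}` about that point, the `η_k` sum up to one, and the
derivatives of order `m` are bounded by `C_m⟨k⟩^{-αm/(1-α)}`. -/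
structure IsAlphaPartition {n : ℕ} (α : ℝ) (η : (Fin n → ℤ) → RSpace n → ℂ) : Prop where
  smooth : ∀ k, ContDiff ℝ ∞ (η k)
  localized : ∃ C₁ C₂ : ℝ, 0 < C₁ ∧ C₁ < C₂ ∧ ∀ k,
    (∀ ξ, ‖ξ - alphaCenter α k‖ ≤ C₁ * latticeBracket k ^ (α / (1 - α)) → ‖η k ξ‖ = 1) ∧
    tsupport (η k) ⊆
      Metric.closedBall (alphaCenter α k) (C₂ * latticeBracket k ^ (α / (1 - α)))
  sum_eq_one : ∀ ξ, HasSum (fun k => η k ξ) 1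
  deriv_le : ∀ m : ℕ, ∃ C : ℝ, ∀ k ξ,
    ‖iteratedFDeriv ℝ m (η k) ξ‖ ≤ C * latticeBracket k ^ (-(α * m) / (1 - α))

/-- The bump function generating the dyadic (Littlewood–Paley) decomposition. -/
structure IsDyadicBump {n : ℕ} (φ : RSpace n → ℝ) : Prop where
  smooth : ContDiff ℝ ∞ φ
  mem_Icc : ∀ ξ, φ ξ ∈ Set.Icc (0 : ℝ) 1
  support_subset : tsupport φ ⊆ Metric.closedBall 0 (3 / 2)
  eq_one : ∀ ξ, ‖ξ‖ ≤ 4 / 3 → φ ξ = 1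

/-- The dyadic windows: `φ_0 = φ` and `φ_j(ξ) = φ(2^{-j}ξ) - φ(2·2^{-j}ξ)` for `j ≥ 1`. -/
def dyadicWindow {n : ℕ} (φ : RSpace n → ℝ) (j : ℕ) (ξ : RSpace n) : ℂ :=
  if j = 0 then (φ ξ : ℂ)
  else ((φ (((2 : ℝ) ^ j)⁻¹ • ξ) - φ ((2 * ((2 : ℝ) ^ j)⁻¹) • ξ) : ℝ) : ℂ)

/-- The data from which a frequency decomposition norm is built: a family of windows on the
frequency side, and for each window the size of the frequencies it lives on. -/
structure FrequencyDecomposition (n : ℕ) where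
  Index : Type
  size : Index → ℝ
  window : Index → RSpace n → ℂ

/-- The decompositions defining the `α`-modulation spaces, `α ∈ [0,1]`: for `α < 1` the
partitions of unity subordinate to the `α`-covering, where the weight of order `s` is
`(⟨k⟩^{1/(1-α)})^s = ⟨k⟩^{s/(1-α)}`; for `α = 1` the dyadic ones, where it is `(2^j)^s`. -/
inductive IsAlphaDecomposition {n : ℕ} (α : ℝ) : FrequencyDecomposition n → Prop
  | ofAlphaPartition (h0 : 0 ≤ α) (h1 : α < 1) (η : (Fin n → ℤ) → RSpace n → ℂ)
      (hη : IsAlphaPartition α η) :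
      IsAlphaDecomposition α ⟨Fin n → ℤ, fun k => latticeBracket k ^ (1 / (1 - α)), η⟩
  | ofDyadic (h : α = 1) (φ : RSpace n → ℝ) (hφ : IsDyadicBump φ) :
      IsAlphaDecomposition α ⟨ℕ, fun j => (2 : ℝ) ^ j, dyadicWindow φ⟩

/-- The `L^p` norm of a tempered distribution; it is `∞` if the distribution is not given by a
function in `L^p`. -/
def distributionLpNorm {n : ℕ} (p : ℝ≥0∞) [Fact (1 ≤ p)] (T : 𝓢'(RSpace n, ℂ)) : ℝ≥0∞ :=
  ⨅ (h : Lp ℂ p (volume : Measure (RSpace n))) (_ : Lp.toTemperedDistribution h = T), ‖h‖ₑ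

/-- The `ℓ^q` norm of a family in `[0,∞]`. -/
def lqNorm {ι : Type} (q : ℝ≥0∞) (a : ι → ℝ≥0∞) : ℝ≥0∞ :=
  if q = ⊤ then ⨆ i, a i else (∑' i, a i ^ q.toReal) ^ (1 / q.toReal)

/-- The norm of `M^{p,q}_{s,α}` built from the decomposition `D`: the `ℓ^q` norm of
`size^s ‖𝓕⁻¹ (window · 𝓕 f)‖_{L^p}`. The space consists of the tempered distributions for which
it is finite. -/
def alphaModulationNorm {n : ℕ} (D : FrequencyDecomposition n) (p q : ℝ≥0∞) [Fact (1 ≤ p)]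
    (s : ℝ) (f : 𝓢'(RSpace n, ℂ)) : ℝ≥0∞ :=
  lqNorm q fun k => ENNReal.ofReal (D.size k ^ s) *
    distributionLpNorm p (TemperedDistribution.fourierMultiplierCLM ℂ (D.window k) f)

/-- The function `h` on `ℝⁿ` belongs to `𝓕M^{p,q}_{s,α}`: the distribution defined by `h` is
tempered, and its inverse Fourier transform belongs to `M^{p,q}_{s,α}`. -/
def MemFourierAlphaModulation {n : ℕ} (D : FrequencyDecomposition n) (p q : ℝ≥0∞)
    [Fact (1 ≤ p)] (s : ℝ) (h : RSpace n → ℂ) : Prop :=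
  LocallyIntegrable h ∧ ∃ u : 𝓢'(RSpace n, ℂ),
    (∀ θ : 𝓢(RSpace n, ℂ), HasCompactSupport θ → u θ = ∫ ξ, h ξ * θ ξ) ∧
    alphaModulationNorm D p q s (𝓕⁻ u) < ⊤

/-- `g = m(D) f = 𝓕⁻¹ (m · 𝓕 f)` for tempered distributions `f`, `g` and a function `m` that need
not be smooth. The product of the function `m` with the distribution `𝓕 f` is the usual local one,
defined through absolutely convergent convolutions on the other side of the Fourier transform:
for every Schwartz function `θ` whose inverse Fourier transform is compactly supported, and every
test function `φ` that equals one on that support, with `K = 𝓕⁻¹ (φ m)`, one has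
`⟨g, θ⟩ = ⟨K * f, θ⟩ = ∫ K(y) ⟨f, θ(· + y)⟩ dy`, where the integral converges absolutely. -/
def IsFourierMultiplierImage {n : ℕ} (m : RSpace n → ℂ) (f g : 𝓢'(RSpace n, ℂ)) : Prop :=
  ∀ (φ : RSpace n → ℂ) (θ : 𝓢(RSpace n, ℂ)),
    ContDiff ℝ ∞ φ → HasCompactSupport φ →
    HasCompactSupport (𝓕⁻ θ : 𝓢(RSpace n, ℂ)) →
    (∀ ξ ∈ tsupport (𝓕⁻ θ : 𝓢(RSpace n, ℂ)), φ ξ = 1) →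
    Integrable (fun y : RSpace n =>
      𝓕⁻ (fun ξ => φ ξ * m ξ) y * f (θ.compSubConstCLM ℂ (-y))) ∧
    g θ = ∫ y : RSpace n, 𝓕⁻ (fun ξ => φ ξ * m ξ) y * f (θ.compSubConstCLM ℂ (-y))

/-- The Fourier multiplier `m(D)` is a well-defined bounded operator from `M^{p,q}_{s₁,α}` to
`M^{p,q}_{s₂,α}`: every `f` in the first space has exactly one image `m(D) f`, and the norms
satisfy `‖m(D) f‖ ≤ C ‖f‖` with `C` independent of `f`. -/
def IsBoundedMultiplier {n : ℕ} (D : FrequencyDecomposition n) (p q : ℝ≥0∞) [Fact (1 ≤ p)]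
    (s₁ s₂ : ℝ) (m : RSpace n → ℂ) : Prop :=
  ∃ C : ℝ≥0, ∀ f : 𝓢'(RSpace n, ℂ), alphaModulationNorm D p q s₁ f < ⊤ →
    ∃ g : 𝓢'(RSpace n, ℂ), (∀ g' : 𝓢'(RSpace n, ℂ), IsFourierMultiplierImage m f g' ↔ g' = g) ∧
      alphaModulationNorm D p q s₂ g ≤ C * alphaModulationNorm D p q s₁ f

/-- The second order partial derivative `∂_i ∂_j μ` at `ξ`; with `i`, `j` arbitrary these are all
the `∂^γ μ` with `|γ| = 2`. -/
def secondPartial {n : ℕ} (μ : RSpace n → ℝ) (i j : Fin n) (ξ : RSpace n) : ℝ :=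
  iteratedFDeriv ℝ 2 μ ξ ![EuclideanSpace.single i 1, EuclideanSpace.single j 1]

end

section FourierBound

variable {V : Type*} [NormedAddCommGroup V] [InnerProductSpace ℝ V] [FiniteDimensional ℝ V]
  [MeasurableSpace V] [BorelSpace V]

theorem norm_fourier_le_integral_norm (g : V → ℂ) (x : V) : ‖𝓕 g x‖ ≤ ∫ y, ‖g y‖ :=
  VectorFourier.norm_fourierIntegral_le_integral_norm _ _ _ _ _

theorem norm_fourierInv_le_integral_norm (g : V → ℂ) (x : V) : ‖𝓕⁻ g x‖ ≤ ∫ y, ‖g y‖ := by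
  rw [Real.fourierInv_eq_fourier_neg]
  exact norm_fourier_le_integral_norm g _

theorem integral_fourier_mul_eq {f g : V → ℂ} (hf : Integrable f) (hg : Integrable g) :
    ∫ ξ, 𝓕 f ξ * g ξ = ∫ x, f x * 𝓕 g x := by
  have := VectorFourier.integral_fourierIntegral_smul_eq_flip (μ := (volume : Measure V))
    (ν := (volume : Measure V)) (L := innerₗ V) Real.continuous_fourierChar
    (by simpa using continuous_inner) hf hg
  simpa [Real.fourier_eq, VectorFourier.fourierIntegral, real_inner_comm] using this

theorem integral_fourierInv_mul_eq {f g : V → ℂ} (hf : Integrable f) (hg : Integrable g) :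
    ∫ ξ, 𝓕⁻ f ξ * g ξ = ∫ x, f x * 𝓕⁻ g x := by
  have := integral_fourier_mul_eq hf.comp_neg hg
  simp only [← Real.fourierInv_eq_fourier_comp_neg] at this
  rw [this, ← integral_neg_eq_self]
  simp [Real.fourierInv_eq_fourier_neg]

theorem continuous_fourier_of_integrable {f : V → ℂ} (hf : Integrable f) : Continuous (𝓕 f) :=
  VectorFourier.fourierIntegral_continuous Real.continuous_fourierChar
    (by simpa using continuous_inner) hf

theorem continuous_fourierInv_of_integrable {f : V → ℂ} (hf : Integrable f) :
    Continuous (𝓕⁻ f) := by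
  have : 𝓕⁻ f = fun x => 𝓕 f (-x) := funext fun x => Real.fourierInv_eq_fourier_neg f x
  rw [this]
  exact (continuous_fourier_of_integrable hf).comp continuous_neg

/-- `F` is a bounded continuous function which acts with norm at most `a` on integrable functions
when those are normed by the supremum of their Fourier transform. Equivalently, `F` is the Fourier
transform of a measure of total mass at most `a`. -/
structure HasFourierBound (F : V → ℂ) (a : ℝ) : Prop where
  nonneg : 0 ≤ a
  continuous : Continuous F
  bounded : ∃ C, ∀ ξ, ‖F ξ‖ ≤ C
  norm_integral_le : ∀ g : V → ℂ, Integrable g → ∀ M, (∀ x, ‖𝓕 g x‖ ≤ M) →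
    ‖∫ ξ, F ξ * g ξ‖ ≤ a * M

namespace HasFourierBound

variable {F G : V → ℂ} {a b : ℝ}

theorem integrable_mul (hF : HasFourierBound F a) {g : V → ℂ} (hg : Integrable g) :
    Integrable fun ξ => F ξ * g ξ := by
  obtain ⟨C, hC⟩ := hF.bounded
  exact hg.bdd_mul hF.continuous.aestronglyMeasurable (ae_of_all _ hC)

theorem norm_fourier_mul_le (hF : HasFourierBound F a) {g : V → ℂ} (hg : Integrable g) {M : ℝ}
    (hM : ∀ x, ‖𝓕 g x‖ ≤ M) (x : V) : ‖𝓕 (fun ξ => F ξ * g ξ) x‖ ≤ a * M := by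
  have h := hF.norm_integral_le (fun ξ => Real.fourierChar (-inner ℝ ξ x) • g ξ)
    ((Real.fourierIntegral_convergent_iff x).2 hg) M (fun y => by
      convert hM (y + x) using 2
      simp only [Real.fourier_eq, smul_smul, inner_add_right, neg_add, AddChar.map_add_eq_mul])
  rw [Real.fourier_eq]
  refine (le_of_eq ?_).trans h
  simp only [Circle.smul_def, smul_eq_mul, mul_left_comm]

theorem mono (hF : HasFourierBound F a) (hab : a ≤ b) : HasFourierBound F b where
  nonneg := hF.nonneg.trans hab
  continuous := hF.continuous
  bounded := hF.bounded
  norm_integral_le g hg M hM := (hF.norm_integral_le g hg M hM).trans <|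
    mul_le_mul_of_nonneg_right hab ((norm_nonneg _).trans (hM 0))

protected theorem zero : HasFourierBound (fun _ : V => (0 : ℂ)) 0 where
  nonneg := le_rfl
  continuous := continuous_const
  bounded := ⟨0, by simp⟩
  norm_integral_le g hg M hM := by simp

protected theorem one : HasFourierBound (fun _ : V => (1 : ℂ)) 1 where
  nonneg := zero_le_one
  continuous := continuous_const
  bounded := ⟨1, by simp⟩
  norm_integral_le g hg M hM := by simpa [Real.fourier_eq] using hM 0

theorem add (hF : HasFourierBound F a) (hG : HasFourierBound G b) :
    HasFourierBound (fun ξ => F ξ + G ξ) (a + b) where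
  nonneg := add_nonneg hF.nonneg hG.nonneg
  continuous := hF.continuous.add hG.continuous
  bounded := by
    obtain ⟨C, hC⟩ := hF.bounded
    obtain ⟨C', hC'⟩ := hG.bounded
    exact ⟨C + C', fun ξ => norm_add_le_of_le (hC ξ) (hC' ξ)⟩
  norm_integral_le g hg M hM := by
    simp only [add_mul]
    rw [integral_add (hF.integrable_mul hg) (hG.integrable_mul hg)]
    exact norm_add_le_of_le (hF.norm_integral_le g hg M hM) (hG.norm_integral_le g hg M hM)

theorem sum {ι : Type*} (s : Finset ι) {F : ι → V → ℂ} {a : ι → ℝ}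
    (h : ∀ i ∈ s, HasFourierBound (F i) (a i)) :
    HasFourierBound (fun ξ => ∑ i ∈ s, F i ξ) (∑ i ∈ s, a i) := by
  classical
  induction s using Finset.induction_on with
  | empty => simpa using HasFourierBound.zero
  | insert i s his ih =>
    simp only [Finset.sum_insert his]
    exact (h i (by simp)).add (ih fun j hj => h j (by simp [hj]))

theorem mul (hF : HasFourierBound F a) (hG : HasFourierBound G b) :
    HasFourierBound (fun ξ => F ξ * G ξ) (a * b) where
  nonneg := mul_nonneg hF.nonneg hG.nonneg
  continuous := hF.continuous.mul hG.continuous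
  bounded := by
    obtain ⟨C, hC⟩ := hF.bounded
    obtain ⟨C', hC'⟩ := hG.bounded
    exact ⟨C * C', fun ξ => norm_mul_le_of_le (hC ξ) (hC' ξ)⟩
  norm_integral_le g hg M hM := by
    simp only [mul_assoc]
    exact hF.norm_integral_le _ (hG.integrable_mul hg) _ (hG.norm_fourier_mul_le hg hM)

theorem const_mul (hF : HasFourierBound F a) (c : ℂ) :
    HasFourierBound (fun ξ => c * F ξ) (‖c‖ * a) where
  nonneg := mul_nonneg (norm_nonneg _) hF.nonneg
  continuous := continuous_const.mul hF.continuous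
  bounded := by
    obtain ⟨C, hC⟩ := hF.bounded
    exact ⟨‖c‖ * C, fun ξ => norm_mul_le_of_le le_rfl (hC ξ)⟩
  norm_integral_le g hg M hM := by
    simp only [mul_assoc]
    rw [integral_const_mul, norm_mul]
    exact mul_le_mul_of_nonneg_left (hF.norm_integral_le g hg M hM) (norm_nonneg _)

theorem pow (hF : HasFourierBound F a) (k : ℕ) : HasFourierBound (fun ξ => F ξ ^ k) (a ^ k) := by
  induction k with
  | zero => simpa using HasFourierBound.one
  | succ k ih => simpa only [pow_succ] using ih.mul hF

theorem of_tendsto {F : ℕ → V → ℂ} {G : V → ℂ} {C : ℝ} (hF : ∀ N, HasFourierBound (F N) a)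
    (hC : ∀ N ξ, ‖F N ξ‖ ≤ C) (hG : Continuous G)
    (h : ∀ ξ, Filter.Tendsto (fun N => F N ξ) Filter.atTop (nhds (G ξ))) :
    HasFourierBound G a where
  nonneg := (hF 0).nonneg
  continuous := hG
  bounded := ⟨C, fun ξ => le_of_tendsto (h ξ).norm (Filter.Eventually.of_forall fun N => hC N ξ)⟩
  norm_integral_le g hg M hM := by
    refine le_of_tendsto (Filter.Tendsto.norm <|
      tendsto_integral_of_dominated_convergence (F := fun N ξ => F N ξ * g ξ) (fun ξ => C * ‖g ξ‖)
        (fun N => ((hF N).integrable_mul hg).aestronglyMeasurable) (hg.norm.const_mul C)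
        (fun N => ae_of_all _ fun ξ => norm_mul_le_of_le (hC N ξ) le_rfl)
        (ae_of_all _ fun ξ => (h ξ).mul_const _))
      (Filter.Eventually.of_forall fun N => (hF N).norm_integral_le g hg M hM)

theorem cexp (hF : HasFourierBound F a) :
    HasFourierBound (fun ξ => Complex.exp (F ξ)) (Real.exp a) := by
  obtain ⟨C, hC⟩ := hF.bounded
  have hC0 : 0 ≤ C := (norm_nonneg _).trans (hC 0)
  refine of_tendsto (F := fun N ξ => ∑ k ∈ Finset.range N, ((k.factorial : ℂ)⁻¹) * F ξ ^ k)
    (C := Real.exp C) (fun N => ?_) (fun N ξ => ?_)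
    (Complex.continuous_exp.comp hF.continuous) (fun ξ => ?_)
  · refine (HasFourierBound.sum (Finset.range N) fun k _ =>
      (hF.pow k).const_mul ((k.factorial : ℂ)⁻¹)).mono ?_
    refine le_trans (le_of_eq ?_) (Real.sum_le_exp_of_nonneg hF.nonneg N)
    refine Finset.sum_congr rfl fun k _ => ?_
    rw [norm_inv, Complex.norm_natCast, div_eq_inv_mul]
  · refine le_trans (norm_sum_le_of_le _ fun k _ => ?_) (Real.sum_le_exp_of_nonneg hC0 N)
    rw [norm_mul, norm_inv, Complex.norm_natCast, norm_pow, div_eq_inv_mul]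
    gcongr
    exact hC ξ
  · have := (NormedSpace.expSeries_div_hasSum_exp (F ξ)).tendsto_sum_nat
    rw [← Complex.exp_eq_exp_ℂ] at this
    simpa only [div_eq_inv_mul] using this

theorem comp_affine (hF : HasFourierBound F a) {t : ℝ} (ht : t ≠ 0) (c : V) :
    HasFourierBound (fun ξ => F (t • ξ + c)) a where
  nonneg := hF.nonneg
  continuous := hF.continuous.comp (by fun_prop)
  bounded := by
    obtain ⟨C, hC⟩ := hF.bounded
    exact ⟨C, fun ξ => hC _⟩
  norm_integral_le g hg M hM := by
    set d := Module.finrank ℝ V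
    have key : ∀ Φ : V → ℂ, ∫ ξ, Φ (t • ξ + c) = |(t ^ d)⁻¹| • ∫ ζ, Φ ζ := fun Φ => by
      rw [Measure.integral_comp_smul volume (fun ζ => Φ (ζ + c)) t, integral_add_right_eq_self]
    have htd : 0 < |(t ^ d)⁻¹| := by positivity
    have hsub : ∀ ξ, t⁻¹ • (t • ξ + c - c) = ξ := fun ξ => by
      rw [add_sub_cancel_right, smul_smul, inv_mul_cancel₀ ht, one_smul]
    have hG : Integrable fun ζ => g (t⁻¹ • (ζ - c)) :=
      (hg.comp_smul (inv_ne_zero ht)).comp_sub_right c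
    have hGM : ∀ x, ‖𝓕 (fun ζ => g (t⁻¹ • (ζ - c))) x‖ ≤ |(t ^ d)⁻¹|⁻¹ * M := fun x => by
      have h := key fun ζ => Real.fourierChar (-inner ℝ ζ x) • g (t⁻¹ • (ζ - c))
      simp only [hsub] at h
      rw [le_inv_mul_iff₀ htd, Real.fourier_eq, ← Real.norm_of_nonneg htd.le, ← norm_smul, ← h]
      have h2 : ∀ ξ, Real.fourierChar (-inner ℝ (t • ξ + c) x) • g ξ =
          Real.fourierChar (-inner ℝ c x) • Real.fourierChar (-inner ℝ ξ (t • x)) • g ξ :=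
        fun ξ => by
          rw [smul_smul, ← AddChar.map_add_eq_mul, inner_add_left, real_inner_smul_left,
            real_inner_smul_right, neg_add, add_comm]
      simp only [h2]
      simp only [Circle.smul_def (Real.fourierChar (-inner ℝ c x))]
      rw [integral_smul, ← Circle.smul_def, Circle.norm_smul, ← Real.fourier_eq]
      exact hM _
    have h1 := hF.norm_integral_le _ hG _ hGM
    have h := key fun ζ => F ζ * g (t⁻¹ • (ζ - c))
    simp only [hsub] at h
    rw [h, norm_smul, Real.norm_of_nonneg htd.le]
    calc |(t ^ d)⁻¹| * _ ≤ |(t ^ d)⁻¹| * (a * (|(t ^ d)⁻¹|⁻¹ * M)) := by gcongr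
      _ = a * M := by field_simp

theorem average (hF : HasFourierBound F a) (c : V) :
    HasFourierBound (fun ξ => ∫ t in (0 : ℝ)..1, (1 - t : ℂ) * F (c + t • (ξ - c))) a where
  nonneg := hF.nonneg
  continuous := by
    have := hF.continuous
    refine intervalIntegral.continuous_parametric_intervalIntegral_of_continuous' ?_ 0 1
    simp only [Function.uncurry_def]
    fun_prop
  bounded := by
    obtain ⟨C, hC⟩ := hF.bounded
    refine ⟨C * |1 - 0|, fun ξ => intervalIntegral.norm_integral_le_of_norm_le_const
      fun t ht => ?_⟩
    rw [Set.uIoc_of_le zero_le_one] at ht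
    calc ‖(1 - t : ℂ) * F (c + t • (ξ - c))‖ ≤ 1 * C := by
          refine norm_mul_le_of_le ?_ (hC _)
          rw [← Complex.ofReal_one, ← Complex.ofReal_sub, Complex.norm_real, Real.norm_eq_abs,
            abs_of_nonneg (by linarith [ht.2])]
          linarith [ht.1]
      _ = C := one_mul C
  norm_integral_le g hg M hM := by
    obtain ⟨C, hC⟩ := hF.bounded
    have hcont := hF.continuous
    simp only [intervalIntegral.integral_of_le zero_le_one, ← integral_mul_const]
    have hint : Integrable (Function.uncurry fun (ξ : V) (t : ℝ) =>
        (1 - t : ℂ) * F (c + t • (ξ - c)) * g ξ)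
        (volume.prod (volume.restrict (Set.Ioc (0 : ℝ) 1))) := by
      have hg2 := hg.comp_fst (volume.restrict (Set.Ioc (0 : ℝ) 1))
      have hmeas : ∀ᵐ z : V × ℝ ∂(volume.prod (volume.restrict (Set.Ioc (0 : ℝ) 1))),
          z.2 ∈ Set.Ioc (0 : ℝ) 1 := by
        have := ae_restrict_mem (μ := (volume : Measure ℝ)) (measurableSet_Ioc (a := 0) (b := 1))
        exact Measure.quasiMeasurePreserving_snd.ae this
      simp only [Function.uncurry_def]
      refine hg2.bdd_mul (c := 1 * C) (Continuous.aestronglyMeasurable (by fun_prop)) ?_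
      filter_upwards [hmeas] with z hz
      refine norm_mul_le_of_le ?_ (hC _)
      rw [← Complex.ofReal_one, ← Complex.ofReal_sub, Complex.norm_real, Real.norm_eq_abs,
        abs_of_nonneg (by linarith [hz.2])]
      linarith [hz.1]
    rw [integral_integral_swap hint, ← intervalIntegral.integral_of_le zero_le_one]
    have := intervalIntegral.norm_integral_le_of_norm_le_const (a := (0 : ℝ)) (b := 1)
      (C := a * M) (f := fun t : ℝ => ∫ ξ, (1 - t : ℂ) * F (c + t • (ξ - c)) * g ξ) ?_
    · simpa using this
    intro t ht
    rw [Set.uIoc_of_le zero_le_one] at ht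
    simp only [mul_assoc]
    rw [integral_const_mul]
    have h1 := (hF.comp_affine ht.1.ne' (c - t • c)).norm_integral_le g hg M hM
    have h2 : ∀ ξ, t • ξ + (c - t • c) = c + t • (ξ - c) := fun ξ => by
      rw [smul_sub]; abel
    simp only [h2] at h1
    calc _ ≤ 1 * (a * M) := by
          refine norm_mul_le_of_le ?_ h1
          rw [← Complex.ofReal_one, ← Complex.ofReal_sub, Complex.norm_real, Real.norm_eq_abs,
            abs_of_nonneg (by linarith [ht.2])]
          linarith [ht.1]
      _ = a * M := one_mul _

theorem phase (r : ℝ) (v : V) :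
    HasFourierBound (fun ξ => Complex.exp (Complex.I * ((r + inner ℝ v ξ : ℝ) : ℂ))) 1 where
  nonneg := zero_le_one
  continuous := by fun_prop
  bounded := ⟨1, fun ξ => by rw [mul_comm, Complex.norm_exp_ofReal_mul_I]⟩
  norm_integral_le g hg M hM := by
    have h : ∀ ξ, Complex.exp (Complex.I * ((r + inner ℝ v ξ : ℝ) : ℂ)) * g ξ =
        Complex.exp (r * Complex.I) *
          (Real.fourierChar (-inner ℝ ξ (-(2 * Real.pi)⁻¹ • v)) • g ξ) := fun ξ => by
      rw [Circle.smul_def, Real.fourierChar_apply, smul_eq_mul, ← mul_assoc, ← Complex.exp_add,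
        real_inner_smul_right, real_inner_comm v ξ]
      congr 2
      push_cast
      have : (Real.pi : ℂ) ≠ 0 := by exact_mod_cast Real.pi_ne_zero
      field_simp
    simp only [h]
    rw [integral_const_mul, ← Real.fourier_eq, norm_mul, Complex.norm_exp_ofReal_mul_I]
    exact mul_le_mul_of_nonneg_left (hM _) zero_le_one

theorem of_fourier {h : V → ℂ} (hh : Integrable h) (hF : Continuous F)
    (hFh : F =ᵐ[volume] 𝓕 h) : HasFourierBound F (∫ x, ‖h x‖) := by
  have hF' : F = 𝓕 h := Continuous.ae_eq_iff_eq volume hF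
    (continuous_fourier_of_integrable hh) |>.1 hFh
  subst hF'
  refine ⟨integral_nonneg fun _ => norm_nonneg _, hF,
    ⟨_, norm_fourier_le_integral_norm h⟩, fun g hg M hM => ?_⟩
  rw [integral_fourier_mul_eq hh hg, ← integral_mul_const]
  exact norm_integral_le_of_norm_le (hh.norm.mul_const M)
    (ae_of_all _ fun x => norm_mul_le_of_le le_rfl (hM x))

theorem of_schwartz (ψ : 𝓢(V, ℂ)) : HasFourierBound ψ (∫ x, ‖𝓕⁻ (ψ : V → ℂ) x‖) := by
  have h := (𝓕⁻ ψ : 𝓢(V, ℂ)).integrable (μ := volume)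
  rw [SchwartzMap.fourierInv_coe] at h
  refine of_fourier h ψ.continuous (Filter.EventuallyEq.of_eq ?_)
  rw [← SchwartzMap.fourierInv_coe, ← SchwartzMap.fourier_coe,
    FourierTransform.fourier_fourierInv_eq]

/-- A function with a Fourier bound is an `L¹` Fourier multiplier. -/
theorem integrable_fourierInv_mul (hF : HasFourierBound F a) (ψ : 𝓢(V, ℂ)) :
    Integrable (𝓕⁻ fun ξ => ψ ξ * F ξ) ∧
      ∫ x, ‖𝓕⁻ (fun ξ => ψ ξ * F ξ) x‖ ≤ a * ∫ x, ‖𝓕 (ψ : V → ℂ) x‖ := by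
  have hψ : Integrable (ψ : V → ℂ) := ψ.integrable
  have hψF : Integrable fun ξ => ψ ξ * F ξ := by
    simpa only [mul_comm] using hF.integrable_mul hψ
  have hψ' : Integrable (𝓕 (ψ : V → ℂ)) := by
    rw [← SchwartzMap.fourier_coe]
    exact (𝓕 ψ : 𝓢(V, ℂ)).integrable
  set k := 𝓕⁻ fun ξ => ψ ξ * F ξ
  set I := ∫ x, ‖𝓕 (ψ : V → ℂ) x‖
  have hI : 0 ≤ I := integral_nonneg fun _ => norm_nonneg _
  have hk : Continuous k := continuous_fourierInv_of_integrable hψF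
  have key : ∀ R : ℝ, ∫ x in Metric.closedBall 0 R, ‖k x‖ ≤ a * I := by
    intro R
    set B := Metric.closedBall (0 : V) R
    have hB : MeasurableSet B := Metric.isClosed_closedBall.measurableSet
    let h : V → ℂ := B.indicator fun x => (‖k x‖ : ℂ) / k x
    have hh1 : ∀ x, ‖h x‖ ≤ 1 := fun x => by
      by_cases hx : x ∈ B
      · simp only [h, Set.indicator_of_mem hx, norm_div, Complex.norm_real, norm_norm]
        exact div_self_le_one _
      · simp [h, hx]
    have hhmeas : Measurable h := by
      refine Measurable.indicator ?_ hB
      exact (Complex.measurable_ofReal.comp hk.norm.measurable).div hk.measurable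
    have hh : Integrable h := by
      have : IntegrableOn (fun x => (‖k x‖ : ℂ) / k x) B := by
        refine Measure.integrableOn_of_bounded (M := 1)
          (isCompact_closedBall (0 : V) R).measure_lt_top.ne
          ((Complex.measurable_ofReal.comp hk.norm.measurable).div
            hk.measurable).aestronglyMeasurable (ae_of_all _ fun x => ?_)
        simp only [norm_div, Complex.norm_real, norm_norm]
        exact div_self_le_one _
      exact this.integrable_indicator hB
    have h1 : ((∫ x in B, ‖k x‖ : ℝ) : ℂ) = ∫ x, k x * h x := by
      rw [← integral_complex_ofReal, ← integral_indicator hB]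
      refine integral_congr_ae (ae_of_all _ fun x => ?_)
      by_cases hx : x ∈ B
      · by_cases hkx : k x = 0
        · simp [h, hx, hkx]
        · simp only [h, Set.indicator_of_mem hx]
          field_simp
      · simp [h, hx]
    have hψh : Integrable fun ξ => ψ ξ * 𝓕⁻ h ξ :=
      hψ.mul_bdd (c := ∫ y, ‖h y‖)
        (continuous_fourierInv_of_integrable hh).aestronglyMeasurable
        (ae_of_all _ fun x => norm_fourierInv_le_integral_norm h x)
    have h2 : ∫ x, k x * h x = ∫ ξ, F ξ * (ψ ξ * 𝓕⁻ h ξ) := by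
      rw [integral_fourierInv_mul_eq hψF hh]
      refine integral_congr_ae (ae_of_all _ fun ξ => ?_)
      simp only
      ring
    have h3 : ∀ x, ‖𝓕 (fun ξ => ψ ξ * 𝓕⁻ h ξ) x‖ ≤ I := by
      intro x
      have e1 : 𝓕 (fun ξ => ψ ξ * 𝓕⁻ h ξ) x =
          ∫ ξ, (Real.fourierChar (-inner ℝ ξ x) • ψ ξ) * 𝓕⁻ h ξ := by
        rw [Real.fourier_eq]
        simp only [Circle.smul_def, smul_eq_mul, mul_assoc]
      have e2 : ∀ y, 𝓕⁻ (fun ξ => Real.fourierChar (-inner ℝ ξ x) • ψ ξ) y = 𝓕 (ψ : V → ℂ) (x - y) := by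
        intro y
        rw [Real.fourierInv_eq, Real.fourier_eq]
        refine integral_congr_ae (ae_of_all _ fun ξ => ?_)
        simp only
        rw [smul_smul, ← AddChar.map_add_eq_mul, inner_sub_right]
        congr 2
        ring
      rw [e1, ← integral_fourierInv_mul_eq ((Real.fourierIntegral_convergent_iff x).2 hψ) hh]
      simp only [e2]
      calc ‖∫ y, 𝓕 (ψ : V → ℂ) (x - y) * h y‖ ≤ ∫ y, ‖𝓕 (ψ : V → ℂ) (x - y)‖ :=
            norm_integral_le_of_norm_le (hψ'.comp_sub_left x).norm
              (ae_of_all _ fun y => by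
                rw [norm_mul]; exact mul_le_of_le_one_right (norm_nonneg _) (hh1 y))
        _ = I := integral_sub_left_eq_self (fun y => ‖𝓕 (ψ : V → ℂ) y‖) volume x
    have h4 := hF.norm_integral_le _ hψh I h3
    rw [← h2, ← h1, Complex.norm_real] at h4
    exact (le_abs_self _).trans h4
  have hcover := aecover_closedBall (μ := (volume : Measure V)) (x := (0 : V))
    (l := Filter.atTop) (r := fun R : ℝ => R) Filter.tendsto_id
  have hint : Integrable k :=
    hcover.integrable_of_integral_norm_bounded (a * I)
      (fun R => hk.continuousOn.integrableOn_compact (isCompact_closedBall (0 : V) R))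
      (Filter.Eventually.of_forall key)
  exact ⟨hint, le_of_tendsto (hcover.integral_tendsto_of_countably_generated hint.norm)
    (Filter.Eventually.of_forall key)⟩

end HasFourierBound

end FourierBound

section WindowKernel

variable {V : Type*} [NormedAddCommGroup V] [InnerProductSpace ℝ V] [FiniteDimensional ℝ V]
  [MeasurableSpace V] [BorelSpace V]

theorem integral_norm_fourier_comp_smul (g : V → ℂ) {R : ℝ} (hR : 0 < R) :
    ∫ x, ‖𝓕 (fun ζ => g (R • ζ)) x‖ = ∫ x, ‖𝓕 g x‖ := by
  set d := Module.finrank ℝ V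
  have h : ∀ x, 𝓕 (fun ζ => g (R • ζ)) x = |(R ^ d)⁻¹| • 𝓕 g (R⁻¹ • x) := fun x => by
    have := Measure.integral_comp_smul volume
      (fun ζ : V => Real.fourierChar (-inner ℝ ζ (R⁻¹ • x)) • g ζ) R
    rw [Real.fourier_eq, Real.fourier_eq, ← this]
    refine integral_congr_ae (ae_of_all _ fun ζ => ?_)
    simp only [real_inner_smul_left, real_inner_smul_right]
    rw [← mul_assoc, inv_mul_cancel₀ hR.ne', one_mul]
  simp only [h, norm_smul, Real.norm_eq_abs, abs_abs]
  rw [integral_const_mul, Measure.integral_comp_inv_smul volume (fun x => ‖𝓕 g x‖), smul_eq_mul,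
    ← mul_assoc, ← abs_mul, inv_mul_cancel₀ (by positivity), abs_one, one_mul]

theorem exists_integral_norm_fourier_le_of_unit_scale (C : ℝ) (D : ℕ → ℝ) :
    ∃ B, ∀ (η : V → ℂ) (c : V), ContDiff ℝ ∞ η → tsupport η ⊆ Metric.closedBall c C →
      (∀ m ξ, ‖iteratedFDeriv ℝ m η ξ‖ ≤ D m) → ∫ x, ‖𝓕 η x‖ ≤ B := by
  set d := Module.finrank ℝ V
  set N := d + 1
  set W := (volume : Measure V).real (Metric.closedBall 0 C)
  set J : ℕ → ℝ := fun m => (2 * (0 : ℕ) + 2) ^ m * ∑ p ∈ Finset.range (0 + 1) ×ˢ Finset.range (m + 1),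
    D p.2 * W with hJ
  refine ⟨∫ x : V, (2 ^ N * (J 0 + J N)) * (1 + ‖x‖) ^ (-(N : ℝ)), fun η c hη hsupp hD => ?_⟩
  have hcomp : HasCompactSupport η :=
    HasCompactSupport.of_support_subset_isCompact (isCompact_closedBall c C)
      ((subset_tsupport η).trans hsupp)
  have hint : ∀ m, Integrable fun v => ‖iteratedFDeriv ℝ m η v‖ := fun m =>
    ((hη.continuous_iteratedFDeriv (by exact_mod_cast le_top)).norm.integrable_of_hasCompactSupport
      (hcomp.iteratedFDeriv m).norm)
  have hle : ∀ m, ∫ v, ‖iteratedFDeriv ℝ m η v‖ ≤ D m * W := fun m => by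
    have h0 : ∀ v ∉ Metric.closedBall c C, ‖iteratedFDeriv ℝ m η v‖ = 0 := fun v hv => by
      rw [norm_eq_zero]
      exact image_eq_zero_of_notMem_tsupport
        fun h => hv (hsupp (tsupport_iteratedFDeriv_subset m h))
    rw [← setIntegral_eq_integral_of_forall_compl_eq_zero h0]
    have hW : W = (volume : Measure V).real (Metric.closedBall c C) := by
      simp only [W, Measure.real, Measure.addHaar_closedBall_center]
    rw [hW]
    have := norm_setIntegral_le_of_norm_le_const (μ := (volume : Measure V)) (s := Metric.closedBall c C)
      (f := fun v => ‖iteratedFDeriv ℝ m η v‖) (C := D m)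
      (isCompact_closedBall c C).measure_lt_top (fun v _ => by simpa using hD m v)
    exact (le_abs_self _).trans this
  have hdec : ∀ m x, ‖x‖ ^ m * ‖𝓕 η x‖ ≤ J m := fun m x => by
    have := Real.pow_mul_norm_iteratedFDeriv_fourier_le (K := 0) (N := ⊤) (f := η) hη
      (fun k m hk _ => by
        have : k = 0 := by simpa using hk
        simpa [this] using hint m) (k := 0) (n := m) (by simp) le_top x
    simp only [norm_iteratedFDeriv_zero, pow_zero, one_mul] at this
    refine this.trans ?_
    simp only [hJ]
    gcongr with p hp
    have : p.1 = 0 := by simpa using (Finset.mem_product.1 hp).1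
    simpa [this] using hle p.2
  refine integral_mono_of_nonneg (ae_of_all _ fun _ => norm_nonneg _)
    ((integrable_one_add_norm (by simp [N, d])).const_mul _) (ae_of_all _ fun x => ?_)
  simp only
  rw [Real.rpow_neg (by positivity), Real.rpow_natCast, ← div_eq_mul_inv,
    le_div_iff₀ (by positivity)]
  have h1 : (1 + ‖x‖) ^ N ≤ 2 ^ N * (1 + ‖x‖ ^ N) := by
    have := add_pow_le (zero_le_one (α := ℝ)) (norm_nonneg x) N
    rw [one_pow] at this
    refine this.trans ?_
    gcongr
    · norm_num
    · omega
  calc ‖𝓕 η x‖ * (1 + ‖x‖) ^ N ≤ ‖𝓕 η x‖ * (2 ^ N * (1 + ‖x‖ ^ N)) := by gcongr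
    _ = 2 ^ N * (‖x‖ ^ 0 * ‖𝓕 η x‖ + ‖x‖ ^ N * ‖𝓕 η x‖) := by ring
    _ ≤ 2 ^ N * (J 0 + J N) := by gcongr <;> exact hdec _ _

theorem exists_integral_norm_fourier_le (C : ℝ) (D : ℕ → ℝ) :
    ∃ B, ∀ (η : V → ℂ) (c : V) (R : ℝ), 0 < R → ContDiff ℝ ∞ η →
      tsupport η ⊆ Metric.closedBall c (C * R) →
      (∀ m ξ, ‖iteratedFDeriv ℝ m η ξ‖ ≤ D m * (R ^ m)⁻¹) → ∫ x, ‖𝓕 η x‖ ≤ B := by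
  obtain ⟨B, hB⟩ := exists_integral_norm_fourier_le_of_unit_scale (V := V) C D
  refine ⟨B, fun η c R hR hη hsupp hD => ?_⟩
  rw [← integral_norm_fourier_comp_smul η hR]
  refine hB _ (R⁻¹ • c) (hη.comp (contDiff_const_smul R)) ?_ fun m ξ => ?_
  · refine closure_minimal (fun ξ hξ => ?_) Metric.isClosed_closedBall
    have := hsupp (subset_tsupport η hξ)
    rw [Metric.mem_closedBall, dist_eq_norm] at this ⊢
    have e : ξ - R⁻¹ • c = R⁻¹ • (R • ξ - c) := by
      rw [smul_sub, smul_smul, inv_mul_cancel₀ hR.ne', one_smul]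
    rw [e, norm_smul, norm_inv, Real.norm_of_nonneg hR.le, inv_mul_le_iff₀ hR]
    linarith
  · rw [iteratedFDeriv_comp_const_smul R (hη.of_le (by exact_mod_cast le_top)), norm_smul, norm_pow,
      Real.norm_of_nonneg hR.le]
    calc R ^ m * ‖iteratedFDeriv ℝ m η (R • ξ)‖ ≤ R ^ m * (D m * (R ^ m)⁻¹) := by
          gcongr; exact hD _ _
      _ = D m := by field_simp

end WindowKernel

section Taylor

variable {E : Type*} [NormedAddCommGroup E] [NormedSpace ℝ E]

theorem taylor_integral_remainder_two {f : E → ℝ} (hf : ContDiff ℝ 2 f) (c v : E) :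
    f (c + v) = f c + fderiv ℝ f c v +
      ∫ t in (0 : ℝ)..1, (1 - t) * fderiv ℝ (fderiv ℝ f) (c + t • v) v v := by
  have hline : ∀ t : ℝ, HasDerivAt (fun t : ℝ => c + t • v) v t := fun t => by
    simpa using ((hasDerivAt_id t).smul_const v).const_add c
  have hf1 : ContDiff ℝ 1 (fderiv ℝ f) := hf.fderiv_right (by norm_num)
  have h0 : ∀ t : ℝ, HasDerivAt (fun t : ℝ => f (c + t • v)) (fderiv ℝ f (c + t • v) v) t :=
    fun t => ((hf.differentiable (by norm_num)) _).hasFDerivAt.comp_hasDerivAt t (hline t)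
  have h1 : ∀ t : ℝ, HasDerivAt (fun t : ℝ => fderiv ℝ f (c + t • v) v)
      (fderiv ℝ (fderiv ℝ f) (c + t • v) v v) t := fun t => by
    have := ((hf1.differentiable (by norm_num)) _).hasFDerivAt.comp_hasDerivAt t (hline t)
    simpa using this.clm_apply (hasDerivAt_const t v)
  have h2 : ∀ t : ℝ, HasDerivAt (fun t : ℝ => (1 - t) * fderiv ℝ f (c + t • v) v + f (c + t • v))
      ((1 - t) * fderiv ℝ (fderiv ℝ f) (c + t • v) v v) t := fun t => by
    have := ((((hasDerivAt_id t).const_sub 1).mul (h1 t)).add (h0 t))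
    refine this.congr_deriv ?_
    simp only [id_eq]
    ring
  have hcont : Continuous fun t : ℝ => (1 - t) * fderiv ℝ (fderiv ℝ f) (c + t • v) v v := by
    have : Continuous (fderiv ℝ (fderiv ℝ f)) := hf1.continuous_fderiv (by norm_num)
    fun_prop
  rw [intervalIntegral.integral_eq_sub_of_hasDerivAt (fun t _ => h2 t)
    (hcont.intervalIntegrable 0 1)]
  simp only [sub_self, zero_mul, one_smul, zero_smul, add_zero, sub_zero, one_mul, zero_add]
  ring

end Taylor

theorem fderiv_fderiv_eq_sum_secondPartial {n : ℕ} (μ : RSpace n → ℝ) (ξ v : RSpace n) :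
    fderiv ℝ (fderiv ℝ μ) ξ v v = ∑ i, ∑ j, v i * v j * secondPartial μ i j ξ := by
  have hv : v = ∑ i, v i • EuclideanSpace.single i (1 : ℝ) := by
    ext i
    simp [Finset.sum_apply, Pi.single_apply]
  conv_lhs => rw [hv]
  simp only [map_sum, map_smul, sum_apply, smul_apply,
    smul_eq_mul, secondPartial, iteratedFDeriv_two_apply, Matrix.cons_val_zero,
    Matrix.cons_val_one, Finset.mul_sum, mul_assoc]
  rw [Finset.sum_comm]
  refine Finset.sum_congr rfl fun i _ => Finset.sum_congr rfl fun j _ => ?_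
  ring

section LocalPhase

/-- Local estimate for the exponential of a phase whose second derivatives have a Fourier bound on
a ball: at the scale `r` for which `r²` times that bound is controlled, the phase is a bounded
perturbation of an affine function. -/
theorem exists_hasFourierBound_mul_cexp_of_ball {n : ℕ} (ρ : 𝓢(RSpace n, ℂ)) {A : ℝ}
    (hρ : Function.support ρ ⊆ Metric.closedBall 0 A) :
    ∃ K₀ K : ℝ, 0 ≤ K ∧ ∀ (μ : RSpace n → ℝ) (c : RSpace n) (r b : ℝ)
      (H : Fin n → Fin n → RSpace n → ℂ), ContDiff ℝ 2 μ → 0 < r →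
      (∀ i j, HasFourierBound (H i j) b) →
      (∀ i j, ∀ ξ ∈ Metric.closedBall c (A * r), H i j ξ = secondPartial μ i j ξ) →
      HasFourierBound (fun ξ => ρ (r⁻¹ • (ξ - c)) * Complex.exp (Complex.I * (μ ξ : ℂ)))
        (K₀ * Real.exp (r ^ 2 * b * K)) := by
  have hbump : 0 < |A| + 1 := by positivity
  let χ : ContDiffBump (0 : RSpace n) := ⟨|A| + 1, |A| + 2, hbump, by linarith⟩
  have hχc : ∀ i j : Fin n, HasCompactSupport fun ζ : RSpace n => ((χ ζ * (ζ i * ζ j) : ℝ) : ℂ) :=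
    fun i j => (χ.hasCompactSupport.mul_right (f' := fun ζ : RSpace n => ζ i * ζ j)).comp_left
      Complex.ofReal_zero
  have hχs : ∀ i j : Fin n, ContDiff ℝ ∞ fun ζ : RSpace n => ((χ ζ * (ζ i * ζ j) : ℝ) : ℂ) :=
    fun i j => Complex.ofRealCLM.contDiff.comp (χ.contDiff.mul (by fun_prop))
  let X : Fin n → Fin n → 𝓢(RSpace n, ℂ) := fun i j => (hχc i j).toSchwartzMap (hχs i j)
  have hX : ∀ i j ζ, X i j ζ = ((χ ζ * (ζ i * ζ j) : ℝ) : ℂ) := fun i j ζ => rfl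
  refine ⟨∫ x, ‖𝓕⁻ (ρ : RSpace n → ℂ) x‖, ∑ i, ∑ j, ∫ x, ‖𝓕⁻ (X i j : RSpace n → ℂ) x‖,
    Finset.sum_nonneg fun i _ => Finset.sum_nonneg fun j _ => integral_nonneg fun _ => norm_nonneg _,
    fun μ c r b H hμ hr hH hHμ => ?_⟩
  have haff : ∀ ξ : RSpace n, r⁻¹ • ξ + -(r⁻¹ • c) = r⁻¹ • (ξ - c) := fun ξ => by
    rw [smul_sub, sub_eq_add_neg]
  let Ψ : RSpace n → ℂ := fun ξ => ∑ i, ∑ j, ((r ^ 2 : ℝ) : ℂ) * (X i j (r⁻¹ • (ξ - c)) *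
    ∫ t in (0 : ℝ)..1, (1 - t : ℂ) * H i j (c + t • (ξ - c)))
  have hΨ : HasFourierBound Ψ (r ^ 2 * b * ∑ i, ∑ j, ∫ x, ‖𝓕⁻ (X i j : RSpace n → ℂ) x‖) := by
    have h : ∀ i j, HasFourierBound (fun ξ => ((r ^ 2 : ℝ) : ℂ) * (X i j (r⁻¹ • (ξ - c)) *
        ∫ t in (0 : ℝ)..1, (1 - t : ℂ) * H i j (c + t • (ξ - c))))
        (‖((r ^ 2 : ℝ) : ℂ)‖ * ((∫ x, ‖𝓕⁻ (X i j : RSpace n → ℂ) x‖) * b)) := fun i j => by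
      have h1 := (HasFourierBound.of_schwartz (X i j)).comp_affine (inv_ne_zero hr.ne')
        (-(r⁻¹ • c))
      simp only [haff] at h1
      exact (h1.mul ((hH i j).average c)).const_mul _
    have := HasFourierBound.sum Finset.univ fun i _ => HasFourierBound.sum Finset.univ
      fun j _ => h i j
    refine this.mono (le_of_eq ?_)
    rw [Finset.mul_sum]
    refine Finset.sum_congr rfl fun i _ => ?_
    rw [Finset.mul_sum]
    refine Finset.sum_congr rfl fun j _ => ?_
    rw [Complex.norm_real, Real.norm_of_nonneg (by positivity)]
    ring
  have hρ' := (HasFourierBound.of_schwartz ρ).comp_affine (inv_ne_zero hr.ne') (-(r⁻¹ • c))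
  simp only [haff] at hρ'
  let w : RSpace n := (InnerProductSpace.toDual ℝ (RSpace n)).symm (fderiv ℝ μ c)
  have hw : ∀ v, inner ℝ w v = fderiv ℝ μ c v := fun v => InnerProductSpace.toDual_symm_apply
  have hphase := HasFourierBound.phase (V := RSpace n) (μ c - inner ℝ w c) w
  have hI : HasFourierBound (fun ξ => Complex.I * Ψ ξ) _ := hΨ.const_mul Complex.I
  rw [Complex.norm_I, one_mul] at hI
  have hprod := hρ'.mul (hphase.mul hI.cexp)
  rw [one_mul] at hprod
  convert hprod using 2 with ξ
  by_cases hξ : ρ (r⁻¹ • (ξ - c)) = 0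
  · rw [hξ, zero_mul, zero_mul]
  congr 1
  rw [← Complex.exp_add, ← mul_add]
  congr 2
  have hball : ‖ξ - c‖ ≤ A * r := by
    have := hρ hξ
    rw [mem_closedBall_zero_iff, norm_smul, norm_inv, Real.norm_of_nonneg hr.le,
      inv_mul_le_iff₀ hr] at this
    linarith
  have hchi : χ (r⁻¹ • (ξ - c)) = 1 := by
    refine χ.one_of_mem_closedBall ?_
    have := hρ hξ
    rw [mem_closedBall_zero_iff] at this ⊢
    exact this.trans ((le_abs_self A).trans (by simp [χ]))
  have hrem : Ψ ξ = ((∫ t in (0 : ℝ)..1, (1 - t) *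
      fderiv ℝ (fderiv ℝ μ) (c + t • (ξ - c)) (ξ - c) (ξ - c) : ℝ) : ℂ) := by
    have hcont : ∀ i j, Continuous fun t : ℝ => secondPartial μ i j (c + t • (ξ - c)) := fun i j => by
      have h2 : Continuous (fderiv ℝ (fderiv ℝ μ)) :=
        (hμ.fderiv_right (m := 1) (by norm_num)).continuous_fderiv (by norm_num)
      simp only [secondPartial, iteratedFDeriv_two_apply]
      fun_prop
    simp only [fderiv_fderiv_eq_sum_secondPartial, Finset.mul_sum]
    rw [intervalIntegral.integral_finsetSum fun i _ => Continuous.intervalIntegrable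
      (continuous_finsetSum _ fun j _ => by have := hcont i j; fun_prop) _ _]
    simp only [Ψ]
    push_cast
    refine Finset.sum_congr rfl fun i _ => ?_
    rw [intervalIntegral.integral_finsetSum fun j _ => Continuous.intervalIntegrable
      (by have := hcont i j; fun_prop) _ _]
    push_cast
    refine Finset.sum_congr rfl fun j _ => ?_
    have hH' : ∫ t in (0 : ℝ)..1, (1 - t : ℂ) * H i j (c + t • (ξ - c)) =
        ((∫ t in (0 : ℝ)..1, (1 - t) * secondPartial μ i j (c + t • (ξ - c)) : ℝ) : ℂ) := by
      rw [← intervalIntegral.integral_ofReal]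
      refine intervalIntegral.integral_congr fun t ht => ?_
      rw [Set.uIcc_of_le zero_le_one] at ht
      rw [hHμ i j]
      · push_cast; rfl
      · rw [mem_closedBall_iff_norm, add_sub_cancel_left, norm_smul, Real.norm_of_nonneg ht.1]
        exact (mul_le_of_le_one_left (norm_nonneg _) ht.2).trans hball
    rw [hH', hX, hchi]
    have hpull : ∫ t in (0 : ℝ)..1, (1 - t) * ((ξ - c) i * (ξ - c) j *
        secondPartial μ i j (c + t • (ξ - c))) = (ξ - c) i * (ξ - c) j *
        ∫ t in (0 : ℝ)..1, (1 - t) * secondPartial μ i j (c + t • (ξ - c)) := by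
      rw [← intervalIntegral.integral_const_mul]
      refine intervalIntegral.integral_congr fun t _ => ?_
      simp only
      ring
    rw [hpull, ← Complex.ofReal_pow, ← Complex.ofReal_mul, ← Complex.ofReal_mul]
    congr 1
    simp only [PiLp.smul_apply, smul_eq_mul]
    field_simp
  rw [hrem, ← Complex.ofReal_add]
  congr 1
  have := taylor_integral_remainder_two hμ c (ξ - c)
  rw [add_sub_cancel, ← hw, inner_sub_right] at this
  rw [this]
  ring

end LocalPhase

section LatticePartition

/-- A smooth function on the line whose integer translates form a partition of unity. -/
noncomputable def lineBump (x : ℝ) : ℝ := Real.smoothTransition (x + 1) - Real.smoothTransition x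

theorem contDiff_lineBump : ContDiff ℝ ∞ lineBump :=
  (Real.smoothTransition.contDiff.comp (contDiff_id.add contDiff_const)).sub
    Real.smoothTransition.contDiff

theorem lineBump_eq_zero {x : ℝ} (hx : 1 < |x|) : lineBump x = 0 := by
  unfold lineBump
  rcases lt_abs.1 hx with h | h
  · rw [Real.smoothTransition.one_of_one_le (by linarith),
      Real.smoothTransition.one_of_one_le h.le, sub_self]
  · rw [Real.smoothTransition.zero_of_nonpos (by linarith),
      Real.smoothTransition.zero_of_nonpos (by linarith), sub_self]

theorem sum_lineBump_eq_one {a x : ℝ} {L : ℕ} (h1 : a ≤ x) (h2 : x + 1 ≤ a + L) :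
    ∑ k ∈ Finset.range L, lineBump (x - (a + k)) = 1 := by
  have h : ∀ k : ℕ, lineBump (x - (a + k)) = Real.smoothTransition (x - a + 1 - k) -
      Real.smoothTransition (x - a + 1 - (k + 1 : ℕ)) := fun k => by
    unfold lineBump
    push_cast
    congr 2 <;> ring
  simp only [h]
  rw [Finset.sum_range_sub' fun k : ℕ => Real.smoothTransition (x - a + 1 - k),
    Real.smoothTransition.one_of_one_le (by push_cast; linarith),
    Real.smoothTransition.zero_of_nonpos (by linarith), sub_zero]

/-- A smooth compactly supported function whose translates by `ℤⁿ` form a partition of unity. -/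
noncomputable def cubeBump (n : ℕ) (ζ : RSpace n) : ℂ := ((∏ i, lineBump (ζ i) : ℝ) : ℂ)

theorem contDiff_cubeBump (n : ℕ) : ContDiff ℝ ∞ (cubeBump n) :=
  Complex.ofRealCLM.contDiff.comp (contDiff_prod (t := Finset.univ)
    (f := fun i (ζ : RSpace n) => lineBump (ζ i)) fun i _ =>
      contDiff_lineBump.comp (by fun_prop : ContDiff ℝ ∞ fun ζ : RSpace n => ζ i))

theorem support_cubeBump_subset (n : ℕ) :
    Function.support (cubeBump n) ⊆ Metric.closedBall 0 (Real.sqrt n) := by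
  intro ζ hζ
  rw [mem_closedBall_zero_iff, EuclideanSpace.norm_eq]
  refine Real.sqrt_le_sqrt ?_
  calc ∑ i, ‖ζ i‖ ^ 2 ≤ ∑ _i : Fin n, (1 : ℝ) := by
        refine Finset.sum_le_sum fun i _ => ?_
        have : ‖ζ i‖ ≤ 1 := by
          by_contra h
          refine hζ ?_
          rw [cubeBump, Finset.prod_eq_zero (Finset.mem_univ i)
            (lineBump_eq_zero (by simpa using h)), Complex.ofReal_zero]
        exact pow_le_one₀ (norm_nonneg _) this
    _ = n := by simp

theorem hasCompactSupport_cubeBump (n : ℕ) : HasCompactSupport (cubeBump n) :=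
  HasCompactSupport.of_support_subset_isCompact (isCompact_closedBall _ _)
    (support_cubeBump_subset n)

theorem sum_cubeBump_eq_one {n : ℕ} {a ζ : RSpace n} {L : ℕ} (h1 : ∀ i, a i ≤ ζ i)
    (h2 : ∀ i, ζ i + 1 ≤ a i + L) :
    ∑ k ∈ Fintype.piFinset (fun _ : Fin n => Finset.range L),
      cubeBump n (ζ - (a + WithLp.toLp 2 fun i => (k i : ℝ))) = 1 := by
  simp only [cubeBump]
  rw [← Complex.ofReal_sum, ← Complex.ofReal_one]
  congr 1
  simp only [PiLp.sub_apply, PiLp.add_apply]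
  rw [Finset.sum_prod_piFinset (Finset.range L) fun i k => lineBump (ζ i - (a i + k))]
  exact Finset.prod_eq_one fun i _ => sum_lineBump_eq_one (h1 i) (h2 i)

end LatticePartition

/-- If the second derivatives of `μ` have Fourier bounds of size `r⁻²` in a neighbourhood of a set
of diameter at most `2 M r`, then `e^{iμ}` has a Fourier bound of order `M^n` on this set. -/
theorem exists_hasFourierBound_cexp_of_cover (n : ℕ) :
    ∃ K : ℝ, 0 ≤ K ∧ ∀ (μ : RSpace n → ℝ) (S : Set (RSpace n)) (x₀ : RSpace n) (r b : ℝ) (M : ℕ)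
      (H : Fin n → Fin n → RSpace n → ℂ), ContDiff ℝ 2 μ → 0 < r → r ^ 2 * b ≤ 1 →
      S ⊆ Metric.closedBall x₀ (M * r) → (∀ i j, HasFourierBound (H i j) b) →
      (∀ i j, ∀ ξ, ∀ ξ' ∈ S, ‖ξ - ξ'‖ ≤ 2 * Real.sqrt n * r → H i j ξ = secondPartial μ i j ξ) →
      ∃ F : RSpace n → ℂ, HasFourierBound F ((2 * M + 2) ^ n * K) ∧
        ∀ ξ ∈ S, F ξ = Complex.exp (Complex.I * (μ ξ : ℂ)) := by
  classical
  obtain ⟨K₀, K, hK, hloc⟩ := exists_hasFourierBound_mul_cexp_of_ball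
    ((hasCompactSupport_cubeBump n).toSchwartzMap (contDiff_cubeBump n))
    (A := Real.sqrt n) (support_cubeBump_subset n)
  refine ⟨|K₀| * Real.exp K, by positivity, fun μ S x₀ r b M H hμ hr hrb hS hH hHμ => ?_⟩
  set L := 2 * M + 2
  let a : RSpace n := WithLp.toLp 2 fun i => (r⁻¹ • x₀) i - M
  let pt : (Fin n → ℕ) → RSpace n := fun k => a + WithLp.toLp 2 fun i => (k i : ℝ)
  let box := Fintype.piFinset fun _ : Fin n => Finset.range L
  let good := box.filter fun k => ∃ ξ ∈ S, cubeBump n (r⁻¹ • ξ - pt k) ≠ 0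
  have hpt : ∀ k ξ, r⁻¹ • (ξ - r • pt k) = r⁻¹ • ξ - pt k := fun k ξ => by
    rw [smul_sub, smul_smul, inv_mul_cancel₀ hr.ne', one_smul]
  refine ⟨fun ξ => ∑ k ∈ good, cubeBump n (r⁻¹ • ξ - pt k) * Complex.exp (Complex.I * (μ ξ : ℂ)),
    (HasFourierBound.sum good (a := fun _ => |K₀| * Real.exp K) fun k hk => ?_).mono ?_,
    fun ξ hξ => ?_⟩
  · obtain ⟨ξ', hξ', hne⟩ := (Finset.mem_filter.1 hk).2
    have hξpt : ‖ξ' - r • pt k‖ ≤ Real.sqrt n * r := by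
      have := support_cubeBump_subset n hne
      rw [← hpt, mem_closedBall_zero_iff, norm_smul, norm_inv, Real.norm_of_nonneg hr.le,
        inv_mul_le_iff₀ hr] at this
      linarith
    have := hloc μ (r • pt k) r b H hμ hr hH fun i j ξ hξ => hHμ i j ξ ξ' hξ' (by
      rw [mem_closedBall_iff_norm] at hξ
      have htri := norm_sub_le_norm_sub_add_norm_sub ξ (r • pt k) ξ'
      rw [norm_sub_rev (r • pt k)] at htri
      linarith)
    simp only [hpt] at this
    refine this.mono ?_
    calc K₀ * Real.exp (r ^ 2 * b * K) ≤ |K₀| * Real.exp (1 * K) := by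
          gcongr
          exact le_abs_self _
      _ = _ := by rw [one_mul]
  · rw [Finset.sum_const, nsmul_eq_mul]
    have hcard : (good.card : ℝ) ≤ (2 * M + 2) ^ n := by
      have : good.card ≤ L ^ n := (Finset.card_filter_le _ _).trans (by simp [box])
      exact_mod_cast this
    gcongr
  · simp only
    rw [← Finset.sum_mul]
    have hsum : ∑ k ∈ good, cubeBump n (r⁻¹ • ξ - pt k) = 1 := by
      have hcoord : ∀ i, |(r⁻¹ • ξ) i - (r⁻¹ • x₀) i| ≤ M := fun i => by
        have h1 := hS hξ
        rw [mem_closedBall_iff_norm] at h1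
        have h2 : ‖(r⁻¹ • ξ - r⁻¹ • x₀) i‖ ≤ M := by
          refine (PiLp.norm_apply_le _ i).trans ?_
          rw [← smul_sub, norm_smul, norm_inv, Real.norm_of_nonneg hr.le, inv_mul_le_iff₀ hr]
          linarith
        simpa using h2
      rw [← sum_cubeBump_eq_one (n := n) (a := a) (ζ := r⁻¹ • ξ) (L := L)
        (fun i => by simp only [a]; linarith [(abs_le.1 (hcoord i)).1])
        (fun i => by simp only [a, L]; push_cast; linarith [(abs_le.1 (hcoord i)).2])]
      refine Finset.sum_subset (Finset.filter_subset _ _) fun k hk hk' => ?_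
      by_contra hne
      exact hk' (Finset.mem_filter.2 ⟨hk, ξ, hξ, hne⟩)
    rw [hsum, one_mul]

/-- The properties of the decompositions of frequency space underlying `α`-modulation spaces which
are used for multiplier estimates: the `k`-th window is a bump function adapted to a ball of radius
`(size k)^α` which consists of frequencies of modulus about `size k`. -/
structure IsAdmissibleDecomposition {n : ℕ} (α : ℝ) (D : FrequencyDecomposition n) : Prop where
  smooth : ∀ k, ContDiff ℝ ∞ (D.window k)
  one_le_size : ∀ k, 1 ≤ D.size k
  size_le : ∃ C, ∀ k, ∀ ξ ∈ tsupport (D.window k), D.size k ≤ C * (1 + ‖ξ‖)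
  le_size : ∃ C, ∀ k, ∀ ξ ∈ tsupport (D.window k), 1 + ‖ξ‖ ≤ C * D.size k
  tsupport_subset : ∃ C, ∀ k, ∃ c, tsupport (D.window k) ⊆ Metric.closedBall c (C * D.size k ^ α)
  deriv_le : ∀ m : ℕ, ∃ C, ∀ k ξ,
    ‖iteratedFDeriv ℝ m (D.window k) ξ‖ ≤ C * ((D.size k ^ α) ^ m)⁻¹
  sum_eq_one : ∀ ξ, HasSum (fun k => D.window k ξ) 1
  summable : ∃ N : ℕ, Summable fun k => (D.size k ^ N)⁻¹
  card_le : ∀ Γ : ℝ, ∃ N : ℕ, ∀ k, ∃ t : Finset D.Index, t.card ≤ N ∧ ∀ l,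
    D.size l ≤ Γ * D.size k → D.size k ≤ Γ * D.size l →
    (∃ ξ ∈ tsupport (D.window k), ∃ ξ' ∈ tsupport (D.window l), ‖ξ - ξ'‖ ≤ D.size k ^ α) → l ∈ t

section Dyadic

variable {n : ℕ} {φ : RSpace n → ℝ}

theorem dyadicWindow_eq_sub {j : ℕ} (hj : j ≠ 0) (φ : RSpace n → ℝ) (ξ : RSpace n) :
    dyadicWindow φ j ξ =
      (φ (((2 : ℝ) ^ j)⁻¹ • ξ) : ℂ) - (φ ((2 * ((2 : ℝ) ^ j)⁻¹) • ξ) : ℂ) := by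
  simp [dyadicWindow, hj]

theorem IsDyadicBump.eq_zero (hφ : IsDyadicBump φ) {ξ : RSpace n} (hξ : 3 / 2 < ‖ξ‖) :
    φ ξ = 0 := by
  by_contra h
  have := hφ.support_subset (subset_tsupport φ h)
  rw [mem_closedBall_zero_iff] at this
  linarith

theorem IsDyadicBump.norm_le_of_mem_tsupport (hφ : IsDyadicBump φ) {j : ℕ} {ξ : RSpace n}
    (hξ : ξ ∈ tsupport (dyadicWindow φ j)) : ‖ξ‖ ≤ 3 / 2 * 2 ^ j := by
  rw [← mem_closedBall_zero_iff]
  refine closure_minimal (fun ζ hζ => ?_) Metric.isClosed_closedBall hξ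
  rw [mem_closedBall_zero_iff]
  by_contra! h
  refine hζ ?_
  have h1 : 3 / 2 < ((2 : ℝ) ^ j)⁻¹ * ‖ζ‖ := by
    rw [lt_inv_mul_iff₀ (by positivity)]
    linarith
  have e1 : φ (((2 : ℝ) ^ j)⁻¹ • ζ) = 0 := hφ.eq_zero (by
    rwa [norm_smul, Real.norm_of_nonneg (by positivity)])
  have e2 : φ ((2 * ((2 : ℝ) ^ j)⁻¹) • ζ) = 0 := hφ.eq_zero (by
    rw [norm_smul, Real.norm_of_nonneg (by positivity)]
    linarith)
  rcases eq_or_ne j 0 with rfl | hj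
  · simpa [dyadicWindow] using e1
  · simp [dyadicWindow_eq_sub hj, e1, e2]

theorem IsDyadicBump.le_norm_of_mem_tsupport (hφ : IsDyadicBump φ) {j : ℕ} (hj : j ≠ 0)
    {ξ : RSpace n} (hξ : ξ ∈ tsupport (dyadicWindow φ j)) : 2 / 3 * 2 ^ j ≤ ‖ξ‖ := by
  refine closure_minimal (fun ζ hζ => ?_)
    (isClosed_le (continuous_const (y := 2 / 3 * (2 : ℝ) ^ j)) continuous_norm) hξ
  simp only [Set.mem_ofPred_eq]
  by_contra! h
  refine hζ ?_
  have h1 : ((2 : ℝ) ^ j)⁻¹ * ‖ζ‖ ≤ 2 / 3 := by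
    rw [inv_mul_le_iff₀ (by positivity)]
    linarith
  rw [dyadicWindow_eq_sub hj, hφ.eq_one, hφ.eq_one, sub_self]
  · rw [norm_smul, Real.norm_of_nonneg (by positivity)]
    linarith
  · rw [norm_smul, Real.norm_of_nonneg (by positivity)]
    linarith

theorem sum_dyadicWindow (φ : RSpace n → ℝ) (ξ : RSpace n) (J : ℕ) :
    ∑ j ∈ Finset.range (J + 1), dyadicWindow φ j ξ = (φ (((2 : ℝ) ^ J)⁻¹ • ξ) : ℂ) := by
  induction J with
  | zero => simp [dyadicWindow]
  | succ J ih =>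
    rw [Finset.sum_range_succ, ih, dyadicWindow_eq_sub J.succ_ne_zero]
    have : 2 * ((2 : ℝ) ^ (J + 1))⁻¹ = ((2 : ℝ) ^ J)⁻¹ := by
      rw [pow_succ]
      field_simp
    rw [this]
    ring

theorem IsDyadicBump.contDiff_ofReal (hφ : IsDyadicBump φ) :
    ContDiff ℝ ∞ fun ξ => (φ ξ : ℂ) :=
  Complex.ofRealCLM.contDiff.comp hφ.smooth

theorem IsDyadicBump.exists_iteratedFDeriv_le (hφ : IsDyadicBump φ) (m : ℕ) :
    ∃ C, 0 ≤ C ∧ ∀ ξ, ‖iteratedFDeriv ℝ m (fun ξ => (φ ξ : ℂ)) ξ‖ ≤ C := by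
  have hc : HasCompactSupport fun ξ => (φ ξ : ℂ) :=
    HasCompactSupport.comp_left (g := ((↑) : ℝ → ℂ))
      (HasCompactSupport.of_support_subset_isCompact (isCompact_closedBall _ _)
        ((subset_tsupport φ).trans hφ.support_subset)) Complex.ofReal_zero
  obtain ⟨C, hC⟩ := (hc.iteratedFDeriv (𝕜 := ℝ) m).exists_bound_of_continuous
    (hφ.contDiff_ofReal.continuous_iteratedFDeriv (by exact_mod_cast le_top))
  exact ⟨C, (norm_nonneg _).trans (hC 0), hC⟩

theorem IsDyadicBump.isAdmissibleDecomposition (hφ : IsDyadicBump φ) :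
    IsAdmissibleDecomposition 1 ⟨ℕ, fun j => (2 : ℝ) ^ j, dyadicWindow φ⟩ where
  smooth j := by
    rcases eq_or_ne j 0 with rfl | hj
    · have : dyadicWindow φ 0 = fun ξ => (φ ξ : ℂ) := funext fun ξ => by simp [dyadicWindow]
      simp only [this]
      exact hφ.contDiff_ofReal
    · have : dyadicWindow φ j = fun ξ =>
          (φ (((2 : ℝ) ^ j)⁻¹ • ξ) : ℂ) - (φ ((2 * ((2 : ℝ) ^ j)⁻¹) • ξ) : ℂ) :=
        funext fun ξ => dyadicWindow_eq_sub hj φ ξ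
      simp only [this]
      exact (hφ.contDiff_ofReal.comp (contDiff_const_smul _)).sub
        (hφ.contDiff_ofReal.comp (contDiff_const_smul _))
  one_le_size j := one_le_pow₀ one_le_two
  size_le := by
    refine ⟨3 / 2, fun j ξ hξ => ?_⟩
    rcases eq_or_ne j 0 with rfl | hj
    · have := norm_nonneg ξ
      simp only [pow_zero]
      linarith
    · have := hφ.le_norm_of_mem_tsupport hj hξ
      simp only
      linarith
  le_size := by
    refine ⟨5 / 2, fun j ξ hξ => ?_⟩
    have := hφ.norm_le_of_mem_tsupport hξ
    have h1 : (1 : ℝ) ≤ 2 ^ j := one_le_pow₀ one_le_two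
    simp only
    linarith
  tsupport_subset := by
    refine ⟨3 / 2, fun j => ⟨0, fun ξ hξ => ?_⟩⟩
    rw [mem_closedBall_zero_iff, Real.rpow_one]
    exact hφ.norm_le_of_mem_tsupport hξ
  deriv_le m := by
    obtain ⟨C, hC0, hC⟩ := hφ.exists_iteratedFDeriv_le m
    refine ⟨C + 2 ^ m * C, fun j ξ => ?_⟩
    simp only [Real.rpow_one]
    have hsmooth : ContDiff ℝ m fun ξ => (φ ξ : ℂ) :=
      hφ.contDiff_ofReal.of_le (by exact_mod_cast le_top)
    have hle : ∀ a : ℝ, 0 ≤ a → ‖iteratedFDeriv ℝ m (fun ξ => (φ (a • ξ) : ℂ)) ξ‖ ≤ a ^ m * C :=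
      fun a ha => by
        rw [iteratedFDeriv_comp_const_smul a hsmooth, norm_smul, norm_pow, Real.norm_of_nonneg ha]
        gcongr
        exact hC _
    rcases eq_or_ne j 0 with rfl | hj
    · have : dyadicWindow φ 0 = fun ξ => (φ ξ : ℂ) := funext fun ξ => by simp [dyadicWindow]
      simp only [this, pow_zero, one_pow, inv_one, mul_one]
      exact (hC ξ).trans (le_add_of_nonneg_right (by positivity))
    · have : dyadicWindow φ j = (fun ξ => (φ (((2 : ℝ) ^ j)⁻¹ • ξ) : ℂ)) -
          fun ξ => (φ ((2 * ((2 : ℝ) ^ j)⁻¹) • ξ) : ℂ) :=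
        funext fun ξ => dyadicWindow_eq_sub hj φ ξ
      have hcd : ∀ a : ℝ, ContDiffAt ℝ m (fun ξ => (φ (a • ξ) : ℂ)) ξ := fun a =>
        (hsmooth.comp (contDiff_const_smul a)).contDiffAt
      rw [this, iteratedFDeriv_sub_apply (hcd _) (hcd _)]
      refine (norm_sub_le_of_le (hle _ (by positivity)) (hle _ (by positivity))).trans
        (le_of_eq ?_)
      rw [mul_pow, inv_pow]
      ring
  sum_eq_one ξ := by
    obtain ⟨J, hJ⟩ := pow_unbounded_of_one_lt (2 * ‖ξ‖) (one_lt_two (α := ℝ))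
    have h1 : (φ (((2 : ℝ) ^ J)⁻¹ • ξ) : ℂ) = 1 := by
      rw [hφ.eq_one, Complex.ofReal_one]
      rw [norm_smul, Real.norm_of_nonneg (by positivity), inv_mul_le_iff₀ (by positivity)]
      linarith [norm_nonneg ξ]
    rw [← h1, ← sum_dyadicWindow]
    refine hasSum_sum_of_ne_finset_zero fun j hj => ?_
    by_contra hne
    rw [Finset.mem_range, not_lt] at hj
    have := hφ.le_norm_of_mem_tsupport (by omega) (subset_tsupport _ hne)
    have h2 : (2 : ℝ) ^ (J + 1) ≤ 2 ^ j := pow_le_pow_right₀ one_le_two hj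
    rw [pow_succ] at h2
    linarith [norm_nonneg ξ]
  summable := ⟨1, by
    simp only [pow_one, ← inv_pow]
    exact summable_geometric_of_lt_one (by norm_num) (by norm_num)⟩
  card_le Γ := by
    obtain ⟨M, hM⟩ := pow_unbounded_of_one_lt Γ (one_lt_two (α := ℝ))
    refine ⟨2 * M + 1, fun k => ⟨Finset.Icc (k - M) (k + M), ?_, fun l h1 h2 _ => ?_⟩⟩
    · rw [Nat.card_Icc]
      omega
    · have key : ∀ a b : ℕ, (2 : ℝ) ^ a ≤ Γ * 2 ^ b → a ≤ b + M := fun a b h => by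
        by_contra! hlt
        have h3 : (2 : ℝ) ^ (b + M) ≤ 2 ^ a := pow_le_pow_right₀ one_le_two hlt.le
        rw [pow_add] at h3
        have h4 : (0 : ℝ) < 2 ^ b := by positivity
        nlinarith
      exact Finset.mem_Icc.2 ⟨Nat.sub_le_iff_le_add.2 (key k l h2), key l k h1⟩

end Dyadic

section Alpha

variable {n : ℕ} {α : ℝ}

theorem norm_toLp_sq_int (k : Fin n → ℤ) :
    ‖(WithLp.toLp 2 (fun i => (k i : ℝ)) : RSpace n)‖ ^ 2 = ∑ i, (k i : ℝ) ^ 2 := by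
  rw [EuclideanSpace.norm_sq_eq]
  simp

theorem latticeBracket_sq (k : Fin n → ℤ) :
    latticeBracket k ^ 2 = 1 + ‖(WithLp.toLp 2 (fun i => (k i : ℝ)) : RSpace n)‖ ^ 2 := by
  rw [latticeBracket, Real.sq_sqrt (by positivity), norm_toLp_sq_int]

theorem one_le_latticeBracket (k : Fin n → ℤ) : 1 ≤ latticeBracket k := by
  rw [latticeBracket, Real.one_le_sqrt]
  exact le_add_of_nonneg_right (by positivity)

theorem norm_le_latticeBracket (k : Fin n → ℤ) :
    ‖(WithLp.toLp 2 (fun i => (k i : ℝ)) : RSpace n)‖ ≤ latticeBracket k := by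
  refine abs_le_of_sq_le_sq' ?_ (zero_le_one.trans (one_le_latticeBracket k)) |>.2
  rw [latticeBracket_sq]
  linarith

theorem latticeBracket_le (k : Fin n → ℤ) :
    latticeBracket k ≤ 1 + ‖(WithLp.toLp 2 (fun i => (k i : ℝ)) : RSpace n)‖ := by
  refine abs_le_of_sq_le_sq' ?_ (by positivity) |>.2
  rw [latticeBracket_sq]
  nlinarith [norm_nonneg (WithLp.toLp 2 (fun i => (k i : ℝ)) : RSpace n)]

theorem latticeBracket_le_of_norm_le {k l : Fin n → ℤ}
    (h : ‖(WithLp.toLp 2 (fun i => (k i : ℝ)) : RSpace n)‖ ≤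
      ‖(WithLp.toLp 2 (fun i => (l i : ℝ)) : RSpace n)‖) : latticeBracket k ≤ latticeBracket l := by
  refine abs_le_of_sq_le_sq' ?_ (zero_le_one.trans (one_le_latticeBracket l)) |>.2
  rw [latticeBracket_sq, latticeBracket_sq]
  gcongr

theorem mul_norm_sub_le_norm_smul_sub_smul {E : Type*} [NormedAddCommGroup E]
    [InnerProductSpace ℝ E] {a b : ℝ} {x y : E} (hb : 0 ≤ b) (hab : b ≤ a) (hxy : ‖y‖ ≤ ‖x‖) :
    b * ‖x - y‖ ≤ ‖a • x - b • y‖ := by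
  refine abs_le_of_sq_le_sq' ?_ (norm_nonneg _) |>.2
  have h1 : ‖a • x - b • y‖ ^ 2 = a ^ 2 * ‖x‖ ^ 2 - 2 * (a * (b * inner ℝ x y)) +
      b ^ 2 * ‖y‖ ^ 2 := by
    rw [norm_sub_sq_real, norm_smul, norm_smul, mul_pow, mul_pow, Real.norm_eq_abs,
      Real.norm_eq_abs, sq_abs, sq_abs, real_inner_smul_left, real_inner_smul_right]
  have h2 := norm_sub_sq_real x y
  have h3 : inner ℝ x y ≤ ‖x‖ ^ 2 := (real_inner_le_norm x y).trans (by
    nlinarith [norm_nonneg x, norm_nonneg y])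
  rw [h1, mul_pow, h2]
  nlinarith [mul_nonneg (mul_nonneg hb (sub_nonneg.2 hab)) (sub_nonneg.2 h3),
    mul_nonneg (sq_nonneg (a - b)) (sq_nonneg ‖x‖)]

theorem summable_int_inv_one_add_sq : Summable fun k : ℤ => (1 + (k : ℝ) ^ 2)⁻¹ := by
  have h : Summable fun k : ℤ => 1 / (k : ℝ) ^ 2 := Real.summable_one_div_int_pow.2 one_lt_two
  refine Summable.of_norm_bounded_eventually h ?_
  filter_upwards [(Set.finite_singleton (0 : ℤ)).compl_mem_cofinite] with k hk
  have hk' : (0 : ℝ) < (k : ℝ) ^ 2 := by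
    have : (k : ℝ) ≠ 0 := by exact_mod_cast hk
    positivity
  rw [Real.norm_of_nonneg (by positivity), one_div]
  gcongr
  linarith

theorem summable_inv_latticeBracket_pow (n : ℕ) :
    Summable fun k : Fin n → ℤ => (latticeBracket k ^ (2 * n))⁻¹ := by
  classical
  have hprod : Summable fun k : Fin n → ℤ => ∏ i, (1 + (k i : ℝ) ^ 2)⁻¹ := by
    refine summable_of_sum_le (c := ∏ _i : Fin n, ∑' m : ℤ, (1 + (m : ℝ) ^ 2)⁻¹)
      (fun k => Finset.prod_nonneg fun i _ => by positivity) fun s => ?_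
    calc ∑ k ∈ s, ∏ i, (1 + (k i : ℝ) ^ 2)⁻¹
        ≤ ∑ k ∈ Fintype.piFinset fun i => s.image fun k : Fin n → ℤ => k i,
            ∏ i, (1 + (k i : ℝ) ^ 2)⁻¹ := by
          refine Finset.sum_le_sum_of_subset_of_nonneg (fun k hk => ?_)
            fun k _ _ => Finset.prod_nonneg fun i _ => by positivity
          exact Fintype.mem_piFinset.2 fun i => Finset.mem_image_of_mem (fun k => k i) hk
      _ = ∏ i, ∑ m ∈ s.image (fun k : Fin n → ℤ => k i), (1 + (m : ℝ) ^ 2)⁻¹ :=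
          (Finset.prod_univ_sum (fun i => s.image fun k => k i)
            fun _ (m : ℤ) => (1 + (m : ℝ) ^ 2)⁻¹).symm
      _ ≤ _ := Finset.prod_le_prod (fun i _ => Finset.sum_nonneg fun m _ => by positivity)
          fun i _ => summable_int_inv_one_add_sq.sum_le_tsum _ fun m _ => by positivity
  refine hprod.of_nonneg_of_le (fun k => ?_) fun k => ?_
  · have := one_le_latticeBracket k
    positivity
  · rw [Finset.prod_inv_distrib]
    refine inv_anti₀ (Finset.prod_pos fun i _ => by positivity) ?_
    calc ∏ i, (1 + (k i : ℝ) ^ 2) ≤ ∏ _i : Fin n, latticeBracket k ^ 2 := by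
          refine Finset.prod_le_prod (fun i _ => by positivity) fun i _ => ?_
          rw [latticeBracket_sq, norm_toLp_sq_int]
          gcongr
          exact Finset.single_le_sum (f := fun i => (k i : ℝ) ^ 2) (fun i _ => by positivity)
            (Finset.mem_univ i)
      _ = latticeBracket k ^ (2 * n) := by simp [pow_mul]

theorem exists_card_norm_sub_le (n : ℕ) (M : ℝ) :
    ∃ N : ℕ, ∀ k : Fin n → ℤ, ∃ t : Finset (Fin n → ℤ), t.card ≤ N ∧ ∀ l : Fin n → ℤ,
      ‖(WithLp.toLp 2 (fun i => (k i : ℝ)) : RSpace n) - WithLp.toLp 2 (fun i => (l i : ℝ))‖ ≤ M →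
      l ∈ t := by
  classical
  obtain ⟨m, hm⟩ := exists_nat_ge M
  let box := Fintype.piFinset fun _ : Fin n => Finset.Icc (-m : ℤ) m
  refine ⟨box.card, fun k => ⟨box.image fun v => k + v, Finset.card_image_le, fun l hl => ?_⟩⟩
  refine Finset.mem_image.2 ⟨l - k, Fintype.mem_piFinset.2 fun i => ?_, by simp⟩
  have h := (PiLp.norm_apply_le (WithLp.toLp 2 (fun i => (k i : ℝ)) -
    WithLp.toLp 2 (fun i => (l i : ℝ)) : RSpace n) i).trans (hl.trans hm)
  simp only [PiLp.sub_apply, Real.norm_eq_abs] at h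
  have h' : |k i - l i| ≤ (m : ℤ) := by exact_mod_cast h
  rw [abs_le] at h'
  rw [Finset.mem_Icc, Pi.sub_apply]
  omega

theorem IsAlphaPartition.isAdmissibleDecomposition {η : (Fin n → ℤ) → RSpace n → ℂ} (h0 : 0 ≤ α)
    (h1 : α < 1) (hη : IsAlphaPartition α η) :
    IsAdmissibleDecomposition α
      ⟨Fin n → ℤ, fun k => latticeBracket k ^ (1 / (1 - α)), η⟩ := by
  have h1' : 0 < 1 - α := sub_pos.2 h1
  obtain ⟨C₁, C, hC₁, hC₁₂, hloc⟩ := hη.localized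
  have hC : 0 < C := hC₁.trans hC₁₂
  set pt : (Fin n → ℤ) → RSpace n := fun k => WithLp.toLp 2 fun i => (k i : ℝ) with hpt
  set R : (Fin n → ℤ) → ℝ := fun k => latticeBracket k ^ (α / (1 - α)) with hR
  set sz : (Fin n → ℤ) → ℝ := fun k => latticeBracket k ^ (1 / (1 - α)) with hsz
  have hb : ∀ k : Fin n → ℤ, 0 < latticeBracket k := fun k =>
    zero_lt_one.trans_le (one_le_latticeBracket k)
  have hR1 : ∀ k, 1 ≤ R k := fun k =>
    Real.one_le_rpow (one_le_latticeBracket k) (div_nonneg h0 h1'.le)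
  have hszR : ∀ k, sz k = R k * latticeBracket k := fun k => by
    simp only [hsz, hR]
    nth_rewrite 3 [← Real.rpow_one (latticeBracket k)]
    rw [← Real.rpow_add (hb k)]
    congr 1
    field_simp
    ring
  have hszα : ∀ k, sz k ^ α = R k := fun k => by
    simp only [hsz, hR]
    rw [← Real.rpow_mul (hb k).le]
    congr 1
    ring
  have hsz1 : ∀ k, 1 ≤ sz k := fun k =>
    Real.one_le_rpow (one_le_latticeBracket k) (by positivity)
  have hbsz : ∀ k, latticeBracket k ≤ sz k := fun k => by
    rw [hszR]
    exact le_mul_of_one_le_left (hb k).le (hR1 k)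
  have hsupp : ∀ k, ∀ ξ ∈ tsupport (η k), ‖ξ - R k • pt k‖ ≤ C * R k := fun k ξ hξ => by
    exact mem_closedBall_iff_norm.1 ((hloc k).2 hξ)
  have hnorm : ∀ k, ‖R k • pt k‖ = R k * ‖pt k‖ := fun k => by
    rw [norm_smul, Real.norm_of_nonneg (zero_le_one.trans (hR1 k))]
  refine
    { smooth := hη.smooth
      one_le_size := hsz1
      size_le := ?_
      le_size := ?_
      tsupport_subset := ?_
      deriv_le := ?_
      sum_eq_one := hη.sum_eq_one
      summable := ?_
      card_le := ?_ }
  · refine ⟨2 + (2 * (1 + C)) ^ (1 / (1 - α)), fun k ξ hξ => ?_⟩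
    have hpos : 0 ≤ (2 * (1 + C)) ^ (1 / (1 - α)) := by positivity
    change sz k ≤ _
    rcases le_total (2 * (1 + C)) (latticeBracket k) with h | h
    · have e1 : sz k ≤ R k + R k * ‖pt k‖ := by
        rw [hszR, ← mul_one_add]
        exact mul_le_mul_of_nonneg_left (latticeBracket_le k) (zero_le_one.trans (hR1 k))
      have e2 : R k * ‖pt k‖ ≤ ‖ξ‖ + C * R k := by
        rw [← hnorm]
        have := norm_sub_norm_le (R k • pt k) ξ
        rw [norm_sub_rev] at this
        linarith [hsupp k ξ hξ]
      have e3 : (2 * (1 + C)) * R k ≤ sz k := by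
        rw [hszR, mul_comm]
        exact mul_le_mul_of_nonneg_left h (zero_le_one.trans (hR1 k))
      have e4 : sz k ≤ 2 * (1 + ‖ξ‖) := by linarith
      nlinarith [norm_nonneg ξ]
    · have : sz k ≤ (2 * (1 + C)) ^ (1 / (1 - α)) :=
        Real.rpow_le_rpow (hb k).le h (by positivity)
      nlinarith [norm_nonneg ξ]
  · refine ⟨2 + C, fun k ξ hξ => ?_⟩
    change _ ≤ _ * sz k
    have e1 : ‖ξ‖ ≤ R k * ‖pt k‖ + C * R k := by
      rw [← hnorm]
      have := norm_sub_norm_le ξ (R k • pt k)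
      linarith [hsupp k ξ hξ]
    have e2 : R k * ‖pt k‖ ≤ sz k := by
      rw [hszR]
      exact mul_le_mul_of_nonneg_left (norm_le_latticeBracket k) (zero_le_one.trans (hR1 k))
    have e3 : R k ≤ sz k := by
      rw [hszR]
      exact le_mul_of_one_le_right (zero_le_one.trans (hR1 k)) (one_le_latticeBracket k)
    nlinarith [hsz1 k]
  · refine ⟨C, fun k => ⟨alphaCenter α k, ?_⟩⟩
    change tsupport (η k) ⊆ Metric.closedBall _ (C * sz k ^ α)
    rw [hszα]
    exact (hloc k).2
  · intro m
    obtain ⟨K, hK⟩ := hη.deriv_le m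
    refine ⟨K, fun k ξ => (hK k ξ).trans (le_of_eq ?_)⟩
    change _ = K * ((sz k ^ α) ^ m)⁻¹
    rw [hszα]
    simp only [hR]
    rw [← Real.rpow_natCast, ← Real.rpow_mul (hb k).le, ← Real.rpow_neg (hb k).le]
    congr 2
    ring
  · refine ⟨2 * n, (summable_inv_latticeBracket_pow n).of_nonneg_of_le (fun k => ?_) fun k => ?_⟩
    · have := hsz1 k
      change 0 ≤ (sz k ^ (2 * n))⁻¹
      positivity
    · have := hb k
      change (sz k ^ (2 * n))⁻¹ ≤ _
      gcongr
      exact hbsz k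
  · intro Γ
    set G := |Γ| ^ α with hG
    obtain ⟨N, hN⟩ := exists_card_norm_sub_le n ((C + 1) * (1 + G))
    refine ⟨N, fun k => ?_⟩
    obtain ⟨t, ht, htl⟩ := hN k
    refine ⟨t, ht, fun l hlk hkl ⟨ξ, hξ, ξ', hξ', hdist⟩ => htl l ?_⟩
    change sz l ≤ Γ * sz k at hlk
    change sz k ≤ Γ * sz l at hkl
    change ‖ξ - ξ'‖ ≤ sz k ^ α at hdist
    rw [hszα] at hdist
    have hcomp : ∀ k l, sz l ≤ Γ * sz k → R l ≤ G * R k := fun k l h => by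
      have hk := zero_le_one.trans (hsz1 k)
      rw [← hszα, ← hszα, hG, ← Real.mul_rpow (abs_nonneg _) hk]
      exact Real.rpow_le_rpow (zero_le_one.trans (hsz1 l))
        (h.trans (mul_le_mul_of_nonneg_right (le_abs_self _) hk)) h0
    have hd : ‖R k • pt k - R l • pt l‖ ≤ (C + 1) * (R k + R l) := by
      have t1 := norm_sub_le_norm_sub_add_norm_sub (R k • pt k) ξ (R l • pt l)
      have t2 := norm_sub_le_norm_sub_add_norm_sub ξ ξ' (R l • pt l)
      rw [norm_sub_rev _ ξ] at t1
      linarith [hsupp k ξ hξ, hsupp l ξ' hξ', hR1 l]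
    have hmin : ∀ k l, ‖R k • pt k - R l • pt l‖ ≤ (C + 1) * (R k + R l) →
        ‖pt l‖ ≤ ‖pt k‖ → R k ≤ G * R l → ‖pt k - pt l‖ ≤ (C + 1) * (1 + G) := by
      intro k l hd hle hG'
      have hRl : R l ≤ R k := Real.rpow_le_rpow (hb l).le (latticeBracket_le_of_norm_le hle)
        (div_nonneg h0 h1'.le)
      have hl0 : 0 < R l := zero_lt_one.trans_le (hR1 l)
      have := mul_norm_sub_le_norm_smul_sub_smul hl0.le hRl hle
      refine le_of_mul_le_mul_left ?_ hl0
      calc R l * ‖pt k - pt l‖ ≤ (C + 1) * (R k + R l) := this.trans hd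
        _ ≤ (C + 1) * (G * R l + R l) := by gcongr
        _ = R l * ((C + 1) * (1 + G)) := by ring
    change ‖pt k - pt l‖ ≤ _
    rcases le_total ‖pt l‖ ‖pt k‖ with h | h
    · exact hmin k l hd h (hcomp l k hkl)
    · rw [norm_sub_rev]
      refine hmin l k ?_ h (hcomp k l hlk)
      rw [norm_sub_rev, add_comm (R l)]
      exact hd

end Alpha

theorem IsAlphaDecomposition.isAdmissibleDecomposition {n : ℕ} {α : ℝ}
    {D : FrequencyDecomposition n} (hD : IsAlphaDecomposition α D) :
    IsAdmissibleDecomposition α D := by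
  cases hD with
  | ofAlphaPartition h0 h1 η hη => exact hη.isAdmissibleDecomposition h0 h1
  | ofDyadic h φ hφ =>
    subst h
    exact hφ.isAdmissibleDecomposition

theorem Real.rpow_le_mul_rpow_of_comparable {x y Γ : ℝ} (hx : 0 < x) (hy : 0 < y) (hΓ : 1 ≤ Γ)
    (h1 : x ≤ Γ * y) (h2 : y ≤ Γ * x) (p : ℝ) : x ^ p ≤ Γ ^ |p| * y ^ p := by
  have hΓ0 : 0 < Γ := zero_lt_one.trans_le hΓ
  rcases le_total 0 p with hp | hp
  · rw [abs_of_nonneg hp, ← Real.mul_rpow hΓ0.le hy.le]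
    exact Real.rpow_le_rpow hx.le h1 hp
  · rw [abs_of_nonpos hp, Real.rpow_neg hΓ0.le, ← Real.inv_rpow hΓ0.le,
      ← Real.mul_rpow (by positivity) hy.le]
    exact Real.rpow_le_rpow_of_nonpos (by positivity) (by rwa [inv_mul_le_iff₀ hΓ0]) hp

namespace IsAdmissibleDecomposition

variable {n : ℕ} {α : ℝ} {D : FrequencyDecomposition n}

theorem size_pos (hD : IsAdmissibleDecomposition α D) (k : D.Index) : 0 < D.size k :=
  zero_lt_one.trans_le (hD.one_le_size k)

theorem hasCompactSupport (hD : IsAdmissibleDecomposition α D) (k : D.Index) :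
    HasCompactSupport (D.window k) := by
  obtain ⟨C, hC⟩ := hD.tsupport_subset
  obtain ⟨c, hc⟩ := hC k
  exact HasCompactSupport.of_support_subset_isCompact (isCompact_closedBall _ _)
    ((subset_tsupport _).trans hc)

theorem hasTemperateGrowth (hD : IsAdmissibleDecomposition α D) (k : D.Index) :
    (D.window k).HasTemperateGrowth :=
  (hD.hasCompactSupport k).hasTemperateGrowth (hD.smooth k)

/-- The windows which meet a neighbourhood of a given one are boundedly many, are of about the same
size, and sum up to one on this neighbourhood. -/
theorem exists_neighbors (hD : IsAdmissibleDecomposition α D) (hα : α ≤ 1) :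
    ∃ (ε Γ : ℝ) (N : ℕ) (nb : D.Index → Finset D.Index), 0 < ε ∧ 1 ≤ Γ ∧
      (∀ k, (nb k).card ≤ N) ∧
      (∀ k, ∀ l ∈ nb k, D.size l ≤ Γ * D.size k ∧ D.size k ≤ Γ * D.size l) ∧
      (∀ k l, ∀ ξ ∈ tsupport (D.window k), ∀ ξ' ∈ tsupport (D.window l),
        ‖ξ - ξ'‖ ≤ ε * D.size k ^ α → l ∈ nb k) := by
  classical
  obtain ⟨C₁, hC₁⟩ := hD.size_le
  obtain ⟨C₂, hC₂⟩ := hD.le_size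
  set C := max 1 (max C₁ C₂)
  have hC : 1 ≤ C := le_max_left _ _
  have hC0 : 0 < C := zero_lt_one.trans_le hC
  have h1 : ∀ k, ∀ ξ ∈ tsupport (D.window k), D.size k ≤ C * (1 + ‖ξ‖) := fun k ξ hξ =>
    (hC₁ k ξ hξ).trans (mul_le_mul_of_nonneg_right
      ((le_max_left _ _).trans (le_max_right _ _)) (by positivity))
  have h2 : ∀ k, ∀ ξ ∈ tsupport (D.window k), 1 + ‖ξ‖ ≤ C * D.size k := fun k ξ hξ =>
    (hC₂ k ξ hξ).trans (mul_le_mul_of_nonneg_right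
      ((le_max_right _ _).trans (le_max_right _ _)) (hD.size_pos k).le)
  set ε := (2 * C)⁻¹ with hε
  have hε0 : 0 < ε := by positivity
  have hεC : C * ε = 1 / 2 := by rw [hε]; field_simp
  have hε1 : ε ≤ 1 := by
    rw [hε]
    exact inv_le_one_of_one_le₀ (by linarith)
  have hsz : ∀ k, D.size k ^ α ≤ D.size k := fun k => by
    simpa using Real.rpow_le_rpow_of_exponent_le (hD.one_le_size k) hα
  set Γ := 2 * C * (C + 1) with hΓ
  have hΓ1 : 1 ≤ Γ := by nlinarith
  have hcomp : ∀ k l, ∀ ξ ∈ tsupport (D.window k), ∀ ξ' ∈ tsupport (D.window l),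
      ‖ξ - ξ'‖ ≤ ε * D.size k ^ α → D.size l ≤ Γ * D.size k ∧ D.size k ≤ Γ * D.size l := by
    intro k l ξ hξ ξ' hξ' hd
    have hd' : ‖ξ - ξ'‖ ≤ ε * D.size k := hd.trans (by gcongr; exact hsz k)
    have hk := hD.size_pos k
    have hl := hD.size_pos l
    constructor
    · have e1 : 1 + ‖ξ'‖ ≤ C * D.size k + ε * D.size k := by
        have := norm_sub_norm_le ξ' ξ
        rw [norm_sub_rev] at this
        linarith [h2 k ξ hξ]
      calc D.size l ≤ C * (1 + ‖ξ'‖) := h1 l ξ' hξ'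
        _ ≤ C * (C * D.size k + ε * D.size k) := by gcongr
        _ ≤ Γ * D.size k := by nlinarith [mul_pos hC0 hk]
    · have e1 : D.size k ≤ C * (C * D.size l + ε * D.size k) := by
        refine (h1 k ξ hξ).trans (mul_le_mul_of_nonneg_left ?_ hC0.le)
        have := norm_sub_norm_le ξ ξ'
        linarith [h2 l ξ' hξ']
      have e2 : C * (C * D.size l + ε * D.size k) = C * C * D.size l + 1 / 2 * D.size k := by
        rw [mul_add, ← mul_assoc, ← mul_assoc, hεC]
      nlinarith [mul_pos hC0 hl]
  obtain ⟨N, hN⟩ := hD.card_le Γ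
  choose t ht htl using hN
  refine ⟨ε, Γ, N, fun k => (t k).filter fun l => D.size l ≤ Γ * D.size k ∧
    D.size k ≤ Γ * D.size l, hε0, hΓ1, fun k => (Finset.card_filter_le _ _).trans (ht k),
    fun k l hl => (Finset.mem_filter.1 hl).2, fun k l ξ hξ ξ' hξ' hd => ?_⟩
  have hc := hcomp k l ξ hξ ξ' hξ' hd
  refine Finset.mem_filter.2 ⟨htl k l hc.1 hc.2 ⟨ξ, hξ, ξ', hξ', hd.trans ?_⟩, hc⟩
  exact mul_le_of_le_one_left (Real.rpow_nonneg (hD.size_pos k).le _) hε1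

theorem sum_window_eq_one (hD : IsAdmissibleDecomposition α D) {s : Finset D.Index}
    {ξ : RSpace n} (h : ∀ l, ξ ∈ tsupport (D.window l) → l ∈ s) :
    ∑ l ∈ s, D.window l ξ = 1 :=
  (hasSum_sum_of_ne_finset_zero fun l hl => by
    by_contra hne
    exact hl (h l (subset_tsupport _ hne))).unique (hD.sum_eq_one ξ)

theorem exists_integral_norm_fourier_window_le (hD : IsAdmissibleDecomposition α D) :
    ∃ B, 0 ≤ B ∧ ∀ k, ∫ x, ‖𝓕 (D.window k) x‖ ≤ B := by
  obtain ⟨C, hC⟩ := hD.tsupport_subset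
  choose K hK using hD.deriv_le
  obtain ⟨B, hB⟩ := exists_integral_norm_fourier_le (V := RSpace n) C K
  refine ⟨max B 0, le_max_right _ _, fun k => ?_⟩
  obtain ⟨c, hc⟩ := hC k
  exact (hB (D.window k) c _ (Real.rpow_pos_of_pos (hD.size_pos k) α) (hD.smooth k) hc
    fun m ξ => hK m k ξ).trans (le_max_left _ _)

/-- Local Fourier bounds for `e^{iμ}` on the windows of an admissible decomposition. -/
theorem exists_hasFourierBound_cexp (hD : IsAdmissibleDecomposition α D)
    (hα : α ≤ 1) {s B : ℝ} {μ : RSpace n → ℝ} (hμ : ContDiff ℝ 2 μ)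
    (hB : ∀ i j k, HasFourierBound (fun ξ => D.window k ξ * (secondPartial μ i j ξ : ℂ))
      (B * D.size k ^ (2 * s - 2 * α))) :
    ∃ C, 0 ≤ C ∧ ∀ k, ∃ F : RSpace n → ℂ, HasFourierBound F (C * D.size k ^ (max s 0 * n)) ∧
      ∀ ξ ∈ tsupport (D.window k), F ξ = Complex.exp (Complex.I * (μ ξ : ℂ)) := by
  obtain ⟨ε, Γ, N, nb, hε, hΓ, hcard, hcomp, hnb⟩ := hD.exists_neighbors hα
  obtain ⟨C₀, hC₀⟩ := hD.tsupport_subset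
  obtain ⟨K, hK, hcov⟩ := exists_hasFourierBound_cexp_of_cover n
  set σ := max s 0
  have hσ : 0 ≤ σ := le_max_right _ _
  set Q := N * (|B| * Γ ^ |2 * s - 2 * α|) with hQ
  have hQ0 : 0 ≤ Q := by positivity
  set e := min (ε / (2 * Real.sqrt n + 1)) (1 / (1 + Q)) with he
  have he0 : 0 < e := lt_min (by positivity) (by positivity)
  have he1 : 2 * Real.sqrt n * e ≤ ε := by
    have h1 : e * (2 * Real.sqrt n + 1) ≤ ε := by
      rw [← le_div_iff₀ (by positivity)]
      exact min_le_left _ _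
    linarith
  have he2 : e ^ 2 * Q ≤ 1 := by
    have h1 : e * (1 + Q) ≤ 1 := by
      rw [← le_div_iff₀ (by positivity)]
      exact min_le_right _ _
    have h2 : e ≤ 1 := by nlinarith
    nlinarith
  refine ⟨(2 * (|C₀| / e) + 4) ^ n * K, by positivity, fun k => ?_⟩
  have hk := hD.size_pos k
  have hk1 := hD.one_le_size k
  set r := e * D.size k ^ (α - σ) with hr
  have hr0 : 0 < r := mul_pos he0 (Real.rpow_pos_of_pos hk _)
  obtain ⟨c, hc⟩ := hC₀ k
  have hszσ : 1 ≤ D.size k ^ σ := Real.one_le_rpow hk1 hσ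
  have hRr : D.size k ^ α = D.size k ^ σ / e * r := by
    rw [hr, Real.rpow_sub hk]
    field_simp
  set M := ⌈|C₀| / e * D.size k ^ σ⌉₊
  have hM : (M : ℝ) ≤ |C₀| / e * D.size k ^ σ + 1 :=
    (Nat.ceil_lt_add_one (by positivity)).le
  have hM' : |C₀| / e * D.size k ^ σ ≤ M := Nat.le_ceil _
  have hball : tsupport (D.window k) ⊆ Metric.closedBall c (M * r) := by
    refine hc.trans (Metric.closedBall_subset_closedBall ?_)
    calc C₀ * D.size k ^ α ≤ |C₀| * D.size k ^ α := by
          gcongr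
          exact le_abs_self _
      _ = |C₀| / e * D.size k ^ σ * r := by rw [hRr]; ring
      _ ≤ M * r := by gcongr
  set b := Q * D.size k ^ (2 * s - 2 * α) with hb
  have hH : ∀ i j, HasFourierBound
      (fun ξ => ∑ l ∈ nb k, D.window l ξ * (secondPartial μ i j ξ : ℂ)) b := fun i j => by
    refine (HasFourierBound.sum (nb k) fun l _ => hB i j l).mono ?_
    calc ∑ l ∈ nb k, B * D.size l ^ (2 * s - 2 * α)
        ≤ ∑ _l ∈ nb k, |B| * (Γ ^ |2 * s - 2 * α| * D.size k ^ (2 * s - 2 * α)) := by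
          refine Finset.sum_le_sum fun l hl => ?_
          have := hD.size_pos l
          gcongr
          · exact le_abs_self _
          · exact Real.rpow_le_mul_rpow_of_comparable this hk hΓ (hcomp k l hl).1
              (hcomp k l hl).2 _
      _ = (nb k).card * (|B| * (Γ ^ |2 * s - 2 * α| * D.size k ^ (2 * s - 2 * α))) := by
          rw [Finset.sum_const, nsmul_eq_mul]
      _ ≤ N * (|B| * (Γ ^ |2 * s - 2 * α| * D.size k ^ (2 * s - 2 * α))) := by
          gcongr
          exact_mod_cast hcard k
      _ = b := by rw [hb, hQ]; ring
  have hrb : r ^ 2 * b ≤ 1 := by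
    have h1 : r ^ 2 * b = e ^ 2 * Q * D.size k ^ (2 * (s - σ)) := by
      rw [hr, hb, mul_pow, ← Real.rpow_natCast (D.size k ^ (α - σ)), ← Real.rpow_mul hk.le]
      have : D.size k ^ (2 * (s - σ)) =
          D.size k ^ ((α - σ) * (2 : ℕ)) * D.size k ^ (2 * s - 2 * α) := by
        rw [← Real.rpow_add hk]
        congr 1
        push_cast
        ring
      rw [this]
      ring
    have h2 : D.size k ^ (2 * (s - σ)) ≤ 1 := Real.rpow_le_one_of_one_le_of_nonpos hk1 (by
      have : s ≤ σ := le_max_left _ _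
      linarith)
    rw [h1]
    exact mul_le_one₀ he2 (Real.rpow_nonneg hk.le _) h2
  obtain ⟨F, hF, hFe⟩ := hcov μ (tsupport (D.window k)) c r b M _ hμ hr0 hrb hball hH
    fun i j ξ ξ' hξ' hd => by
      rw [← Finset.sum_mul, hD.sum_window_eq_one, one_mul]
      intro l hl
      refine hnb k l ξ' hξ' ξ hl ?_
      rw [norm_sub_rev]
      refine hd.trans ?_
      have h1 : D.size k ^ (α - σ) ≤ D.size k ^ α :=
        Real.rpow_le_rpow_of_exponent_le hk1 (by linarith)
      calc 2 * Real.sqrt n * r = 2 * Real.sqrt n * e * D.size k ^ (α - σ) := by rw [hr]; ring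
        _ ≤ ε * D.size k ^ α := by gcongr
  refine ⟨F, hF.mono ?_, hFe⟩
  have h3 : (2 * M + 2 : ℝ) ≤ (2 * (|C₀| / e) + 4) * D.size k ^ σ := by
    have : 0 ≤ |C₀| / e := by positivity
    nlinarith
  calc (2 * M + 2 : ℝ) ^ n * K ≤ ((2 * (|C₀| / e) + 4) * D.size k ^ σ) ^ n * K := by gcongr
    _ = (2 * (|C₀| / e) + 4) ^ n * K * D.size k ^ (σ * n) := by
        rw [mul_pow, Real.rpow_mul hk.le, Real.rpow_natCast]
        ring

end IsAdmissibleDecomposition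

theorem exists_toTemperedDistribution_eq_of_distributionLpNorm_lt {n : ℕ} {p : ℝ≥0∞}
    [Fact (1 ≤ p)] {T : 𝓢'(RSpace n, ℂ)} {a : ℝ≥0∞} (h : distributionLpNorm p T < a) :
    ∃ f : Lp ℂ p (volume : Measure (RSpace n)), Lp.toTemperedDistribution f = T ∧ ‖f‖ₑ < a := by
  simp only [distributionLpNorm, iInf_lt_iff] at h
  obtain ⟨f, hf, hlt⟩ := h
  exact ⟨f, hf, hlt⟩

theorem le_lqNorm {ι : Type} {q : ℝ≥0∞} (hq : 1 ≤ q) (a : ι → ℝ≥0∞) (i : ι) : a i ≤ lqNorm q a := by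
  rw [lqNorm]
  split_ifs with h
  · exact le_iSup a i
  · have hq0 : 0 < q.toReal := ENNReal.toReal_pos (zero_lt_one.trans_le hq).ne' h
    rw [one_div, ENNReal.le_rpow_inv_iff hq0]
    exact ENNReal.le_tsum i

theorem lqNorm_le_mul {ι : Type} {q : ℝ≥0∞} (hq : 1 ≤ q) {a b : ι → ℝ≥0∞} {c : ℝ≥0∞}
    (h : ∀ i, a i ≤ c * b i) : lqNorm q a ≤ c * lqNorm q b := by
  rw [lqNorm, lqNorm]
  split_ifs with hq'
  · rw [ENNReal.mul_iSup]
    exact iSup_mono h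
  · have hq0 : 0 < q.toReal := ENNReal.toReal_pos (zero_lt_one.trans_le hq).ne' hq'
    calc (∑' i, a i ^ q.toReal) ^ (1 / q.toReal)
        ≤ (∑' i, c ^ q.toReal * b i ^ q.toReal) ^ (1 / q.toReal) := by
          refine ENNReal.rpow_le_rpow (ENNReal.tsum_le_tsum fun i => ?_) (by positivity)
          rw [← ENNReal.mul_rpow_of_nonneg _ _ hq0.le]
          exact ENNReal.rpow_le_rpow (h i) hq0.le
      _ = _ := by
          rw [ENNReal.tsum_mul_left, ENNReal.mul_rpow_of_nonneg _ _ (by positivity),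
            ← ENNReal.rpow_mul, mul_one_div_cancel hq0.ne', ENNReal.rpow_one]

theorem exists_toTemperedDistribution_eq_of_alphaModulationNorm_lt_top {n : ℕ} {α σ : ℝ}
    {p q : ℝ≥0∞} [Fact (1 ≤ p)] (hq : 1 ≤ q) {D : FrequencyDecomposition n}
    (hD : IsAdmissibleDecomposition α D) {f : 𝓢'(RSpace n, ℂ)}
    (hf : alphaModulationNorm D p q σ f < ⊤) :
    ∃ A, 0 ≤ A ∧ ∀ k, ∃ F : Lp ℂ p (volume : Measure (RSpace n)), Lp.toTemperedDistribution F =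
      TemperedDistribution.fourierMultiplierCLM ℂ (D.window k) f ∧ ‖F‖ ≤ A * D.size k ^ (-σ) := by
  refine ⟨(alphaModulationNorm D p q σ f).toReal + 1, by positivity, fun k => ?_⟩
  have hk := hD.size_pos k
  set T := TemperedDistribution.fourierMultiplierCLM ℂ (D.window k) f
  set A := alphaModulationNorm D p q σ f
  have hle : ENNReal.ofReal (D.size k ^ σ) * distributionLpNorm p T ≤ A :=
    le_lqNorm hq (fun k => ENNReal.ofReal (D.size k ^ σ) * distributionLpNorm p
      (TemperedDistribution.fourierMultiplierCLM ℂ (D.window k) f)) k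
  have hpos : 0 < D.size k ^ σ := Real.rpow_pos_of_pos hk σ
  have hlt : distributionLpNorm p T < ENNReal.ofReal ((A.toReal + 1) * D.size k ^ (-σ)) := by
    have h1 : ENNReal.ofReal (D.size k ^ σ) * distributionLpNorm p T <
        ENNReal.ofReal (A.toReal + 1) :=
      hle.trans_lt ((ENNReal.lt_ofReal_iff_toReal_lt hf.ne).2 (lt_add_one _))
    rw [Real.rpow_neg hk.le, ← div_eq_mul_inv, ENNReal.ofReal_div_of_pos hpos]
    rw [ENNReal.lt_div_iff_mul_lt (by simp [hpos]) (by simp), mul_comm]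
    exact h1
  obtain ⟨F, hF, hFn⟩ := exists_toTemperedDistribution_eq_of_distributionLpNorm_lt hlt
  refine ⟨F, hF, ?_⟩
  rw [← ofReal_norm, ENNReal.ofReal_lt_ofReal_iff_of_nonneg (norm_nonneg _)] at hFn
  exact hFn.le

theorem MemFourierAlphaModulation.exists_hasFourierBound {n : ℕ} {α σ : ℝ}
    {D : FrequencyDecomposition n} (hD : IsAdmissibleDecomposition α D) {h : RSpace n → ℂ}
    (hc : Continuous h) (hh : MemFourierAlphaModulation D 1 ⊤ σ h) :
    ∃ B, 0 ≤ B ∧ ∀ k, HasFourierBound (fun ξ => D.window k ξ * h ξ) (B * D.size k ^ (-σ)) := by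
  obtain ⟨-, u, hu, hfin⟩ := hh
  obtain ⟨A, hA0, hA⟩ := exists_toTemperedDistribution_eq_of_alphaModulationNorm_lt_top le_top hD hfin
  refine ⟨A, hA0, fun k => ?_⟩
  obtain ⟨f, hf, hfn⟩ := hA k
  set T := TemperedDistribution.fourierMultiplierCLM ℂ (D.window k) (𝓕⁻ u)
  have hfi : Integrable f := L1.integrable_coeFn f
  have hW : ContDiff ℝ ∞ (D.window k) := hD.smooth k
  have hcF : Continuous fun ξ => D.window k ξ * h ξ := hW.continuous.mul hc
  have hae : (fun ξ => D.window k ξ * h ξ) =ᵐ[volume] 𝓕 (f : RSpace n → ℂ) := by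
    refine ae_eq_of_integral_contDiff_smul_eq hcF.locallyIntegrable
      (continuous_fourier_of_integrable hfi).locallyIntegrable fun g hg hgc => ?_
    have hg₁ : HasCompactSupport (Complex.ofRealCLM ∘ g) := hgc.comp_left rfl
    have hg₂ : ContDiff ℝ ∞ (Complex.ofRealCLM ∘ g) := by fun_prop
    let ψ : 𝓢(RSpace n, ℂ) := hg₁.toSchwartzMap hg₂
    have hψ : ∀ ξ, ψ ξ = (g ξ : ℂ) := fun ξ => rfl
    have e1 : T (𝓕 ψ) = ∫ ξ, h ξ * (D.window k ξ * ψ ξ) := by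
      have : T (𝓕 ψ) = u (SchwartzMap.smulLeftCLM ℂ (D.window k) ψ) := by
        simp only [T, TemperedDistribution.fourierMultiplierCLM_apply_apply,
          FourierTransform.fourierInv_fourier_eq, TemperedDistribution.fourierInv_apply]
      rw [this, hu]
      · simp only [SchwartzMap.smulLeftCLM_apply_apply (hD.hasTemperateGrowth k), smul_eq_mul]
      · have : ⇑(SchwartzMap.smulLeftCLM ℂ (D.window k) ψ) = fun ξ => D.window k ξ * ψ ξ := by
          ext ξ
          rw [SchwartzMap.smulLeftCLM_apply_apply (hD.hasTemperateGrowth k), smul_eq_mul]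
        rw [this]
        exact (hD.hasCompactSupport k).mul_right
    have e2 : T (𝓕 ψ) = ∫ ξ, 𝓕 (f : RSpace n → ℂ) ξ * ψ ξ := by
      rw [← hf, Lp.toTemperedDistribution_apply, integral_fourier_mul_eq hfi ψ.integrable]
      refine integral_congr_ae (ae_of_all _ fun x => ?_)
      simp only [smul_eq_mul, SchwartzMap.fourier_coe, mul_comm]
    have e3 := e1.symm.trans e2
    simp only [hψ] at e3
    rw [show (∫ ξ, g ξ • (D.window k ξ * h ξ)) = ∫ ξ, h ξ * (D.window k ξ * (g ξ : ℂ)) from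
      integral_congr_ae (ae_of_all _ fun ξ => by simp only [Complex.real_smul]; ring), e3]
    exact integral_congr_ae (ae_of_all _ fun ξ => by simp only [Complex.real_smul]; ring)
  refine (HasFourierBound.of_fourier hfi hcF hae).mono ?_
  rw [← L1.norm_eq_integral_norm]
  exact hfn

section Young

variable {V : Type*} [NormedAddCommGroup V] [InnerProductSpace ℝ V] [FiniteDimensional ℝ V]
  [MeasurableSpace V] [BorelSpace V]

theorem ENNReal.rpow_lintegral_mul_le {X : Type*} [MeasurableSpace X] {ν : Measure X} {p : ℝ}
    (hp : 1 ≤ p) {k f : X → ℝ≥0∞} (hk : AEMeasurable k ν) (hf : AEMeasurable f ν) :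
    (∫⁻ y, k y * f y ∂ν) ^ p ≤ (∫⁻ y, k y ∂ν) ^ (p - 1) * ∫⁻ y, k y * f y ^ p ∂ν := by
  rcases hp.eq_or_lt with rfl | hp
  · simp
  have hp0 : 0 < p := zero_lt_one.trans hp
  have hpq := (Real.HolderConjugate.conjExponent hp).symm
  set q := Real.conjExponent p
  have hq0 : 0 < q := hpq.pos
  have h := ENNReal.lintegral_mul_le_Lp_mul_Lq ν hpq (f := fun y => k y ^ (1 / q))
    (g := fun y => k y ^ (1 / p) * f y) (hk.pow_const _) ((hk.pow_const _).mul hf)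
  have e1 : ∀ y, ((fun y => k y ^ (1 / q)) * fun y => k y ^ (1 / p) * f y) y = k y * f y := by
    intro y
    simp only [Pi.mul_apply, ← mul_assoc]
    rw [← ENNReal.rpow_add_of_nonneg _ _ (by positivity) (by positivity), one_div, one_div,
      hpq.inv_add_inv_eq_one, ENNReal.rpow_one]
  have e2 : ∀ y, (k y ^ (1 / q)) ^ q = k y := fun y => by
    rw [← ENNReal.rpow_mul, one_div_mul_cancel hq0.ne', ENNReal.rpow_one]
  have e3 : ∀ y, (k y ^ (1 / p) * f y) ^ p = k y * f y ^ p := fun y => by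
    rw [ENNReal.mul_rpow_of_nonneg _ _ hp0.le, ← ENNReal.rpow_mul, one_div_mul_cancel hp0.ne',
      ENNReal.rpow_one]
  simp only [e1, e2, e3] at h
  calc (∫⁻ y, k y * f y ∂ν) ^ p
      ≤ ((∫⁻ y, k y ∂ν) ^ (1 / q) * (∫⁻ y, k y * f y ^ p ∂ν) ^ (1 / p)) ^ p := by gcongr
    _ = _ := by
      rw [ENNReal.mul_rpow_of_nonneg _ _ hp0.le, ← ENNReal.rpow_mul, ← ENNReal.rpow_mul,
        one_div_mul_cancel hp0.ne', ENNReal.rpow_one]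
      congr 2
      rw [one_div, ← div_eq_inv_mul]
      have := hpq.symm.sub_one_mul_conj
      rw [div_eq_iff hq0.ne']
      linarith

/-- **Young's inequality** for convolution with an integrable function. -/
theorem eLpNorm_convolution_le {p : ℝ≥0∞} (hp : 1 ≤ p) {K f : V → ℂ} (hK : Measurable K)
    (hf : Measurable f) :
    eLpNorm (fun x => ∫ y, K y * f (x - y)) p volume ≤ (∫⁻ y, ‖K y‖ₑ) * eLpNorm f p volume := by
  have hle : ∀ x, ‖∫ y, K y * f (x - y)‖ₑ ≤ ∫⁻ y, ‖K y‖ₑ * ‖f (x - y)‖ₑ := fun x =>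
    (enorm_integral_le_lintegral_enorm _).trans (le_of_eq (by simp only [enorm_mul]))
  rcases eq_or_ne p ⊤ with rfl | hpt
  · rw [eLpNorm_exponent_top, eLpNorm_exponent_top]
    refine essSup_le_of_ae_le _ (ae_of_all _ fun x => (hle x).trans ?_)
    rw [← lintegral_mul_const _ hK.enorm]
    have h1 := (quasiMeasurePreserving_sub_left_of_right_invariant (volume : Measure V) x).ae
      (enorm_ae_le_eLpNormEssSup f (volume : Measure V))
    refine lintegral_mono_ae ?_
    filter_upwards [h1] with y hy
    gcongr
  · have hp0 : p ≠ 0 := (zero_lt_one.trans_le hp).ne'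
    have hr : 1 ≤ p.toReal := by
      rwa [← ENNReal.toReal_one, ENNReal.toReal_le_toReal ENNReal.one_ne_top hpt]
    have hr0 : 0 < p.toReal := zero_lt_one.trans_le hr
    set I := ∫⁻ y, ‖K y‖ₑ
    have hmeas : Measurable (Function.uncurry fun (x y : V) => ‖K y‖ₑ * ‖f (x - y)‖ₑ ^ p.toReal) := by
      simp only [Function.uncurry_def]
      fun_prop
    have key : ∫⁻ x, ‖∫ y, K y * f (x - y)‖ₑ ^ p.toReal ≤
        I ^ p.toReal * ∫⁻ x, ‖f x‖ₑ ^ p.toReal := by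
      calc ∫⁻ x, ‖∫ y, K y * f (x - y)‖ₑ ^ p.toReal
          ≤ ∫⁻ x, I ^ (p.toReal - 1) * ∫⁻ y, ‖K y‖ₑ * ‖f (x - y)‖ₑ ^ p.toReal := by
            refine lintegral_mono fun x => ?_
            refine (ENNReal.rpow_le_rpow (hle x) hr0.le).trans ?_
            exact ENNReal.rpow_lintegral_mul_le hr hK.enorm.aemeasurable
              (hf.comp (measurable_const.sub measurable_id)).enorm.aemeasurable
        _ = I ^ (p.toReal - 1) * ∫⁻ y, ∫⁻ x, ‖K y‖ₑ * ‖f (x - y)‖ₑ ^ p.toReal := by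
            rw [lintegral_const_mul _ hmeas.lintegral_prod_right,
              lintegral_lintegral_swap hmeas.aemeasurable]
        _ = I ^ (p.toReal - 1) * (I * ∫⁻ x, ‖f x‖ₑ ^ p.toReal) := by
            congr 1
            rw [← lintegral_mul_const _ hK.enorm]
            refine lintegral_congr fun y => ?_
            rw [lintegral_const_mul _ (by fun_prop),
              lintegral_sub_right_eq_self fun x => ‖f x‖ₑ ^ p.toReal]
        _ = _ := by
            rw [← mul_assoc]
            congr 1
            nth_rewrite 2 [← ENNReal.rpow_one I]
            rw [← ENNReal.rpow_add_of_nonneg _ _ (by linarith) zero_le_one, sub_add_cancel]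
    rw [eLpNorm_eq_lintegral_rpow_enorm_toReal hp0 hpt, eLpNorm_eq_lintegral_rpow_enorm_toReal hp0 hpt]
    calc _ ≤ (I ^ p.toReal * ∫⁻ x, ‖f x‖ₑ ^ p.toReal) ^ (1 / p.toReal) := by gcongr
      _ = _ := by
        rw [ENNReal.mul_rpow_of_nonneg _ _ (by positivity), ← ENNReal.rpow_mul,
          mul_one_div_cancel hr0.ne', ENNReal.rpow_one]

end Young

section Pairing

variable {V : Type*} [NormedAddCommGroup V] [InnerProductSpace ℝ V] [FiniteDimensional ℝ V]
  [MeasurableSpace V] [BorelSpace V] {p : ℝ≥0∞} [hp : Fact (1 ≤ p)]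

theorem lintegral_enorm_comp_add_mul_le (F : Lp ℂ p (volume : Measure V)) (θ : 𝓢(V, ℂ)) (y : V) :
    ∫⁻ x, ‖θ (x + y) * F x‖ₑ ≤ eLpNorm θ (1 - p⁻¹)⁻¹ volume * ‖F‖ₑ := by
  have := (ENNReal.HolderConjugate.inv_one_sub_inv' hp.out).symm
  have h1 : MeasurePreserving (fun x : V => x + y) volume volume := measurePreserving_add_right _ y
  have h := eLpNorm_smul_le_mul_eLpNorm (p := (1 - p⁻¹)⁻¹) (q := p) (r := 1)
    (Lp.aestronglyMeasurable F) (φ := fun x => θ (x + y))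
    ((θ.continuous.comp (continuous_id.add continuous_const)).aestronglyMeasurable)
  rw [eLpNorm_one_eq_lintegral_enorm] at h
  refine h.trans (le_of_eq ?_)
  rw [Lp.enorm_def]
  congr 1
  exact eLpNorm_comp_measurePreserving θ.continuous.aestronglyMeasurable h1

theorem toTemperedDistribution_compSubConst (F : Lp ℂ p (volume : Measure V)) (θ : 𝓢(V, ℂ))
    (y : V) : Lp.toTemperedDistribution F (θ.compSubConstCLM ℂ (-y)) =
      ∫ x, θ (x + y) * F x := by
  rw [Lp.toTemperedDistribution_apply]
  simp only [SchwartzMap.compSubConstCLM_apply, sub_neg_eq_add, smul_eq_mul]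

theorem integrable_prod_mul_comp_add_mul {K : V → ℂ} (hKc : Continuous K) (hK : Integrable K)
    (F : Lp ℂ p (volume : Measure V)) (θ : 𝓢(V, ℂ)) :
    Integrable (Function.uncurry fun y x : V => K y * (θ (x + y) * F x))
      ((volume : Measure V).prod volume) := by
  have hF : Measurable F := (Lp.stronglyMeasurable F).measurable
  have hθ : Measurable θ := θ.continuous.measurable
  have hKm := hKc.measurable
  have hmeas : Measurable (Function.uncurry fun y x : V => K y * (θ (x + y) * F x)) := by
    simp only [Function.uncurry_def]
    fun_prop
  refine ⟨hmeas.aestronglyMeasurable, ?_⟩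
  rw [hasFiniteIntegral_iff_enorm, lintegral_prod _ hmeas.enorm.aemeasurable]
  calc ∫⁻ y, ∫⁻ x, ‖K y * (θ (x + y) * F x)‖ₑ
      ≤ ∫⁻ y, ‖K y‖ₑ * (eLpNorm θ (1 - p⁻¹)⁻¹ volume * ‖F‖ₑ) := by
        refine lintegral_mono fun y => ?_
        simp only [enorm_mul (K y)]
        rw [lintegral_const_mul _ (by fun_prop)]
        gcongr
        exact lintegral_enorm_comp_add_mul_le F θ y
    _ = (∫⁻ y, ‖K y‖ₑ) * (eLpNorm θ (1 - p⁻¹)⁻¹ volume * ‖F‖ₑ) :=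
        lintegral_mul_const _ hKm.enorm
    _ < ⊤ := ENNReal.mul_lt_top (hasFiniteIntegral_iff_enorm.1 hK.2)
        (ENNReal.mul_lt_top (θ.eLpNorm_lt_top _ _) enorm_lt_top)

theorem integrable_mul_toTemperedDistribution {K : V → ℂ} (hKc : Continuous K)
    (hK : Integrable K) (F : Lp ℂ p (volume : Measure V)) (θ : 𝓢(V, ℂ)) :
    Integrable fun y => K y * Lp.toTemperedDistribution F (θ.compSubConstCLM ℂ (-y)) := by
  have := (integrable_prod_mul_comp_add_mul hKc hK F θ).integral_prod_left
  simpa only [Function.uncurry_apply_pair, integral_const_mul,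
    toTemperedDistribution_compSubConst] using this

theorem norm_integral_mul_toTemperedDistribution_le {K : V → ℂ}
    (hK : Integrable K) (F : Lp ℂ p (volume : Measure V)) (θ : 𝓢(V, ℂ)) :
    ‖∫ y, K y * Lp.toTemperedDistribution F (θ.compSubConstCLM ℂ (-y))‖ ≤
      (∫ y, ‖K y‖) * ((eLpNorm θ (1 - p⁻¹)⁻¹ volume).toReal * ‖F‖) := by
  rw [← integral_mul_const]
  refine norm_integral_le_of_norm_le (hK.norm.mul_const _) (ae_of_all _ fun y => ?_)
  refine norm_mul_le_of_le le_rfl ?_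
  rw [toTemperedDistribution_compSubConst, ← toReal_enorm, ← toReal_enorm F, ← ENNReal.toReal_mul]
  exact ENNReal.toReal_mono
    (ENNReal.mul_lt_top (θ.eLpNorm_lt_top _ _) enorm_lt_top).ne
    ((enorm_integral_le_lintegral_enorm _).trans (lintegral_enorm_comp_add_mul_le F θ y))

/-- Convolution of an integrable function with a function in `L^p`, in the weak formulation. -/
theorem exists_toTemperedDistribution_eq_convolution {K : V → ℂ} (hKc : Continuous K)
    (hK : Integrable K) (F : Lp ℂ p (volume : Measure V)) :
    ∃ H : Lp ℂ p (volume : Measure V), ‖H‖ₑ ≤ ENNReal.ofReal (∫ y, ‖K y‖) * ‖F‖ₑ ∧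
      ∀ θ : 𝓢(V, ℂ), Lp.toTemperedDistribution H θ =
        ∫ y, K y * Lp.toTemperedDistribution F (θ.compSubConstCLM ℂ (-y)) := by
  have hF : Measurable F := (Lp.stronglyMeasurable F).measurable
  have hKm := hKc.measurable
  have hY := eLpNorm_convolution_le hp.out hKm hF
  have hmeas : StronglyMeasurable (Function.uncurry fun x y : V => K y * F (x - y)) := by
    simp only [Function.uncurry_def]
    exact (by fun_prop : Measurable fun z : V × V => K z.2 * F (z.1 - z.2)).stronglyMeasurable
  have hL : MemLp (fun x => ∫ y, K y * F (x - y)) p volume :=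
    ⟨hmeas.integral_prod_right.aestronglyMeasurable, hY.trans_lt
      (ENNReal.mul_lt_top (hasFiniteIntegral_iff_enorm.1 hK.2) (Lp.memLp F).2)⟩
  refine ⟨hL.toLp, ?_, fun θ => ?_⟩
  · rw [Lp.enorm_toLp, ofReal_integral_norm_eq_lintegral_enorm hK, Lp.enorm_def]
    exact hY
  · rw [Lp.toTemperedDistribution_apply]
    have h1 : ∀ y, K y * Lp.toTemperedDistribution F (θ.compSubConstCLM ℂ (-y)) =
        ∫ x, K y * (θ x * F (x - y)) := fun y => by
      rw [toTemperedDistribution_compSubConst, integral_const_mul,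
        ← integral_sub_right_eq_self (fun x => θ (x + y) * F x) y]
      simp only [sub_add_cancel]
    have hint : Integrable (Function.uncurry fun y x : V => K y * (θ x * F (x - y)))
        ((volume : Measure V).prod volume) := by
      have h := integrable_prod_mul_comp_add_mul hKc hK F θ
      have hmp : MeasurePreserving (fun z : V × V => (z.1, z.2 - z.1))
          ((volume : Measure V).prod volume) ((volume : Measure V).prod volume) :=
        (MeasurePreserving.id volume).skew_product (g := fun y x => x - y)
          (by fun_prop) (ae_of_all _ fun y => (measurePreserving_sub_right volume y).map_eq)
      have := hmp.integrable_comp_of_integrable h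
      simpa only [Function.comp_def, Function.uncurry_def, sub_add_cancel] using this
    simp only [h1]
    rw [integral_integral_swap hint]
    refine integral_congr_ae ?_
    filter_upwards [hL.coeFn_toLp] with x hx
    rw [hx, smul_eq_mul, ← integral_const_mul]
    refine integral_congr_ae (ae_of_all _ fun y => ?_)
    simp only
    ring

theorem integral_mul_comp_add_eq_fourier {K : V → ℂ} (hK : Integrable K) (θ : 𝓢(V, ℂ)) (x : V) :
    ∫ y, K y * θ (x + y) = 𝓕 (fun ξ => 𝓕 K ξ * (𝓕⁻ θ : 𝓢(V, ℂ)) ξ) x := by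
  have hθ : ∀ y, θ (x + y) =
      𝓕 (fun ξ => Real.fourierChar (-inner ℝ ξ x) • (𝓕⁻ θ : 𝓢(V, ℂ)) ξ) y := fun y => by
    have h : 𝓕 (𝓕⁻ θ : 𝓢(V, ℂ)) = θ := FourierTransform.fourier_fourierInv_eq θ
    conv_lhs => rw [← h]
    rw [SchwartzMap.fourier_coe, Real.fourier_eq, Real.fourier_eq]
    refine integral_congr_ae (ae_of_all _ fun ξ => ?_)
    simp only
    rw [smul_smul, ← AddChar.map_add_eq_mul, inner_add_right, neg_add, add_comm]
  simp only [hθ]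
  rw [← integral_fourier_mul_eq hK
    ((Real.fourierIntegral_convergent_iff x).2 (𝓕⁻ θ : 𝓢(V, ℂ)).integrable), Real.fourier_eq]
  refine integral_congr_ae (ae_of_all _ fun ξ => ?_)
  simp only [Circle.smul_def, smul_eq_mul]
  ring

/-- The convolution of an `L^p` function with an integrable kernel, tested against `θ`, depends on
the kernel and `θ` only through the product of their Fourier transforms. -/
theorem integral_mul_toTemperedDistribution_congr {K K' : V → ℂ} (hKc : Continuous K)
    (hK : Integrable K) (hKc' : Continuous K') (hK' : Integrable K')
    (F : Lp ℂ p (volume : Measure V)) {θ θ' : 𝓢(V, ℂ)}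
    (h : ∀ ξ, 𝓕 K ξ * (𝓕⁻ θ : 𝓢(V, ℂ)) ξ = 𝓕 K' ξ * (𝓕⁻ θ' : 𝓢(V, ℂ)) ξ) :
    ∫ y, K y * Lp.toTemperedDistribution F (θ.compSubConstCLM ℂ (-y)) =
      ∫ y, K' y * Lp.toTemperedDistribution F (θ'.compSubConstCLM ℂ (-y)) := by
  have key : ∀ {K : V → ℂ} {θ : 𝓢(V, ℂ)}, Continuous K → Integrable K →
      ∫ y, K y * Lp.toTemperedDistribution F (θ.compSubConstCLM ℂ (-y)) =
        ∫ x, 𝓕 (fun ξ => 𝓕 K ξ * (𝓕⁻ θ : 𝓢(V, ℂ)) ξ) x * F x := by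
    intro K θ hKc hK
    simp only [toTemperedDistribution_compSubConst, ← integral_const_mul]
    rw [integral_integral_swap (integrable_prod_mul_comp_add_mul hKc hK F θ)]
    refine integral_congr_ae (ae_of_all _ fun x => ?_)
    simp only
    rw [← integral_mul_comp_add_eq_fourier hK, ← integral_mul_const]
    simp only [mul_assoc]
  rw [key hKc hK, key hKc' hK']
  simp only [h]

end Pairing

section SchwartzLocalization

variable {V : Type*} [NormedAddCommGroup V] [NormedSpace ℝ V]

theorem Function.HasTemperateGrowth.of_iteratedFDeriv_le {w : V → ℂ} (hw : ContDiff ℝ ∞ w)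
    {K : ℕ → ℝ} (hK : ∀ m ξ, ‖iteratedFDeriv ℝ m w ξ‖ ≤ K m) : w.HasTemperateGrowth :=
  ⟨hw, fun m => ⟨0, K m, fun ξ => by simpa using hK m ξ⟩⟩

/-- Multiplication of a Schwartz function by a smooth function with bounded derivatives which is
supported away from the ball of radius `R` gains arbitrary powers of `R`. -/
theorem exists_seminorm_smulLeftCLM_le (a b N : ℕ) (K : ℕ → ℝ) :
    ∃ C, 0 ≤ C ∧ ∀ (w : V → ℂ) (R : ℝ), 0 < R → ContDiff ℝ ∞ w →
      (∀ m ξ, ‖iteratedFDeriv ℝ m w ξ‖ ≤ K m) → (∀ ξ ∈ tsupport w, R ≤ 1 + ‖ξ‖) →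
      ∀ ψ : 𝓢(V, ℂ), SchwartzMap.seminorm ℂ a b (SchwartzMap.smulLeftCLM ℂ w ψ) ≤
        C * (R ^ N)⁻¹ * (Finset.Iic (a + N, b)).sup (schwartzSeminormFamily ℂ V ℂ) ψ := by
  refine ⟨∑ i ∈ Finset.range (b + 1), (b.choose i : ℝ) * |K i| * 2 ^ (a + N),
    Finset.sum_nonneg fun i _ => by positivity, fun w R hR hw hK hsupp ψ => ?_⟩
  set S := (Finset.Iic (a + N, b)).sup (schwartzSeminormFamily ℂ V ℂ) ψ with hS
  have hS0 : 0 ≤ S := apply_nonneg _ _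
  have hsum0 : 0 ≤ ∑ i ∈ Finset.range (b + 1), (b.choose i : ℝ) * |K i| * 2 ^ (a + N) :=
    Finset.sum_nonneg fun i _ => by positivity
  refine SchwartzMap.seminorm_le_bound ℂ a b _ (by positivity) fun ξ => ?_
  rw [SchwartzMap.smulLeftCLM_apply (.of_iteratedFDeriv_le hw hK)]
  simp only [smul_eq_mul]
  by_cases hξ : ξ ∈ tsupport w
  · have hRξ := hsupp ξ hξ
    have hder : ∀ j ≤ b, ‖ξ‖ ^ a * ‖iteratedFDeriv ℝ j ψ ξ‖ ≤ (R ^ N)⁻¹ * (2 ^ (a + N) * S) := by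
      intro j hj
      rw [le_inv_mul_iff₀ (by positivity)]
      calc R ^ N * (‖ξ‖ ^ a * ‖iteratedFDeriv ℝ j ψ ξ‖)
          ≤ (1 + ‖ξ‖) ^ N * ((1 + ‖ξ‖) ^ a * ‖iteratedFDeriv ℝ j ψ ξ‖) := by
            gcongr
            exact le_add_of_nonneg_left zero_le_one
        _ = (1 + ‖ξ‖) ^ (a + N) * ‖iteratedFDeriv ℝ j ψ ξ‖ := by rw [pow_add]; ring
        _ ≤ _ := SchwartzMap.one_add_le_sup_seminorm_apply (𝕜 := ℂ) (m := (a + N, b)) le_rfl hj ψ ξ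
    have hL := norm_iteratedFDeriv_mul_le hw (ψ.smooth ⊤) ξ (n := b) (by exact_mod_cast le_top)
    calc ‖ξ‖ ^ a * ‖iteratedFDeriv ℝ b (fun y => w y * ψ y) ξ‖
        ≤ ‖ξ‖ ^ a * ∑ i ∈ Finset.range (b + 1), (b.choose i : ℝ) * ‖iteratedFDeriv ℝ i w ξ‖ *
            ‖iteratedFDeriv ℝ (b - i) ψ ξ‖ := by gcongr
      _ = ∑ i ∈ Finset.range (b + 1), (b.choose i : ℝ) * ‖iteratedFDeriv ℝ i w ξ‖ *
            (‖ξ‖ ^ a * ‖iteratedFDeriv ℝ (b - i) ψ ξ‖) := by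
          rw [Finset.mul_sum]
          exact Finset.sum_congr rfl fun i _ => by ring
      _ ≤ ∑ i ∈ Finset.range (b + 1), (b.choose i : ℝ) * |K i| *
            ((R ^ N)⁻¹ * (2 ^ (a + N) * S)) := by
          refine Finset.sum_le_sum fun i _ => ?_
          exact mul_le_mul (mul_le_mul_of_nonneg_left ((hK i ξ).trans (le_abs_self _))
            (by positivity)) (hder _ (Nat.sub_le _ _)) (by positivity) (by positivity)
      _ = _ := by
          rw [Finset.sum_mul, Finset.sum_mul]
          exact Finset.sum_congr rfl fun i _ => by ring
  · have h0 : iteratedFDeriv ℝ b (fun y => w y * ψ y) ξ = 0 := by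
      refine image_eq_zero_of_notMem_tsupport fun h => hξ ?_
      exact closure_mono (fun y hy => left_ne_zero_of_mul hy)
        (tsupport_iteratedFDeriv_subset b h)
    rw [h0, norm_zero, mul_zero]
    positivity

theorem exists_sup_seminorm_smulLeftCLM_le (s : Finset (ℕ × ℕ)) (N : ℕ) (K : ℕ → ℝ) :
    ∃ (C : ℝ) (t : Finset (ℕ × ℕ)), 0 ≤ C ∧ ∀ (w : V → ℂ) (R : ℝ), 0 < R → ContDiff ℝ ∞ w →
      (∀ m ξ, ‖iteratedFDeriv ℝ m w ξ‖ ≤ K m) → (∀ ξ ∈ tsupport w, R ≤ 1 + ‖ξ‖) →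
      ∀ ψ : 𝓢(V, ℂ), s.sup (schwartzSeminormFamily ℂ V ℂ) (SchwartzMap.smulLeftCLM ℂ w ψ) ≤
        C * (R ^ N)⁻¹ * t.sup (schwartzSeminormFamily ℂ V ℂ) ψ := by
  classical
  choose C hC0 hC using fun ab : ℕ × ℕ => exists_seminorm_smulLeftCLM_le (V := V) ab.1 ab.2 N K
  refine ⟨∑ ab ∈ s, C ab, s.biUnion fun ab => Finset.Iic (ab.1 + N, ab.2),
    Finset.sum_nonneg fun ab _ => hC0 ab, fun w R hR hw hK hsupp ψ => ?_⟩
  have hsum0 : 0 ≤ ∑ ab ∈ s, C ab := Finset.sum_nonneg fun ab _ => hC0 ab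
  refine Seminorm.finset_sup_apply_le (mul_nonneg (by positivity) (apply_nonneg _ _))
    fun ab hab => ?_
  refine (hC ab w R hR hw hK hsupp ψ).trans ?_
  gcongr
  · exact Finset.single_le_sum (fun ab _ => hC0 ab) hab
  · exact Seminorm.le_def.1 (Finset.sup_mono (Finset.subset_biUnion_of_mem
      (fun ab : ℕ × ℕ => Finset.Iic (ab.1 + N, ab.2)) hab)) ψ

end SchwartzLocalization

section Density

variable {V : Type*} [NormedAddCommGroup V] [InnerProductSpace ℝ V] [FiniteDimensional ℝ V]

/-- Every Schwartz function is the limit of a sequence of compactly supported ones. -/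
theorem SchwartzMap.exists_tendsto_hasCompactSupport (ψ : 𝓢(V, ℂ)) :
    ∃ u : ℕ → 𝓢(V, ℂ), (∀ j, HasCompactSupport (u j)) ∧
      Filter.Tendsto u Filter.atTop (nhds ψ) := by
  let χ : ContDiffBump (0 : V) := ⟨1, 2, one_pos, one_lt_two⟩
  have hχ : ContDiff ℝ ∞ fun ξ => (χ ξ : ℂ) := Complex.ofRealCLM.contDiff.comp χ.contDiff
  have hχc : HasCompactSupport fun ξ => (χ ξ : ℂ) :=
    χ.hasCompactSupport.comp_left (g := ((↑) : ℝ → ℂ)) Complex.ofReal_zero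
  let w₀ : V → ℂ := fun ξ => 1 - (χ ξ : ℂ)
  have hw₀ : ContDiff ℝ ∞ w₀ := contDiff_const.sub hχ
  have hbd : ∀ m, ∃ C, ∀ ξ, ‖iteratedFDeriv ℝ m w₀ ξ‖ ≤ C := by
    intro m
    obtain ⟨C, hC⟩ := (hχc.iteratedFDeriv (𝕜 := ℝ) m).exists_bound_of_continuous
      (hχ.continuous_iteratedFDeriv (by exact_mod_cast le_top))
    refine ⟨1 + C, fun ξ => ?_⟩
    have h1 : w₀ = (fun _ => (1 : ℂ)) - fun ξ => (χ ξ : ℂ) := rfl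
    rw [h1, iteratedFDeriv_sub_apply contDiff_const.contDiffAt
      (hχ.of_le (by exact_mod_cast le_top)).contDiffAt]
    refine norm_sub_le_of_le ?_ (hC ξ)
    rcases m.eq_zero_or_pos with rfl | hm
    · simp
    · rw [iteratedFDeriv_const_of_ne hm.ne']
      simp
  choose K hK using hbd
  let w : ℕ → V → ℂ := fun j ξ => w₀ (((j : ℝ) + 1)⁻¹ • ξ)
  have hw : ∀ j, ContDiff ℝ ∞ (w j) := fun j => hw₀.comp (contDiff_const_smul _)
  have hwK : ∀ j m ξ, ‖iteratedFDeriv ℝ m (w j) ξ‖ ≤ K m := fun j m ξ => by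
    simp only [w]
    rw [iteratedFDeriv_comp_const_smul _ (hw₀.of_le (by exact_mod_cast le_top)), norm_smul]
    refine (mul_le_of_le_one_left (norm_nonneg _) ?_).trans (hK m _)
    rw [norm_pow, norm_inv]
    refine pow_le_one₀ (by positivity) (inv_le_one_of_one_le₀ ?_)
    rw [Real.norm_of_nonneg (by positivity)]
    exact le_add_of_nonneg_left (by positivity)
  have hws : ∀ j, ∀ ξ ∈ tsupport (w j), (j : ℝ) + 1 ≤ 1 + ‖ξ‖ := fun j ξ hξ => by
    refine closure_minimal (t := {ζ : V | (j : ℝ) + 1 ≤ 1 + ‖ζ‖}) (fun ζ hζ => ?_)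
      (isClosed_le continuous_const (continuous_const.add continuous_norm)) hξ
    simp only [Set.mem_ofPred_eq]
    by_contra! h
    refine hζ ?_
    have : χ (((j : ℝ) + 1)⁻¹ • ζ) = 1 := by
      refine χ.one_of_mem_closedBall ?_
      rw [mem_closedBall_zero_iff, norm_smul, norm_inv, Real.norm_of_nonneg (by positivity),
        inv_mul_le_iff₀ (by positivity)]
      change ‖ζ‖ ≤ _ * 1
      linarith
    simp [w, w₀, this]
  have hwt : ∀ j, (w j).HasTemperateGrowth := fun j => .of_iteratedFDeriv_le (hw j) (hwK j)
  refine ⟨fun j => ψ - SchwartzMap.smulLeftCLM ℂ (w j) ψ, fun j => ?_, ?_⟩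
  · have h1 : ⇑(ψ - SchwartzMap.smulLeftCLM ℂ (w j) ψ) =
        fun ξ => (χ (((j : ℝ) + 1)⁻¹ • ξ) : ℂ) * ψ ξ := by
      ext ξ
      simp only [sub_apply, SchwartzMap.smulLeftCLM_apply_apply (hwt j), smul_eq_mul, w, w₀]
      ring
    rw [h1]
    exact (hχc.comp_smul (by positivity)).mul_right
  · rw [(schwartz_withSeminorms ℂ V ℂ).tendsto_nhds]
    intro ab ε hε
    obtain ⟨C, hC0, hC⟩ := exists_seminorm_smulLeftCLM_le (V := V) ab.1 ab.2 1 K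
    set A := C * (Finset.Iic (ab.1 + 1, ab.2)).sup (schwartzSeminormFamily ℂ V ℂ) ψ
    have hlim : Filter.Tendsto (fun j : ℕ => A * (1 / ((j : ℝ) + 1))) Filter.atTop (nhds 0) := by
      simpa using tendsto_one_div_add_atTop_nhds_zero_nat.const_mul A
    filter_upwards [hlim.eventually_lt_const hε] with j hj
    refine lt_of_le_of_lt ?_ hj
    rw [sub_sub_cancel_left, map_neg_eq_map]
    refine (hC (w j) ((j : ℝ) + 1) (by positivity) (hw j) (hwK j) (hws j) ψ).trans (le_of_eq ?_)
    rw [pow_one, one_div]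
    ring

variable [MeasurableSpace V] [BorelSpace V]

theorem TemperedDistribution.ext_of_hasCompactSupport_fourierInv {T S : 𝓢'(V, ℂ)}
    (h : ∀ θ : 𝓢(V, ℂ), HasCompactSupport (𝓕⁻ θ : 𝓢(V, ℂ)) → T θ = S θ) : T = S := by
  ext θ
  obtain ⟨u, hu, hlim⟩ := SchwartzMap.exists_tendsto_hasCompactSupport (𝓕⁻ θ : 𝓢(V, ℂ))
  have hlim' : Filter.Tendsto (fun j => (𝓕 (u j) : 𝓢(V, ℂ))) Filter.atTop (nhds θ) := by
    have h1 := ((FourierTransform.continuous_fourier (E := 𝓢(V, ℂ)) (F := 𝓢(V, ℂ))).tendsto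
      (𝓕⁻ θ : 𝓢(V, ℂ))).comp hlim
    have h2 : 𝓕 (𝓕⁻ θ : 𝓢(V, ℂ)) = θ := FourierTransform.fourier_fourierInv_eq θ
    rw [h2] at h1
    exact h1
  refine tendsto_nhds_unique ((T.continuous.tendsto θ).comp hlim') ?_
  refine Filter.Tendsto.congr (fun j => ?_) ((S.continuous.tendsto θ).comp hlim')
  refine (h _ ?_).symm
  have h3 : 𝓕⁻ (𝓕 (u j) : 𝓢(V, ℂ)) = u j := FourierTransform.fourierInv_fourier_eq (u j)
  rw [h3]
  exact hu j

end Density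

section FrequencyLocalization

variable {V : Type*} [NormedAddCommGroup V] [InnerProductSpace ℝ V] [FiniteDimensional ℝ V]
  [MeasurableSpace V] [BorelSpace V]

namespace SchwartzMap

theorem ext_fourierInv {θ θ' : 𝓢(V, ℂ)}
    (h : ∀ ξ, (𝓕⁻ θ : 𝓢(V, ℂ)) ξ = (𝓕⁻ θ' : 𝓢(V, ℂ)) ξ) : θ = θ' := by
  have h' : (𝓕⁻ θ : 𝓢(V, ℂ)) = 𝓕⁻ θ' := SchwartzMap.ext h
  have e : ∀ θ : 𝓢(V, ℂ), 𝓕 (𝓕⁻ θ : 𝓢(V, ℂ)) = θ := fun θ =>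
    FourierTransform.fourier_fourierInv_eq θ
  rw [← e θ, h', e]

theorem fourierInv_compSubConstCLM_apply (θ : 𝓢(V, ℂ)) (y ξ : V) :
    (𝓕⁻ (θ.compSubConstCLM ℂ (-y)) : 𝓢(V, ℂ)) ξ =
      Real.fourierChar (-inner ℝ y ξ) • (𝓕⁻ θ : 𝓢(V, ℂ)) ξ := by
  rw [SchwartzMap.fourierInv_coe, SchwartzMap.fourierInv_coe, Real.fourierInv_eq,
    Real.fourierInv_eq]
  simp only [compSubConstCLM_apply, sub_neg_eq_add]
  rw [← integral_sub_right_eq_self (fun x => Real.fourierChar (inner ℝ x ξ) • θ (x + y)) y]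
  simp only [sub_add_cancel, Circle.smul_def, smul_eq_mul]
  rw [← integral_const_mul]
  refine integral_congr_ae (ae_of_all _ fun x => ?_)
  simp only
  rw [← mul_assoc, ← Circle.coe_mul, ← AddChar.map_add_eq_mul, inner_sub_left, neg_add_eq_sub]

/-- The Schwartz function whose inverse Fourier transform is that of `θ` multiplied by `w`. -/
noncomputable def fourierCutoff (w : V → ℂ) (θ : 𝓢(V, ℂ)) : 𝓢(V, ℂ) := 𝓕 (smulLeftCLM ℂ w (𝓕⁻ θ))

theorem fourierInv_fourierCutoff_apply {w : V → ℂ} (hw : w.HasTemperateGrowth) (θ : 𝓢(V, ℂ))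
    (ξ : V) : (𝓕⁻ (fourierCutoff w θ) : 𝓢(V, ℂ)) ξ = w ξ * (𝓕⁻ θ : 𝓢(V, ℂ)) ξ := by
  rw [fourierCutoff, FourierTransform.fourierInv_fourier_eq, smulLeftCLM_apply_apply hw, smul_eq_mul]

theorem fourierCutoff_compSubConstCLM {w : V → ℂ} (hw : w.HasTemperateGrowth) (θ : 𝓢(V, ℂ))
    (y : V) :
    fourierCutoff w (θ.compSubConstCLM ℂ (-y)) = (fourierCutoff w θ).compSubConstCLM ℂ (-y) :=
  ext_fourierInv fun ξ => by
    simp only [fourierInv_fourierCutoff_apply hw, fourierInv_compSubConstCLM_apply,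
      Circle.smul_def, smul_eq_mul]
    ring

end SchwartzMap

namespace TemperedDistribution

open SchwartzMap

theorem fourierMultiplierCLM_apply_compSubConstCLM {w : V → ℂ} (hw : w.HasTemperateGrowth)
    (f : 𝓢'(V, ℂ)) (θ : 𝓢(V, ℂ)) (y : V) :
    fourierMultiplierCLM ℂ w f (θ.compSubConstCLM ℂ (-y)) =
      f ((fourierCutoff w θ).compSubConstCLM ℂ (-y)) := by
  rw [← fourierCutoff_compSubConstCLM hw, fourierMultiplierCLM_apply_apply, fourierCutoff]

theorem fourierMultiplierCLM_apply_compSubConstCLM_congr {w : V → ℂ} (hw : w.HasTemperateGrowth)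
    (f : 𝓢'(V, ℂ)) {θ θ' : 𝓢(V, ℂ)}
    (h : ∀ ξ, w ξ * (𝓕⁻ θ : 𝓢(V, ℂ)) ξ = w ξ * (𝓕⁻ θ' : 𝓢(V, ℂ)) ξ) (y : V) :
    fourierMultiplierCLM ℂ w f (θ.compSubConstCLM ℂ (-y)) =
      fourierMultiplierCLM ℂ w f (θ'.compSubConstCLM ℂ (-y)) := by
  have : fourierCutoff w θ = fourierCutoff w θ' := ext_fourierInv fun ξ => by
    simp only [fourierInv_fourierCutoff_apply hw, h]
  rw [fourierMultiplierCLM_apply_compSubConstCLM hw, fourierMultiplierCLM_apply_compSubConstCLM hw,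
    this]

theorem apply_compSubConstCLM_eq_sum {ι : Type*} {η : ι → V → ℂ}
    (hη : ∀ k, (η k).HasTemperateGrowth) (f : 𝓢'(V, ℂ)) {θ : 𝓢(V, ℂ)} {A : Finset ι}
    (h : ∀ ξ, (𝓕⁻ θ : 𝓢(V, ℂ)) ξ ≠ 0 → ∑ k ∈ A, η k ξ = 1) (y : V) :
    f (θ.compSubConstCLM ℂ (-y)) =
      ∑ k ∈ A, fourierMultiplierCLM ℂ (η k) f (θ.compSubConstCLM ℂ (-y)) := by
  have h1 : θ = fourierCutoff (fun ξ => ∑ k ∈ A, η k ξ) θ := ext_fourierInv fun ξ => by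
    rw [fourierInv_fourierCutoff_apply (.sum fun k _ => hη k)]
    by_cases hξ : (𝓕⁻ θ : 𝓢(V, ℂ)) ξ = 0
    · rw [hξ, mul_zero]
    · rw [h ξ hξ, one_mul]
  conv_lhs => rw [h1]
  rw [← fourierMultiplierCLM_apply_compSubConstCLM (.sum fun k _ => hη k),
    fourierMultiplierCLM_sum ℂ fun k _ => hη k]
  simp

variable {p : ℝ≥0∞} [Fact (1 ≤ p)] {f : 𝓢'(V, ℂ)} {w w' m : V → ℂ}
  {F : Lp ℂ p (volume : Measure V)}

/-- The convolution of a frequency localized part of a distribution with a kernel depends only on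
the Fourier transform of the kernel near the frequencies in question. -/
theorem integral_mul_toTemperedDistribution_eq_of_localized (hw : w.HasTemperateGrowth)
    (hw' : w'.HasTemperateGrowth) (hww' : ∀ ξ, w ξ * w' ξ = w ξ)
    (hF : Lp.toTemperedDistribution F = fourierMultiplierCLM ℂ w f)
    {K K' : V → ℂ} (hKc : Continuous K) (hK : Integrable K) (hKc' : Continuous K')
    (hK' : Integrable K') (hKw' : ∀ ξ, 𝓕 K' ξ = w' ξ * m ξ) {θ : 𝓢(V, ℂ)}
    (hKm : ∀ ξ, (𝓕⁻ θ : 𝓢(V, ℂ)) ξ ≠ 0 → 𝓕 K ξ = m ξ) :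
    ∫ y, K y * Lp.toTemperedDistribution F (θ.compSubConstCLM ℂ (-y)) =
      ∫ y, K' y * Lp.toTemperedDistribution F (θ.compSubConstCLM ℂ (-y)) := by
  have h1 : ∀ y, Lp.toTemperedDistribution F (θ.compSubConstCLM ℂ (-y)) =
      Lp.toTemperedDistribution F ((fourierCutoff w' θ).compSubConstCLM ℂ (-y)) := fun y => by
    rw [hF]
    refine fourierMultiplierCLM_apply_compSubConstCLM_congr hw f (fun ξ => ?_) y
    rw [fourierInv_fourierCutoff_apply hw', ← mul_assoc, hww']
  rw [← integral_mul_toTemperedDistribution_congr hKc hK hKc' hK' F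
    (θ := fourierCutoff w' θ) (θ' := θ)]
  · simp only [h1]
  · intro ξ
    rw [fourierInv_fourierCutoff_apply hw', hKw']
    by_cases hξ : (𝓕⁻ θ : 𝓢(V, ℂ)) ξ = 0
    · simp [hξ]
    · rw [hKm ξ hξ]
      ring

theorem norm_integral_mul_toTemperedDistribution_le_of_localized (hw : w.HasTemperateGrowth)
    (hw' : w'.HasTemperateGrowth) (hww' : ∀ ξ, w ξ * w' ξ = w ξ)
    (hF : Lp.toTemperedDistribution F = fourierMultiplierCLM ℂ w f)
    {K : V → ℂ} (hK : Integrable K) (θ : 𝓢(V, ℂ)) :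
    ‖∫ y, K y * Lp.toTemperedDistribution F (θ.compSubConstCLM ℂ (-y))‖ ≤ (∫ y, ‖K y‖) *
      ((eLpNorm (fourierCutoff w' θ) (1 - p⁻¹)⁻¹ volume).toReal * ‖F‖) := by
  refine le_trans (le_of_eq ?_)
    (norm_integral_mul_toTemperedDistribution_le hK F (fourierCutoff w' θ))
  congr 2
  ext y
  rw [hF, fourierMultiplierCLM_apply_compSubConstCLM_congr hw f (fun ξ => ?_) y]
  rw [fourierInv_fourierCutoff_apply hw', ← mul_assoc, hww']

/-- Convolution of a distribution with a kernel, for frequencies in a compact set, is the sum of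
the convolutions of its frequency localized parts with localized kernels. -/
theorem integral_mul_eq_tsum_of_localized {ι : Type*} {η η' : ι → V → ℂ}
    (hη : ∀ k, (η k).HasTemperateGrowth) (hη' : ∀ k, (η' k).HasTemperateGrowth)
    (hηη' : ∀ k ξ, η k ξ * η' k ξ = η k ξ) {F : ι → Lp ℂ p (volume : Measure V)}
    (hF : ∀ k, Lp.toTemperedDistribution (F k) = fourierMultiplierCLM ℂ (η k) f)
    {K' : ι → V → ℂ} (hKc' : ∀ k, Continuous (K' k)) (hK' : ∀ k, Integrable (K' k))
    (hKη' : ∀ k ξ, 𝓕 (K' k) ξ = η' k ξ * m ξ)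
    {K : V → ℂ} (hKc : Continuous K) (hK : Integrable K) {θ : 𝓢(V, ℂ)}
    (hKm : ∀ ξ, (𝓕⁻ θ : 𝓢(V, ℂ)) ξ ≠ 0 → 𝓕 K ξ = m ξ) {A : Finset ι}
    (hA : ∀ ξ, (𝓕⁻ θ : 𝓢(V, ℂ)) ξ ≠ 0 → ∑ k ∈ A, η k ξ = 1)
    (hA' : ∀ ξ, (𝓕⁻ θ : 𝓢(V, ℂ)) ξ ≠ 0 → ∀ k ∉ A, η k ξ = 0) :
    Integrable (fun y => K y * f (θ.compSubConstCLM ℂ (-y))) ∧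
      ∫ y, K y * f (θ.compSubConstCLM ℂ (-y)) =
        ∑' k, ∫ y, K' k y * Lp.toTemperedDistribution (F k) (θ.compSubConstCLM ℂ (-y)) := by
  simp only [apply_compSubConstCLM_eq_sum hη f hA, Finset.mul_sum, ← hF]
  have hint : ∀ k ∈ A, Integrable fun y =>
      K y * Lp.toTemperedDistribution (F k) (θ.compSubConstCLM ℂ (-y)) :=
    fun k _ => integrable_mul_toTemperedDistribution hKc hK _ _
  refine ⟨integrable_finsetSum _ hint, ?_⟩
  rw [integral_finsetSum _ hint, tsum_eq_sum (s := A)]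
  · exact Finset.sum_congr rfl fun k _ => integral_mul_toTemperedDistribution_eq_of_localized
      (hη k) (hη' k) (hηη' k) (hF k) hKc hK (hKc' k) (hK' k) (hKη' k) hKm
  · intro k hk
    have h0 : ∀ y, Lp.toTemperedDistribution (F k) (θ.compSubConstCLM ℂ (-y)) = 0 := fun y => by
      rw [hF, fourierMultiplierCLM_apply_compSubConstCLM_congr (θ' := 0) (hη k) f (fun ξ => ?_) y,
        map_zero, map_zero]
      have hz : (𝓕⁻ (0 : 𝓢(V, ℂ)) : 𝓢(V, ℂ)) = 0 := FourierTransform.fourierInv_zero ..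
      rw [hz, zero_apply, mul_zero]
      by_cases hξ : (𝓕⁻ θ : 𝓢(V, ℂ)) ξ = 0
      · rw [hξ, mul_zero]
      · rw [hA' ξ hξ k hk, zero_mul]
    simp [h0]

end TemperedDistribution

/-- The kernel of a compactly supported continuous symbol with integrable Fourier transform. -/
theorem fourier_fourierInv_eq_of_hasCompactSupport {G : V → ℂ} (hG : Continuous G)
    (hGc : HasCompactSupport G) (hI : Integrable (𝓕⁻ G)) :
    Continuous (𝓕⁻ G) ∧ 𝓕 (𝓕⁻ G) = G := by
  have hGi : Integrable G := hG.integrable_of_hasCompactSupport hGc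
  refine ⟨continuous_fourierInv_of_integrable hGi, hG.fourier_fourierInv_eq hGi ?_⟩
  have : 𝓕 G = fun x => 𝓕⁻ G (-x) := by
    ext x
    rw [Real.fourierInv_eq_fourier_neg, neg_neg]
  rw [this]
  exact hI.comp_neg

end FrequencyLocalization

section Continuity

variable {V : Type*} [NormedAddCommGroup V] [InnerProductSpace ℝ V]

theorem SchwartzMap.exists_sup_seminorm_le (L : 𝓢(V, ℂ) →L[ℂ] 𝓢(V, ℂ)) (s : Finset (ℕ × ℕ)) :
    ∃ (C : ℝ) (t : Finset (ℕ × ℕ)), 0 ≤ C ∧ ∀ ψ, s.sup (schwartzSeminormFamily ℂ V ℂ) (L ψ) ≤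
      C * t.sup (schwartzSeminormFamily ℂ V ℂ) ψ := by
  have hs : Continuous ⇑(s.sup (schwartzSeminormFamily ℂ V ℂ)) :=
    Seminorm.continuous_finsetSup fun i _ => (schwartz_withSeminorms ℂ V ℂ).continuous_seminorm i
  obtain ⟨t, C, -, hC⟩ := Seminorm.bound_of_continuous (schwartz_withSeminorms ℂ V ℂ)
    ((s.sup (schwartzSeminormFamily ℂ V ℂ)).comp L.toLinearMap) (hs.comp L.continuous)
  exact ⟨C, t, C.coe_nonneg, fun ψ => hC ψ⟩

variable [FiniteDimensional ℝ V] [MeasurableSpace V] [BorelSpace V]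

theorem Real.fourierInv_sum {ι : Type*} {A : Finset ι} {G : ι → V → ℂ}
    (hG : ∀ k ∈ A, Integrable (G k)) :
    𝓕⁻ (fun ξ => ∑ k ∈ A, G k ξ) = fun x => ∑ k ∈ A, 𝓕⁻ (G k) x := by
  ext x
  simp only [Real.fourierInv_eq, Finset.smul_sum]
  refine integral_finsetSum _ fun k hk => ?_
  simpa [inner_neg_right] using (Real.fourierIntegral_convergent_iff (-x)).2 (hG k hk)

end Continuity

namespace IsAdmissibleDecomposition

variable {n : ℕ} {α : ℝ} {D : FrequencyDecomposition n}

theorem exists_finset_of_isCompact (hD : IsAdmissibleDecomposition α D) {S : Set (RSpace n)}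
    (hS : IsCompact S) :
    ∃ A : Finset D.Index, ∀ ξ ∈ S, ∀ l, ξ ∈ tsupport (D.window l) → l ∈ A := by
  obtain ⟨C, hC⟩ := hD.size_le
  obtain ⟨R, hR⟩ := hS.isBounded.exists_norm_le
  obtain ⟨N, hN⟩ := hD.summable
  set M := max 1 (|C| * (1 + R))
  have hM : 0 < M := zero_lt_one.trans_le (le_max_left _ _)
  have hfin : {l | D.size l ≤ M}.Finite := by
    have h := hN.tendsto_cofinite_zero.eventually_lt_const
      (show (0 : ℝ) < (M ^ N)⁻¹ by positivity)
    refine (Filter.eventually_cofinite.1 h).subset fun l hl => ?_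
    simp only [Set.mem_ofPred_eq, not_lt] at hl ⊢
    have := hD.size_pos l
    gcongr
  refine ⟨hfin.toFinset, fun ξ hξ l hl => ?_⟩
  simp only [Set.Finite.mem_toFinset, Set.mem_ofPred_eq]
  refine ((hC l ξ hl).trans ?_).trans (le_max_right _ _)
  have := hR ξ hξ
  gcongr
  exact le_abs_self C

variable {m : RSpace n → ℂ} {C σ : ℝ}

theorem window_mul_eq {k : D.Index} {F : RSpace n → ℂ}
    (hF : ∀ ξ ∈ tsupport (D.window k), F ξ = m ξ) (ξ : RSpace n) :
    D.window k ξ * m ξ = D.window k ξ * F ξ := by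
  by_cases h : ξ ∈ tsupport (D.window k)
  · rw [hF ξ h]
  · rw [image_eq_zero_of_notMem_tsupport h, zero_mul, zero_mul]

theorem integrable_fourierInv_mul (hD : IsAdmissibleDecomposition α D)
    (hm : ∀ k, ∃ F, HasFourierBound F (C * D.size k ^ σ) ∧
      ∀ ξ ∈ tsupport (D.window k), F ξ = m ξ)
    {φ : RSpace n → ℂ} (hφ : ContDiff ℝ ∞ φ) (hφc : HasCompactSupport φ) :
    Integrable (𝓕⁻ fun ξ => φ ξ * m ξ) := by
  choose F hF hFm using hm
  obtain ⟨A, hA⟩ := hD.exists_finset_of_isCompact hφc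
  have h1 : (fun ξ => φ ξ * m ξ) = fun ξ => ∑ k ∈ A, φ ξ * D.window k ξ * F k ξ := by
    ext ξ
    simp only [mul_assoc, ← window_mul_eq (hFm _)]
    rw [← Finset.mul_sum, ← Finset.sum_mul]
    by_cases hξ : ξ ∈ tsupport φ
    · rw [hD.sum_window_eq_one (hA ξ hξ), one_mul]
    · rw [image_eq_zero_of_notMem_tsupport hξ, zero_mul, zero_mul]
  have hs : ∀ k, ContDiff ℝ ∞ fun ξ => φ ξ * D.window k ξ := fun k => hφ.mul (hD.smooth k)
  have hc : ∀ k, HasCompactSupport fun ξ => φ ξ * D.window k ξ := fun k => hφc.mul_right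
  rw [h1, Real.fourierInv_sum (G := fun k ξ => φ ξ * D.window k ξ * F k ξ) fun k _ => ((hs k).continuous.mul
    (hF k).continuous).integrable_of_hasCompactSupport (hc k).mul_right]
  exact integrable_finsetSum _ fun k _ =>
    ((hF k).integrable_fourierInv_mul ((hc k).toSchwartzMap (hs k))).1

theorem exists_integral_norm_fourierInv_window_mul_le (hD : IsAdmissibleDecomposition α D)
    (hm : ∀ k, ∃ F, HasFourierBound F (C * D.size k ^ σ) ∧
      ∀ ξ ∈ tsupport (D.window k), F ξ = m ξ) :
    ∃ B, 0 ≤ B ∧ ∀ k, Integrable (𝓕⁻ fun ξ => D.window k ξ * m ξ) ∧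
      ∫ x, ‖𝓕⁻ (fun ξ => D.window k ξ * m ξ) x‖ ≤ B * D.size k ^ σ := by
  obtain ⟨B, hB0, hB⟩ := hD.exists_integral_norm_fourier_window_le
  refine ⟨|C| * B, by positivity, fun k => ?_⟩
  obtain ⟨F, hF, hFm⟩ := hm k
  have hk := Real.rpow_pos_of_pos (hD.size_pos k) σ
  simp only [window_mul_eq hFm]
  obtain ⟨h1, h2⟩ := hF.integrable_fourierInv_mul
    ((hD.hasCompactSupport k).toSchwartzMap (hD.smooth k))
  refine ⟨h1, h2.trans ?_⟩
  calc C * D.size k ^ σ * ∫ x, ‖𝓕 (D.window k) x‖ ≤ |C| * D.size k ^ σ * B := by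
        gcongr
        · exact le_abs_self C
        · exact hB k
    _ = _ := by ring

/-- The kernels of a multiplier localized by unions of boundedly many windows. -/
theorem exists_integral_norm_fourierInv_sum_window_mul_le (hD : IsAdmissibleDecomposition α D)
    (hmc : Continuous m)
    (hm : ∀ k, ∃ F, HasFourierBound F (C * D.size k ^ σ) ∧
      ∀ ξ ∈ tsupport (D.window k), F ξ = m ξ)
    {Γ : ℝ} {N : ℕ} {nb : D.Index → Finset D.Index} (hΓ : 1 ≤ Γ) (hcard : ∀ k, (nb k).card ≤ N)
    (hcomp : ∀ k, ∀ l ∈ nb k, D.size l ≤ Γ * D.size k ∧ D.size k ≤ Γ * D.size l) :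
    ∃ B, 0 ≤ B ∧ ∀ k, Integrable (𝓕⁻ fun ξ => (∑ l ∈ nb k, D.window l ξ) * m ξ) ∧
      ∫ x, ‖𝓕⁻ (fun ξ => (∑ l ∈ nb k, D.window l ξ) * m ξ) x‖ ≤ B * D.size k ^ σ := by
  obtain ⟨B, hB0, hB⟩ := hD.exists_integral_norm_fourierInv_window_mul_le hm
  refine ⟨N * (B * Γ ^ |σ|), by positivity, fun k => ?_⟩
  have hk := Real.rpow_pos_of_pos (hD.size_pos k) σ
  simp only [Finset.sum_mul]
  rw [Real.fourierInv_sum (G := fun l ξ => D.window l ξ * m ξ) fun l _ => ((hD.smooth l).continuous.mul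
    hmc).integrable_of_hasCompactSupport (hD.hasCompactSupport l).mul_right]
  refine ⟨integrable_finsetSum _ fun l _ => (hB l).1, ?_⟩
  calc ∫ x, ‖∑ l ∈ nb k, 𝓕⁻ (fun ξ => D.window l ξ * m ξ) x‖
      ≤ ∫ x, ∑ l ∈ nb k, ‖𝓕⁻ (fun ξ => D.window l ξ * m ξ) x‖ :=
        integral_mono (integrable_finsetSum _ fun l _ => (hB l).1).norm
          (integrable_finsetSum _ fun l _ => (hB l).1.norm) fun x => norm_sum_le _ _
    _ = ∑ l ∈ nb k, ∫ x, ‖𝓕⁻ (fun ξ => D.window l ξ * m ξ) x‖ :=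
        integral_finsetSum _ fun l _ => (hB l).1.norm
    _ ≤ ∑ l ∈ nb k, B * (Γ ^ |σ| * D.size k ^ σ) := Finset.sum_le_sum fun l hl =>
        (hB l).2.trans (mul_le_mul_of_nonneg_left (Real.rpow_le_mul_rpow_of_comparable
          (hD.size_pos l) (hD.size_pos k) hΓ (hcomp k l hl).1 (hcomp k l hl).2 σ) hB0)
    _ = (nb k).card * (B * (Γ ^ |σ| * D.size k ^ σ)) := by rw [Finset.sum_const, nsmul_eq_mul]
    _ ≤ N * (B * (Γ ^ |σ| * D.size k ^ σ)) := by
        gcongr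
        exact hcard k
    _ = _ := by ring

/-- The frequency localized parts of a Schwartz function decay rapidly in the frequency. -/
theorem exists_eLpNorm_fourierCutoff_sum_window_le (hD : IsAdmissibleDecomposition α D)
    (hα : 0 ≤ α) {Γ : ℝ} {N : ℕ} {nb : D.Index → Finset D.Index} (hΓ : 1 ≤ Γ)
    (hcard : ∀ k, (nb k).card ≤ N)
    (hcomp : ∀ k, ∀ l ∈ nb k, D.size l ≤ Γ * D.size k ∧ D.size k ≤ Γ * D.size l)
    (r : ℝ≥0∞) (M : ℕ) :
    ∃ (C : ℝ) (t : Finset (ℕ × ℕ)), 0 ≤ C ∧ ∀ k (θ : 𝓢(RSpace n, ℂ)),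
      (eLpNorm (SchwartzMap.fourierCutoff (fun ξ => ∑ l ∈ nb k, D.window l ξ) θ) r volume).toReal ≤
        C * (D.size k ^ M)⁻¹ * t.sup (schwartzSeminormFamily ℂ (RSpace n) ℂ) θ := by
  obtain ⟨C₀, hC₀⟩ := hD.size_le
  set A := max 1 C₀
  have hA : 0 < A := zero_lt_one.trans_le (le_max_left _ _)
  choose K hK using hD.deriv_le
  obtain ⟨d, c, hc⟩ := SchwartzMap.eLpNorm_le_seminorm ℂ (E := RSpace n) ℂ r volume
  obtain ⟨C₁, t₁, hC₁, h₁⟩ := SchwartzMap.exists_sup_seminorm_le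
    (FourierTransform.fourierCLM ℂ 𝓢(RSpace n, ℂ)) (Finset.Iic (d, 0))
  obtain ⟨C₂, t₂, hC₂, h₂⟩ := exists_sup_seminorm_smulLeftCLM_le (V := RSpace n) t₁ M
    fun j => |K j|
  obtain ⟨C₃, t₃, hC₃, h₃⟩ := SchwartzMap.exists_sup_seminorm_le
    (FourierTransform.fourierInvCLM ℂ 𝓢(RSpace n, ℂ)) t₂
  refine ⟨c * (C₁ * (N * (C₂ * (A * Γ) ^ M * C₃))), t₃, by positivity, fun k θ => ?_⟩
  have hk := hD.size_pos k
  have hKj : ∀ l j ξ, ‖iteratedFDeriv ℝ j (D.window l) ξ‖ ≤ |K j| := fun l j ξ => by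
    have h1 : 1 ≤ (D.size l ^ α) ^ j := one_le_pow₀ (Real.one_le_rpow (hD.one_le_size l) hα)
    calc _ ≤ K j * ((D.size l ^ α) ^ j)⁻¹ := hK j l ξ
      _ ≤ |K j| * ((D.size l ^ α) ^ j)⁻¹ := by gcongr; exact le_abs_self _
      _ ≤ |K j| := mul_le_of_le_one_right (abs_nonneg _) (inv_le_one_of_one_le₀ h1)
  set ψ : 𝓢(RSpace n, ℂ) := 𝓕⁻ θ
  set S := t₃.sup (schwartzSeminormFamily ℂ (RSpace n) ℂ) θ
  have hS : 0 ≤ S := apply_nonneg _ _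
  have hψ : t₂.sup (schwartzSeminormFamily ℂ (RSpace n) ℂ) ψ ≤ C₃ * S := h₃ θ
  have hl : ∀ l ∈ nb k, t₁.sup (schwartzSeminormFamily ℂ (RSpace n) ℂ)
      (SchwartzMap.smulLeftCLM ℂ (D.window l) ψ) ≤
      C₂ * (A * Γ) ^ M * C₃ * ((D.size k ^ M)⁻¹ * S) := fun l hl => by
    have hlp := hD.size_pos l
    refine (h₂ (D.window l) (D.size l / A) (by positivity) (hD.smooth l) (hKj l)
      (fun ξ hξ => ?_) ψ).trans ?_
    · rw [div_le_iff₀' hA]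
      refine (hC₀ l ξ hξ).trans ?_
      gcongr
      exact le_max_right _ _
    · have h4 : ((D.size l / A) ^ M)⁻¹ ≤ (A * Γ) ^ M * (D.size k ^ M)⁻¹ := by
        rw [← inv_pow, ← inv_pow, ← mul_pow, inv_div]
        gcongr
        rw [div_le_iff₀ hlp, mul_assoc, mul_assoc, ← mul_assoc Γ]
        refine le_mul_of_one_le_right hA.le ?_
        rw [mul_right_comm, ← div_eq_mul_inv, one_le_div₀ hk]
        exact (hcomp k l hl).2
      calc _ ≤ C₂ * ((A * Γ) ^ M * (D.size k ^ M)⁻¹) * (C₃ * S) := by gcongr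
        _ = _ := by ring
  have hsum : t₁.sup (schwartzSeminormFamily ℂ (RSpace n) ℂ)
      (SchwartzMap.smulLeftCLM ℂ (fun ξ => ∑ l ∈ nb k, D.window l ξ) ψ) ≤
      N * (C₂ * (A * Γ) ^ M * C₃) * ((D.size k ^ M)⁻¹ * S) := by
    rw [SchwartzMap.smulLeftCLM_sum fun l _ => hD.hasTemperateGrowth l]
    rw [sum_apply]
    refine (Finset.le_sum_of_subadditive _ (map_zero _).le (map_add_le_add _) _ _).trans ?_
    refine (Finset.sum_le_sum hl).trans ?_
    rw [Finset.sum_const, nsmul_eq_mul, mul_assoc (N : ℝ)]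
    gcongr
    exact hcard k
  calc _ ≤ (c * ENNReal.ofReal ((Finset.Iic (d, 0)).sup (schwartzSeminormFamily ℂ (RSpace n) ℂ)
          (SchwartzMap.fourierCutoff (fun ξ => ∑ l ∈ nb k, D.window l ξ) θ))).toReal :=
        ENNReal.toReal_mono (by finiteness) (hc _)
    _ = c * (Finset.Iic (d, 0)).sup (schwartzSeminormFamily ℂ (RSpace n) ℂ)
          (SchwartzMap.fourierCutoff (fun ξ => ∑ l ∈ nb k, D.window l ξ) θ) := by
        rw [ENNReal.toReal_mul, ENNReal.coe_toReal, ENNReal.toReal_ofReal (apply_nonneg _ _)]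
    _ ≤ c * (C₁ * (N * (C₂ * (A * Γ) ^ M * C₃) * ((D.size k ^ M)⁻¹ * S))) := by
        gcongr
        exact (h₁ _).trans (mul_le_mul_of_nonneg_left hsum hC₁)
    _ = _ := by ring

end IsAdmissibleDecomposition

namespace IsAdmissibleDecomposition

variable {n : ℕ} {α : ℝ} {D : FrequencyDecomposition n} {m : RSpace n → ℂ}

theorem window_mul_sum_eq (hD : IsAdmissibleDecomposition α D) {nb : D.Index → Finset D.Index}
    (hnb : ∀ k l, ∀ ξ ∈ tsupport (D.window k), ξ ∈ tsupport (D.window l) → l ∈ nb k)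
    (k : D.Index) (ξ : RSpace n) :
    D.window k ξ * ∑ l ∈ nb k, D.window l ξ = D.window k ξ := by
  by_cases hξ : ξ ∈ tsupport (D.window k)
  · rw [hD.sum_window_eq_one fun l hl => hnb k l ξ hξ hl, mul_one]
  · rw [image_eq_zero_of_notMem_tsupport hξ, zero_mul]

/-- The sum of the convolutions of the frequency localized parts of a distribution in a modulation
space with kernels of the right size is a tempered distribution. -/
theorem exists_eq_tsum_integral_mul (hD : IsAdmissibleDecomposition α D) (hα : 0 ≤ α) {σ A B Γ : ℝ}
    {N : ℕ} {nb : D.Index → Finset D.Index} (hΓ : 1 ≤ Γ) (hcard : ∀ k, (nb k).card ≤ N)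
    (hcomp : ∀ k, ∀ l ∈ nb k, D.size l ≤ Γ * D.size k ∧ D.size k ≤ Γ * D.size l)
    (hnb : ∀ k l, ∀ ξ ∈ tsupport (D.window k), ξ ∈ tsupport (D.window l) → l ∈ nb k)
    {p : ℝ≥0∞} [Fact (1 ≤ p)] {f : 𝓢'(RSpace n, ℂ)}
    {F : D.Index → Lp ℂ p (volume : Measure (RSpace n))}
    (hF : ∀ k, Lp.toTemperedDistribution (F k) =
      TemperedDistribution.fourierMultiplierCLM ℂ (D.window k) f)
    (hA : 0 ≤ A) (hFA : ∀ k, ‖F k‖ ≤ A * D.size k ^ (-σ)) {K : D.Index → RSpace n → ℂ}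
    (hKc : ∀ k, Continuous (K k)) (hK : ∀ k, Integrable (K k)) (hB : 0 ≤ B)
    (hKB : ∀ k, ∫ y, ‖K k y‖ ≤ B * D.size k ^ σ) :
    ∃ g : 𝓢'(RSpace n, ℂ), ∀ θ, g θ =
      ∑' k, ∫ y, K k y * Lp.toTemperedDistribution (F k) (θ.compSubConstCLM ℂ (-y)) := by
  obtain ⟨M, hM⟩ := hD.summable
  obtain ⟨c, t, hc, hct⟩ := hD.exists_eLpNorm_fourierCutoff_sum_window_le hα hΓ hcard hcomp
    (1 - p⁻¹)⁻¹ M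
  let T : D.Index → 𝓢(RSpace n, ℂ) → ℂ := fun k θ =>
    ∫ y, K k y * Lp.toTemperedDistribution (F k) (θ.compSubConstCLM ℂ (-y))
  have hint := fun k θ => integrable_mul_toTemperedDistribution (hKc k) (hK k) (F k) θ
  have hTadd : ∀ k θ θ', T k (θ + θ') = T k θ + T k θ' := fun k θ θ' => by
    simp only [T, map_add, mul_add]
    exact integral_add (hint k θ) (hint k θ')
  have hTsmul : ∀ k (a : ℂ) θ, T k (a • θ) = a * T k θ := fun k a θ => by
    simp only [T, map_smul, smul_eq_mul]
    rw [← integral_const_mul]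
    exact integral_congr_ae (ae_of_all _ fun y => by simp only; ring)
  have hTle : ∀ k θ, ‖T k θ‖ ≤
      (D.size k ^ M)⁻¹ * (B * A * c * t.sup (schwartzSeminormFamily ℂ (RSpace n) ℂ) θ) := by
    intro k θ
    have hk := hD.size_pos k
    set S := t.sup (schwartzSeminormFamily ℂ (RSpace n) ℂ) θ
    have hS : 0 ≤ S := apply_nonneg _ _
    have h1 : D.size k ^ σ * D.size k ^ (-σ) = 1 := by
      rw [← Real.rpow_add hk, add_neg_cancel, Real.rpow_zero]
    calc ‖T k θ‖ ≤ _ :=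
          TemperedDistribution.norm_integral_mul_toTemperedDistribution_le_of_localized
            (hD.hasTemperateGrowth k) (.sum fun l _ => hD.hasTemperateGrowth l)
            (hD.window_mul_sum_eq hnb k) (hF k) (hK k) θ
      _ ≤ B * D.size k ^ σ * (c * (D.size k ^ M)⁻¹ * S * (A * D.size k ^ (-σ))) := by
          gcongr
          · exact hKB k
          · exact hct k θ
          · exact hFA k
      _ = (D.size k ^ σ * D.size k ^ (-σ)) * ((D.size k ^ M)⁻¹ * (B * A * c * S)) := by ring
      _ = _ := by rw [h1, one_mul]
  have hsum : ∀ θ, Summable fun k => T k θ := fun θ =>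
    .of_norm_bounded (hM.mul_right _) fun k => hTle k θ
  refine ⟨ContinuousLinearMap.toPointwiseConvergenceCLM _ _ _ _
    (SchwartzMap.mkCLMtoNormedSpace (σ := RingHom.id ℂ) (fun θ => ∑' k, T k θ)
      (fun θ θ' => ?_) (fun a θ => ?_) ⟨t, (∑' k, (D.size k ^ M)⁻¹) * (B * A * c), ?_, fun θ => ?_⟩),
    fun θ => rfl⟩
  · simp only [hTadd]
    exact (hsum θ).tsum_add (hsum θ')
  · simp only [hTsmul, tsum_mul_left, RingHom.id_apply, smul_eq_mul]
  · exact mul_nonneg (tsum_nonneg fun k => inv_nonneg.2 (pow_nonneg (hD.size_pos k).le _))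
      (by positivity)
  · rw [mul_assoc, ← tsum_mul_right]
    exact tsum_of_norm_bounded (hM.mul_right _).hasSum fun k => hTle k θ

/-- A continuous multiplier which agrees on the windows of an admissible decomposition with
Fourier transforms of measures of mass at most `C (size k)^σ` is bounded between modulation spaces
with a loss of `σ` derivatives. -/
theorem isBoundedMultiplier (hD : IsAdmissibleDecomposition α D) (hα : α ∈ Set.Icc (0 : ℝ) 1)
    {p q : ℝ≥0∞} [Fact (1 ≤ p)] (hq : 1 ≤ q) (hmc : Continuous m) {C σ : ℝ}
    (hm : ∀ k, ∃ F, HasFourierBound F (C * D.size k ^ σ) ∧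
      ∀ ξ ∈ tsupport (D.window k), F ξ = m ξ) : IsBoundedMultiplier D p q σ 0 m := by
  obtain ⟨ε, Γ, N, nb, hε, hΓ, hcard, hcomp, hnear⟩ := hD.exists_neighbors hα.2
  have hnb : ∀ k l, ∀ ξ ∈ tsupport (D.window k), ξ ∈ tsupport (D.window l) → l ∈ nb k :=
    fun k l ξ hk hl => hnear k l ξ hk ξ hl (by
      have := hD.size_pos k
      rw [sub_self, norm_zero]
      positivity)
  obtain ⟨B, hB0, hB⟩ := hD.exists_integral_norm_fourierInv_sum_window_mul_le hmc hm hΓ hcard hcomp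
  let η : D.Index → RSpace n → ℂ := fun k ξ => ∑ l ∈ nb k, D.window l ξ
  let K : D.Index → RSpace n → ℂ := fun k => 𝓕⁻ fun ξ => η k ξ * m ξ
  have hη : ∀ k, (η k).HasTemperateGrowth := fun k => .sum fun l _ => hD.hasTemperateGrowth l
  have hηs : ∀ k, ContDiff ℝ ∞ (η k) := fun k => .sum fun l _ => hD.smooth l
  have hηc : ∀ k, HasCompactSupport (η k) := fun k => by
    refine HasCompactSupport.intro ((nb k).isCompact_biUnion fun l _ => hD.hasCompactSupport l)
      fun ξ hξ => Finset.sum_eq_zero fun l hl => image_eq_zero_of_notMem_tsupport fun h => hξ ?_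
    exact Set.mem_biUnion hl h
  have hηη := hD.window_mul_sum_eq hnb
  have hK : ∀ k, Integrable (K k) := fun k => (hB k).1
  have hK' : ∀ k, Continuous (K k) ∧ 𝓕 (K k) = fun ξ => η k ξ * m ξ := fun k =>
    fourier_fourierInv_eq_of_hasCompactSupport ((hηs k).continuous.mul hmc) (hηc k).mul_right (hK k)
  refine ⟨⟨B, hB0⟩ + 1, fun f hf => ?_⟩
  obtain ⟨A, hA0, hA⟩ := exists_toTemperedDistribution_eq_of_alphaModulationNorm_lt_top hq hD hf
  choose F hF hFA using hA
  obtain ⟨g, hg⟩ := hD.exists_eq_tsum_integral_mul hα.1 hΓ hcard hcomp hnb hF hA0 hFA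
    (fun k => (hK' k).1) hK hB0 fun k => (hB k).2
  have hloc : ∀ (L : RSpace n → ℂ) (θ : 𝓢(RSpace n, ℂ)), Continuous L → Integrable L →
      HasCompactSupport (𝓕⁻ θ : 𝓢(RSpace n, ℂ)) →
      (∀ ξ ∈ tsupport (𝓕⁻ θ : 𝓢(RSpace n, ℂ)), 𝓕 L ξ = m ξ) →
      Integrable (fun y => L y * f (θ.compSubConstCLM ℂ (-y))) ∧
        g θ = ∫ y, L y * f (θ.compSubConstCLM ℂ (-y)) := by
    intro L θ hLc hL hθ hLm
    obtain ⟨A, hA⟩ := hD.exists_finset_of_isCompact hθ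
    have hsupp : ∀ ξ, (𝓕⁻ θ : 𝓢(RSpace n, ℂ)) ξ ≠ 0 → ξ ∈ tsupport (𝓕⁻ θ : 𝓢(RSpace n, ℂ)) :=
      fun ξ hξ => subset_tsupport _ hξ
    obtain ⟨h1, h2⟩ := TemperedDistribution.integral_mul_eq_tsum_of_localized
      hD.hasTemperateGrowth hη hηη hF (fun k => (hK' k).1) hK (fun k ξ => congrFun (hK' k).2 ξ)
      hLc hL (fun ξ hξ => hLm ξ (hsupp ξ hξ))
      (fun ξ hξ => hD.sum_window_eq_one (hA ξ (hsupp ξ hξ)))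
      (fun ξ hξ k hk => image_eq_zero_of_notMem_tsupport fun h => hk (hA ξ (hsupp ξ hξ) k h))
    exact ⟨h1, (hg θ).trans h2.symm⟩
  have himage : IsFourierMultiplierImage m f g := by
    intro φ θ hφ hφc hθ hφ1
    have hI := hD.integrable_fourierInv_mul hm hφ hφc
    obtain ⟨hc, hfour⟩ := fourier_fourierInv_eq_of_hasCompactSupport
      (G := fun ξ => φ ξ * m ξ) (hφ.continuous.mul hmc) hφc.mul_right hI
    refine hloc _ θ hc hI hθ fun ξ hξ => ?_
    simp only [hfour, hφ1 ξ hξ, one_mul]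
  refine ⟨g, fun g' => ⟨fun h => ?_, fun h => h ▸ himage⟩, ?_⟩
  · refine TemperedDistribution.ext_of_hasCompactSupport_fourierInv fun θ hθ => ?_
    obtain ⟨R, hR⟩ := hθ.isCompact.isBounded.exists_norm_le
    let χ : ContDiffBump (0 : RSpace n) := ⟨|R| + 1, |R| + 2, by positivity, by linarith⟩
    have hχ : ContDiff ℝ ∞ fun ξ => (χ ξ : ℂ) := Complex.ofRealCLM.contDiff.comp χ.contDiff
    have hχc : HasCompactSupport fun ξ => (χ ξ : ℂ) :=
      χ.hasCompactSupport.comp_left (g := ((↑) : ℝ → ℂ)) Complex.ofReal_zero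
    have hχ1 : ∀ ξ ∈ tsupport (𝓕⁻ θ : 𝓢(RSpace n, ℂ)), (χ ξ : ℂ) = 1 := fun ξ hξ => by
      rw [χ.one_of_mem_closedBall, Complex.ofReal_one]
      rw [mem_closedBall_zero_iff]
      exact (hR ξ hξ).trans ((le_abs_self R).trans (le_add_of_nonneg_right zero_le_one))
    rw [(h _ θ hχ hχc hθ hχ1).2, (himage _ θ hχ hχc hθ hχ1).2]
  · refine lqNorm_le_mul hq fun k => ?_
    have hk := Real.rpow_pos_of_pos (hD.size_pos k) σ
    rw [Real.rpow_zero, ENNReal.ofReal_one, one_mul]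
    have key : ∀ h : Lp ℂ p (volume : Measure (RSpace n)), Lp.toTemperedDistribution h =
        TemperedDistribution.fourierMultiplierCLM ℂ (D.window k) f →
        distributionLpNorm p (TemperedDistribution.fourierMultiplierCLM ℂ (D.window k) g) ≤
          ENNReal.ofReal ((B + 1) * D.size k ^ σ) * ‖h‖ₑ := by
      intro h hh
      obtain ⟨H, hH, hHθ⟩ := exists_toTemperedDistribution_eq_convolution (hK' k).1 (hK k) h
      have hHg : Lp.toTemperedDistribution H =
          TemperedDistribution.fourierMultiplierCLM ℂ (D.window k) g := by
        ext θ
        have hcut : ⇑(𝓕⁻ (SchwartzMap.fourierCutoff (D.window k) θ) : 𝓢(RSpace n, ℂ)) =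
            fun ξ => D.window k ξ * (𝓕⁻ θ : 𝓢(RSpace n, ℂ)) ξ :=
          funext (SchwartzMap.fourierInv_fourierCutoff_apply (hD.hasTemperateGrowth k) θ)
        rw [hHθ, TemperedDistribution.fourierMultiplierCLM_apply_apply]
        refine Eq.trans ?_ (hloc (K k) (SchwartzMap.fourierCutoff (D.window k) θ) (hK' k).1 (hK k)
          ?_ fun ξ hξ => ?_).2.symm
        · simp only [hh, TemperedDistribution.fourierMultiplierCLM_apply_compSubConstCLM
            (hD.hasTemperateGrowth k)]
        · rw [hcut]
          exact (hD.hasCompactSupport k).mul_right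
        · rw [hcut] at hξ
          have hξk : ξ ∈ tsupport (D.window k) := tsupport_mul_subset_left hξ
          rw [(hK' k).2]
          simp only [η]
          rw [hD.sum_window_eq_one fun l hl => hnb k l ξ hξk hl, one_mul]
      refine (iInf₂_le H hHg).trans (hH.trans ?_)
      gcongr
      exact (hB k).2.trans (mul_le_mul_of_nonneg_right (le_add_of_nonneg_right zero_le_one) hk.le)
    have hc : ((⟨B, hB0⟩ + 1 : ℝ≥0) : ℝ≥0∞) * (ENNReal.ofReal (D.size k ^ σ) *
        distributionLpNorm p (TemperedDistribution.fourierMultiplierCLM ℂ (D.window k) f)) =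
        ENNReal.ofReal ((B + 1) * D.size k ^ σ) *
          distributionLpNorm p (TemperedDistribution.fourierMultiplierCLM ℂ (D.window k) f) := by
      rw [← mul_assoc, ENNReal.ofReal_mul (by positivity), ← ENNReal.ofReal_coe_nnreal]
      rfl
    rw [hc]
    have hpos : ENNReal.ofReal ((B + 1) * D.size k ^ σ) ≠ 0 := by
      rw [ne_eq, ENNReal.ofReal_eq_zero, not_le]
      positivity
    rw [mul_comm, ← ENNReal.div_le_iff hpos ENNReal.ofReal_ne_top]
    refine le_iInf₂ fun h hh => ?_
    rw [ENNReal.div_le_iff hpos ENNReal.ofReal_ne_top, mul_comm]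
    exact key h hh

end IsAdmissibleDecomposition

theorem continuous_secondPartial {n : ℕ} {μ : RSpace n → ℝ} (hμ : ContDiff ℝ 2 μ) (i j : Fin n) :
    Continuous (secondPartial μ i j) :=
  (hμ.continuous_iteratedFDeriv (m := 2) le_rfl).eval_const _

theorem theorem3p1 (n : ℕ) (p q : ℝ≥0∞) [hp : Fact (1 ≤ p)] (hq : 1 ≤ q) (s α δ : ℝ)
    (hα : α ∈ Set.Icc (0 : ℝ) 1) (D : FrequencyDecomposition n) (hD : IsAlphaDecomposition α D)
    (μ : RSpace n → ℝ) (hμ : ContDiff ℝ 2 μ)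
    (hμ₂ : ∀ i j : Fin n,
      MemFourierAlphaModulation D 1 ⊤ (2 * α - 2 * s) (fun ξ => (secondPartial μ i j ξ : ℂ)))
    (hδ : max s 0 ≤ δ) :
    IsBoundedMultiplier D p q (δ * n) 0 (fun ξ => Complex.exp (Complex.I * (μ ξ : ℂ))) := by
  have hD' := hD.isAdmissibleDecomposition
  choose B hB0 hB using fun i j => MemFourierAlphaModulation.exists_hasFourierBound hD'
    (Complex.continuous_ofReal.comp (continuous_secondPartial hμ i j)) (hμ₂ i j)
  obtain ⟨C, hC0, hC⟩ := hD'.exists_hasFourierBound_cexp hα.2 (s := s)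
    (B := ∑ i, ∑ j, B i j) hμ fun i j k => (hB i j k).mono (by
      have hk := hD'.size_pos k
      rw [neg_sub]
      gcongr
      exact (Finset.single_le_sum (f := B i) (fun j _ => hB0 i j) (Finset.mem_univ j)).trans
        (Finset.single_le_sum (f := fun i => ∑ j, B i j)
          (fun i _ => Finset.sum_nonneg fun j _ => hB0 i j) (Finset.mem_univ i)))
  refine hD'.isBoundedMultiplier hα hq (C := C) (by have := hμ.continuous; fun_prop) fun k => ?_
  obtain ⟨F, hF, hFm⟩ := hC k
  refine ⟨F, hF.mono (mul_le_mul_of_nonneg_left (Real.rpow_le_rpow_of_exponent_le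
    (hD'.one_le_size k) (by gcongr)) hC0), hFm⟩
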